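/- Let $k$ be an algebraically closed field of odd characteristic $p$. Let $n=p^st$ be odd, where $s\ge 0$ and $p\nmid t$, let $\xi\in k$ be a primitive $t$-th root of unity, and let $D_n=\langle a,b\mid a^n=b^2=(ab)^2=1\rangle$ be the dihedral group of order $2n$, with $C_n=\langle a\rangle$. A Yetter–Drinfeld $kD_n$-module is a left $kD_n$-module and right $kD_n$-comodule $M$ with $\sum h_1m_0\otimes h_2m_1=\sum (h_2m)_0\otimes (h_2m)_1h_1$ for all $h\in kD_n$, $m\in M$. For $g\in D_n$ with centralizer $C(g)$ and a $kC(g)$-module $N$, let $D(N)=kD_n\otimes_{kC(g)}N$ with the coaction $x\otimes u\mapsto (x\otimes u)\otimes xgx^{-1}$ $(x\in D_n,\ u\in N)$. For $r\ge 1$ let $A_{r,i}$ be the $r\times r$ Jordan block with eigenvalue $\xi^i$ and $1$'s above the diagonal, and let $T$ be the upper triangular $r\times r$ matrix with entries $T_{ij}=(-1)^{r-i}\binom{r-i}{r-j}$. Define: * $V_{r,0}$, $V'_{r,0}$: the $kD_n$-modules of dimension $r$ on which $a$ acts by $A_{r,0}$ and $b$ acts by $T$, respectively by $-T$, with trivial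 coaction $v\mapsto v\otimes 1$; * $W_{2r,i}$: the $kD_n$-module of dimension $2r$ on which $a$ acts by $\begin{pmatrix}A_{r,i}&0\\0&A_{r,i}^{-1}\end{pmatrix}$ and $b$ by $\begin{pmatrix}0&I_r\\I_r&0\end{pmatrix}$, with trivial coaction; * $U_j$ ($j=1,2$): the one-dimensional module over $kC(b)=k\langle b\rangle$ on which $b$ acts by $(-1)^j$; * $Q_{r,j}^l$: for $1\le l\le\frac{n-1}{2}$, the module of dimension $r$ over $kC(a^l)=kC_n$ on which $a$ acts by $A_{r,j}$. Then $$\Big\{V_{r,0},\ V'_{r,0},\ W_{2r,i},\ D(U_1),\ D(U_2),\ D(Q_{r,j}^l)\ \Big|\ 1\le r\le p^s,\ 0\le j\le t-1,\ 1\le i\le\tfrac{t-1}{2},\ 1\le l\le\tfrac{n-1}{2}\Big\}$$ is a complete set of pairwise non-isomorphic finite-dimensional indecomposable Yetter–Drinfeld $kD_n$-modules: each listed module is finite-dimensional and indecomposable, no two of them are isomorphic, and every finite-dimensional indecomposable Yetter–Drinfeld $kD_n$-module is isomorphic to one of them. Equivalently, let $D(kD_n)$ be the quantum double, with basis $\phi_g\otimes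 h$ $(g,h\in D_n)$ and product $(\phi_g\otimes h)(\phi_{g'}\otimes h')=\delta_{g,hg'h^{-1}}\,\phi_g\otimes hh'$, and let $\phi_g\otimes h$ act on a Yetter–Drinfeld module by $m\mapsto\sum\phi_g((hm)_1)\,(hm)_0$. Then the listed modules form a complete set of pairwise non-isomorphic finite-dimensional indecomposable $D(kD_n)$-modules. -/

import Mathlib

open scoped TensorProduct Matrix

universe u v v' w

noncomputable section

/-! ### Yetter-Drinfeld modules over a Hopf algebra -/

/-- A (left-right) Yetter-Drinfeld module over a Hopf algebra `H` over `k`: a left `H`-module and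
right `H`-comodule `M` such that `∑ h₁ m₀ ⊗ h₂ m₁ = ∑ (h₂ m)₀ ⊗ (h₂ m)₁ h₁` for all `h`, `m`. -/
structure YetterDrinfeldModule (k : Type u) (H : Type w) [CommRing k] [Ring H]
    [HopfAlgebra k H] where
  /-- The underlying `k`-module. -/
  carrier : Type v
  [addCommGroup : AddCommGroup carrier]
  [module : Module k carrier]
  /-- The left action of `H`. -/
  act : H →ₐ[k] Module.End k carrier
  /-- The right coaction of `H`. -/
  coact : carrier →ₗ[k] carrier ⊗[k] H
  coact_counit : ∀ m : carrier,
    TensorProduct.rid k carrier ((Coalgebra.counit (R := k) (A := H)).lTensor carrier (coact m)) = m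
  coact_coassoc : ∀ m : carrier,
    TensorProduct.assoc k carrier H H (coact.rTensor H (coact m)) =
      (Coalgebra.comul (R := k) (A := H)).lTensor carrier (coact m)
  compat : ∀ (h : H) (m : carrier),
    TensorProduct.map (TensorProduct.lift act.toLinearMap) (LinearMap.mul' k H)
        (TensorProduct.tensorTensorTensorComm k H H carrier H
          (Coalgebra.comul (R := k) h ⊗ₜ[k] coact m)) =
      (LinearMap.mul' k H).lTensor carrier
        (TensorProduct.assoc k carrier H H
          ((coact ∘ₗ act.toLinearMap.flip m).rTensor H
            (TensorProduct.comm k H H (Coalgebra.comul (R := k) h))))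

namespace YetterDrinfeldModule

attribute [instance] addCommGroup module

section General

variable {k : Type u} {H : Type w} [CommRing k] [Ring H] [HopfAlgebra k H]

/-- `M` and `N` are isomorphic: there is a `k`-linear bijection that is `H`-linear and
`H`-colinear. -/
def Isomorphic (M : YetterDrinfeldModule.{u, v, w} k H)
    (N : YetterDrinfeldModule.{u, v', w} k H) : Prop :=
  ∃ e : M.carrier ≃ₗ[k] N.carrier,
    (∀ (h : H) (m : M.carrier), e (M.act h m) = N.act h (e m)) ∧
    ∀ m : M.carrier, N.coact (e m) = e.toLinearMap.rTensor H (M.coact m)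

/-- A `k`-subspace `N` of `M` is a Yetter-Drinfeld submodule if it is stable under the action and
the coaction maps `N` into (the image in `M ⊗ H` of) `N ⊗ H`. -/
def IsSubobject (M : YetterDrinfeldModule.{u, v, w} k H) (N : Submodule k M.carrier) : Prop :=
  (∀ (h : H), ∀ m ∈ N, M.act h m ∈ N) ∧
    ∀ m ∈ N, M.coact m ∈ LinearMap.range (N.subtype.rTensor H)

/-- `M` is indecomposable: it is nonzero and it is not the direct sum of two nonzero
Yetter-Drinfeld submodules. -/
def IsIndecomposable (M : YetterDrinfeldModule.{u, v, w} k H) : Prop :=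
  Nontrivial M.carrier ∧
    ∀ N₁ N₂ : Submodule k M.carrier, M.IsSubobject N₁ → M.IsSubobject N₂ → IsCompl N₁ N₂ →
      N₁ = ⊥ ∨ N₂ = ⊥

end General

/-! ### Yetter-Drinfeld modules over a group algebra -/

section GroupAlgebra

variable {k : Type u} {G : Type w} [CommRing k] [Group G]

/-- Over a group algebra the compatibility condition only has to be checked on group elements. -/
def ofRepresentation {V : Type v} [AddCommGroup V] [Module k V] (ρ : Representation k G V)
    (coact : V →ₗ[k] V ⊗[k] MonoidAlgebra k G)
    (coact_counit : ∀ m : V, TensorProduct.rid k V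
      ((Coalgebra.counit (R := k) (A := MonoidAlgebra k G)).lTensor V (coact m)) = m)
    (coact_coassoc : ∀ m : V,
      TensorProduct.assoc k V (MonoidAlgebra k G) (MonoidAlgebra k G)
          (coact.rTensor (MonoidAlgebra k G) (coact m)) =
        (Coalgebra.comul (R := k) (A := MonoidAlgebra k G)).lTensor V (coact m))
    (compat : ∀ (g : G) (m : V),
      TensorProduct.map (ρ g) (LinearMap.mulLeft k (MonoidAlgebra.single g (1 : k))) (coact m) =
        (LinearMap.mulRight k (MonoidAlgebra.single g (1 : k))).lTensor V (coact (ρ g m))) :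
    YetterDrinfeldModule.{u, v, max u w} k (MonoidAlgebra k G) where
  carrier := V
  act := ρ.asAlgebraHom
  coact := coact
  coact_counit := coact_counit
  coact_coassoc := coact_coassoc
  compat h m := by
    induction h using MonoidAlgebra.induction_linear with
    | zero => simp
    | add f g hf hg => simp only [map_add, TensorProduct.add_tmul, hf, hg]
    | single g r =>
      have h1 : ∀ z : V ⊗[k] MonoidAlgebra k G,
          TensorProduct.map (TensorProduct.lift ρ.asAlgebraHom.toLinearMap)
            (LinearMap.mul' k (MonoidAlgebra k G))
            (TensorProduct.tensorTensorTensorComm k _ _ V _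
              ((MonoidAlgebra.single g (1 : k) ⊗ₜ[k] MonoidAlgebra.single g (1 : k)) ⊗ₜ[k] z)) =
          TensorProduct.map (ρ g) (LinearMap.mulLeft k (MonoidAlgebra.single g (1 : k))) z := by
        intro z
        induction z with
        | zero => simp
        | add x y hx hy => simp only [TensorProduct.tmul_add, map_add, hx, hy]
        | tmul x y => simp
      have h2 : ∀ z : V ⊗[k] MonoidAlgebra k G,
          (LinearMap.mul' k (MonoidAlgebra k G)).lTensor V
            (TensorProduct.assoc k V _ _ (z ⊗ₜ[k] MonoidAlgebra.single g (1 : k))) =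
          (LinearMap.mulRight k (MonoidAlgebra.single g (1 : k))).lTensor V z := by
        intro z
        induction z with
        | zero => simp
        | add x y hx hy => simp only [TensorProduct.add_tmul, map_add, hx, hy]
        | tmul x y => simp
      have h3 : Coalgebra.comul (R := k) (MonoidAlgebra.single g r) =
          r • (MonoidAlgebra.single g (1 : k) ⊗ₜ[k] MonoidAlgebra.single g (1 : k)) := by
        rw [← TensorProduct.tmul_smul]
        simp
      rw [h3]
      simp only [map_smul, ← TensorProduct.smul_tmul', h1, compat, TensorProduct.comm_tmul,
        LinearMap.rTensor_tmul, h2]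
      simp

/-- A `kG`-module with the trivial coaction `v ↦ v ⊗ 1`. -/
def trivialCoaction {V : Type v} [AddCommGroup V] [Module k V] (ρ : Representation k G V) :
    YetterDrinfeldModule.{u, v, max u w} k (MonoidAlgebra k G) :=
  ofRepresentation ρ ((TensorProduct.mk k V (MonoidAlgebra k G)).flip 1)
    (by intro m; simp [MonoidAlgebra.one_def])
    (by intro m; simp [MonoidAlgebra.one_def])
    (by intro g m; simp)

/-- For `x : G` and `n` in a representation `N` of the centralizer `C(g)`, this is the element of
the induced module `kG ⊗_{kC(g)} N` that is usually written `x⁻¹ ⊗ n`. (In Mathlib, `x` acts on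
the induced module by sending the class of `y ⊗ n` to that of `y x⁻¹ ⊗ n`.) -/
def indMk (g : G) {N : Type v} [AddCommGroup N] [Module k N]
    (ρ : Representation k (Subgroup.centralizer {g}) N) (x : G) :
    N →ₗ[k] Representation.IndV (Subgroup.centralizer {g}).subtype ρ :=
  Representation.IndV.mk (Subgroup.centralizer {g}).subtype ρ x

theorem indMk_induction (g : G) {N : Type v} [AddCommGroup N] [Module k N]
    (ρ : Representation k (Subgroup.centralizer {g}) N) {P : Type*} [AddCommGroup P] [Module k P]
    (f f' : Representation.IndV (Subgroup.centralizer {g}).subtype ρ →ₗ[k] P)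
    (h : ∀ x n, f (indMk g ρ x n) = f' (indMk g ρ x n)) (m) : f m = f' m :=
  LinearMap.congr_fun (Representation.IndV.hom_ext _ _ fun x => LinearMap.ext (h x)) m

theorem ind_indMk (g : G) {N : Type v} [AddCommGroup N] [Module k N]
    (ρ : Representation k (Subgroup.centralizer {g}) N) (y x : G) (n : N) :
    ρ.ind (Subgroup.centralizer {g}).subtype y (indMk g ρ x n) = indMk g ρ (x * y⁻¹) n :=
  Representation.ind_mk _ _ y x n

/-- The coaction `x ⊗ n ↦ (x ⊗ n) ⊗ x g x⁻¹` on the induced module. -/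
def inducedCoact (g : G) {N : Type v} [AddCommGroup N] [Module k N]
    (ρ : Representation k (Subgroup.centralizer {g}) N) :
    Representation.IndV (Subgroup.centralizer {g}).subtype ρ →ₗ[k]
      Representation.IndV (Subgroup.centralizer {g}).subtype ρ ⊗[k] MonoidAlgebra k G :=
  Representation.Coinvariants.lift _
    (TensorProduct.lift
      ((Finsupp.lsum k fun x : G => LinearMap.toSpanSingleton k _
          ((TensorProduct.mk k _ (MonoidAlgebra k G)).flip
            (MonoidAlgebra.single (x⁻¹ * g * x) (1 : k)) ∘ₗ indMk g ρ x)) ∘ₗ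
        (MonoidAlgebra.coeffLinearEquiv k).toLinearMap))
    (by
      rintro ⟨c, hc⟩
      ext x n
      have hc' : c⁻¹ * g * c = g := by
        rw [Subgroup.mem_centralizer_singleton_iff] at hc
        rw [mul_assoc, ← hc, inv_mul_cancel_left]
      have hm : indMk g ρ (c * x) (ρ ⟨c, hc⟩ n) = indMk g ρ x n :=
        by
          have := Representation.Coinvariants.mk_self_apply
            (Representation.tprod ((Representation.leftRegular k G).comp
              (Subgroup.centralizer {g}).subtype) ρ) ⟨c, hc⟩
            (MonoidAlgebra.single x (1 : k) ⊗ₜ[k] n)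
          simpa [indMk] using this
      have hx : x⁻¹ * c⁻¹ * g * (c * x) = x⁻¹ * g * x := by
        simpa [mul_assoc] using congrArg (fun y => x⁻¹ * y * x) hc'
      simp [hm, hx])

theorem inducedCoact_mk (g : G) {N : Type v} [AddCommGroup N] [Module k N]
    (ρ : Representation k (Subgroup.centralizer {g}) N) (x : G) (n : N) :
    inducedCoact g ρ (indMk g ρ x n) =
      indMk g ρ x n ⊗ₜ[k] MonoidAlgebra.single (x⁻¹ * g * x) (1 : k) := by
  simp [inducedCoact, indMk]

/-- The Yetter-Drinfeld module `D(N) = kG ⊗_{kC(g)} N` of a representation `N` of the centralizer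
`C(g)` of `g`, with the coaction `x ⊗ n ↦ (x ⊗ n) ⊗ x g x⁻¹`. -/
def induced (g : G) {N : Type v} [AddCommGroup N] [Module k N]
    (ρ : Representation k (Subgroup.centralizer {g}) N) :
    YetterDrinfeldModule.{u, max u v w, max u w} k (MonoidAlgebra k G) :=
  ofRepresentation (ρ.ind (Subgroup.centralizer {g}).subtype) (inducedCoact g ρ)
    (indMk_induction g ρ ((TensorProduct.rid k _).toLinearMap ∘ₗ
        (Coalgebra.counit (R := k) (A := MonoidAlgebra k G)).lTensor _ ∘ₗ inducedCoact g ρ)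
      LinearMap.id fun x n => by simp [inducedCoact_mk])
    (indMk_induction g ρ
      ((TensorProduct.assoc k _ _ _).toLinearMap ∘ₗ
        (inducedCoact g ρ).rTensor _ ∘ₗ inducedCoact g ρ)
      ((Coalgebra.comul (R := k) (A := MonoidAlgebra k G)).lTensor _ ∘ₗ inducedCoact g ρ)
      fun x n => by simp [inducedCoact_mk])
    (fun y => indMk_induction g ρ
      (TensorProduct.map (ρ.ind (Subgroup.centralizer {g}).subtype y)
        (LinearMap.mulLeft k (MonoidAlgebra.single y (1 : k))) ∘ₗ inducedCoact g ρ)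
      ((LinearMap.mulRight k (MonoidAlgebra.single y (1 : k))).lTensor _ ∘ₗ
        inducedCoact g ρ ∘ₗ ρ.ind (Subgroup.centralizer {g}).subtype y)
      fun x n => by
        simp only [LinearMap.comp_apply, inducedCoact_mk, ind_indMk, TensorProduct.map_tmul,
          LinearMap.lTensor_tmul]
        simp [mul_assoc])

end GroupAlgebra

end YetterDrinfeldModule

/-! ### The quantum double of a group algebra -/

/-- The quantum double `D(kG)` of the group algebra of a finite group `G`. The element `d` stands
for `∑ d.coeff g h • (φ_g ⊗ h)`, where the `φ_g ⊗ h`, for `g, h : G`, are the standard basis. -/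
@[ext]
structure DrinfeldDouble (k : Type u) (G : Type w) where
  /-- The coefficient at `φ_g ⊗ h`. -/
  coeff : G → G → k

namespace DrinfeldDouble

variable {k : Type u} {G : Type w}

/-- An element of the quantum double is given by its coefficients. -/
@[simps]
def coeffEquiv (k : Type u) (G : Type w) : DrinfeldDouble k G ≃ (G → G → k) where
  toFun := coeff
  invFun := mk
  left_inv _ := rfl
  right_inv _ := rfl

instance [CommRing k] : AddCommGroup (DrinfeldDouble k G) := (coeffEquiv k G).addCommGroup

instance [CommRing k] : Module k (DrinfeldDouble k G) := (coeffEquiv k G).module k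

/-- The basis element `φ_g ⊗ h`. -/
def basis (k : Type u) {G : Type w} [CommRing k] [DecidableEq G] (g h : G) : DrinfeldDouble k G :=
  ⟨fun g' h' => if g' = g ∧ h' = h then 1 else 0⟩

/-- The product with `(φ_g ⊗ h)(φ_g' ⊗ h') = δ_{g, h g' h⁻¹} (φ_g ⊗ h h')`. -/
instance [CommRing k] [Group G] [Fintype G] : Mul (DrinfeldDouble k G) where
  mul x y := ⟨fun g h => ∑ a : G, x.coeff g a * y.coeff (a⁻¹ * g * a) (a⁻¹ * h)⟩

/-- The identity `∑ φ_g ⊗ 1`. -/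
instance [CommRing k] [Group G] [DecidableEq G] : One (DrinfeldDouble k G) where
  one := ⟨fun _ h => if h = 1 then 1 else 0⟩

theorem coeff_add [CommRing k] (x y : DrinfeldDouble k G) (g h : G) :
    (x + y).coeff g h = x.coeff g h + y.coeff g h := rfl

theorem coeff_zero [CommRing k] (g h : G) : (0 : DrinfeldDouble k G).coeff g h = 0 := rfl

theorem coeff_smul [CommRing k] (c : k) (x : DrinfeldDouble k G) (g h : G) :
    (c • x).coeff g h = c * x.coeff g h := rfl

theorem coeff_mul [CommRing k] [Group G] [Fintype G] (x y : DrinfeldDouble k G) (g h : G) :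
    (x * y).coeff g h = ∑ a : G, x.coeff g a * y.coeff (a⁻¹ * g * a) (a⁻¹ * h) := rfl

theorem coeff_one [CommRing k] [Group G] [DecidableEq G] (g h : G) :
    (1 : DrinfeldDouble k G).coeff g h = if h = 1 then 1 else 0 := rfl

variable [CommRing k] [Group G] [Fintype G] [DecidableEq G]

instance : Ring (DrinfeldDouble k G) where
  __ := (inferInstance : AddCommGroup (DrinfeldDouble k G))
  left_distrib x y z := by
    ext g h; simp only [coeff_mul, coeff_add, mul_add, Finset.sum_add_distrib]
  right_distrib x y z := by
    ext g h; simp only [coeff_mul, coeff_add, add_mul, Finset.sum_add_distrib]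
  zero_mul x := by ext g h; simp only [coeff_mul, coeff_zero, zero_mul, Finset.sum_const_zero]
  mul_zero x := by ext g h; simp only [coeff_mul, coeff_zero, mul_zero, Finset.sum_const_zero]
  one_mul x := by ext g h; simp [coeff_mul, coeff_one]
  mul_one x := by
    ext g h
    simp only [coeff_mul, coeff_one, inv_mul_eq_one]
    simp
  mul_assoc x y z := by
    ext g h
    simp only [coeff_mul, Finset.sum_mul, Finset.mul_sum]
    rw [Finset.sum_comm]
    refine Finset.sum_congr rfl fun a _ => ?_
    refine (Fintype.sum_equiv (Equiv.mulLeft a) _ _ fun b => ?_).symm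
    simp [mul_assoc]

instance : Algebra k (DrinfeldDouble k G) :=
  Algebra.ofModule
    (fun c x y => by ext g h; simp only [coeff_mul, coeff_smul, Finset.mul_sum, mul_assoc])
    (fun c x y => by ext g h; simp only [coeff_mul, coeff_smul, Finset.mul_sum, mul_left_comm])

theorem basis_mul_basis (g h g' h' : G) :
    basis k g h * basis k g' h' = if g = h * g' * h⁻¹ then basis k g (h * h') else 0 := by
  ext a b
  rw [coeff_mul, Finset.sum_eq_single h]
  · have h1 : h⁻¹ * a * h = g' ↔ a = h * g' * h⁻¹ := by
      constructor <;> rintro rfl <;> simp [mul_assoc]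
    have h2 : h⁻¹ * b = h' ↔ b = h * h' := inv_mul_eq_iff_eq_mul
    by_cases hg : g = h * g' * h⁻¹
    · rw [if_pos hg]
      simp only [basis, h1, h2, ← hg]
      by_cases ha : a = g <;> simp [ha]
    · rw [if_neg hg, coeff_zero]
      simp only [basis, h1, h2]
      by_cases ha : a = g
      · subst ha; simp [hg]
      · simp [ha]
  · intro c _ hc
    simp [basis, hc]
  · simp

end DrinfeldDouble

namespace YetterDrinfeldModule

variable {k : Type u} {G : Type w} [CommRing k] [Group G]
  (M : YetterDrinfeldModule.{u, v, max u w} k (MonoidAlgebra k G))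

/-- The action of `φ_g ∈ (kG)^*` on a Yetter-Drinfeld module: `m ↦ ∑ φ_g(m₁) m₀`, the projection
onto the component `M_g`. -/
def component (g : G) : Module.End k M.carrier :=
  (TensorProduct.rid k M.carrier).toLinearMap ∘ₗ
    (Finsupp.lapply g ∘ₗ (MonoidAlgebra.coeffLinearEquiv k).toLinearMap).lTensor M.carrier ∘ₗ
      M.coact

theorem component_component [DecidableEq G] (g g' : G) (m : M.carrier) :
    M.component g (M.component g' m) = if g = g' then M.component g m else 0 := by
  have h1 : ∀ z : M.carrier ⊗[k] MonoidAlgebra k G,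
      M.component g (TensorProduct.rid k M.carrier ((Finsupp.lapply g' ∘ₗ
        (MonoidAlgebra.coeffLinearEquiv k).toLinearMap).lTensor M.carrier z)) =
      TensorProduct.rid k M.carrier ((LinearMap.mul' k k ∘ₗ TensorProduct.map
        (Finsupp.lapply g ∘ₗ (MonoidAlgebra.coeffLinearEquiv k).toLinearMap)
        (Finsupp.lapply g' ∘ₗ (MonoidAlgebra.coeffLinearEquiv k).toLinearMap)).lTensor M.carrier
          (TensorProduct.assoc k _ _ _ (M.coact.rTensor _ z))) := by
    intro z
    induction z with
    | zero => simp
    | add x y hx hy => simp only [map_add, hx, hy]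
    | tmul x y =>
      simp only [component, LinearMap.lTensor_tmul, TensorProduct.rid_tmul, map_smul,
        LinearMap.rTensor_tmul, LinearMap.comp_apply]
      generalize M.coact x = c
      induction c with
      | zero => simp
      | add a b ha hb => simp only [map_add, TensorProduct.add_tmul, smul_add, ha, hb]
      | tmul a b => simp [smul_smul, mul_comm]
  refine (h1 (M.coact m)).trans ?_
  rw [M.coact_coassoc]
  simp only [component, LinearMap.comp_apply]
  generalize M.coact m = c
  induction c with
  | zero => simp
  | add a b ha hb => simp only [map_add, ha, hb]; split_ifs <;> simp
  | tmul a b =>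
    induction b using MonoidAlgebra.induction_linear with
    | zero => simp
    | add a b ha hb =>
      simp only [TensorProduct.tmul_add, map_add, ha, hb]; split_ifs <;> simp
    | single x r =>
      by_cases hg : g = g'
      · subst hg
        by_cases hx : x = g <;> simp [hx]
      · by_cases hx : x = g
        · subst hx; simp [hg]
        · simp [hg, hx]

theorem sum_component [Fintype G] (m : M.carrier) : ∑ g : G, M.component g m = m := by
  conv_rhs => rw [← M.coact_counit m]
  simp only [component, LinearMap.comp_apply]
  generalize M.coact m = c
  induction c with
  | zero => simp
  | add a b ha hb => simp only [map_add, Finset.sum_add_distrib, ha, hb]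
  | tmul a b =>
    induction b using MonoidAlgebra.induction_linear with
    | zero => simp
    | add a b ha hb =>
      simp only [TensorProduct.tmul_add, map_add, Finset.sum_add_distrib, ha, hb]
    | single x r =>
      classical
      simp [Finsupp.single_apply]

theorem component_act (g h : G) (m : M.carrier) :
    M.component g (M.act (MonoidAlgebra.single h 1) m) =
      M.act (MonoidAlgebra.single h 1) (M.component (h⁻¹ * g * h) m) := by
  have h1 : ∀ z : M.carrier ⊗[k] MonoidAlgebra k G,
      TensorProduct.rid k M.carrier ((Finsupp.lapply (g * h) ∘ₗ
        (MonoidAlgebra.coeffLinearEquiv k).toLinearMap).lTensor M.carrier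
          (TensorProduct.map (TensorProduct.lift M.act.toLinearMap)
            (LinearMap.mul' k (MonoidAlgebra k G))
            (TensorProduct.tensorTensorTensorComm k _ _ M.carrier _
              ((MonoidAlgebra.single h (1 : k) ⊗ₜ[k] MonoidAlgebra.single h (1 : k)) ⊗ₜ[k] z)))) =
      M.act (MonoidAlgebra.single h 1) (TensorProduct.rid k M.carrier
        ((Finsupp.lapply (h⁻¹ * g * h) ∘ₗ
          (MonoidAlgebra.coeffLinearEquiv k).toLinearMap).lTensor M.carrier z)) := by
    intro z
    induction z with
    | zero => simp
    | add x y hx hy => simp only [TensorProduct.tmul_add, map_add, hx, hy]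
    | tmul x y => simp [MonoidAlgebra.coeff_single_mul_apply, mul_assoc]
  have h2 : ∀ z : M.carrier ⊗[k] MonoidAlgebra k G,
      TensorProduct.rid k M.carrier ((Finsupp.lapply (g * h) ∘ₗ
        (MonoidAlgebra.coeffLinearEquiv k).toLinearMap).lTensor M.carrier
          ((LinearMap.mul' k (MonoidAlgebra k G)).lTensor M.carrier
            (TensorProduct.assoc k M.carrier _ _ (z ⊗ₜ[k] MonoidAlgebra.single h (1 : k))))) =
      TensorProduct.rid k M.carrier ((Finsupp.lapply g ∘ₗ
          (MonoidAlgebra.coeffLinearEquiv k).toLinearMap).lTensor M.carrier z) := by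
    intro z
    induction z with
    | zero => simp
    | add x y hx hy => simp only [TensorProduct.add_tmul, map_add, hx, hy]
    | tmul x y => simp [MonoidAlgebra.coeff_mul_single_apply]
  have hc := M.compat (MonoidAlgebra.single h 1) m
  have h3 : Coalgebra.comul (R := k) (MonoidAlgebra.single h (1 : k)) =
      MonoidAlgebra.single h (1 : k) ⊗ₜ[k] MonoidAlgebra.single h (1 : k) := by
    simp
  rw [h3, TensorProduct.comm_tmul, LinearMap.rTensor_tmul] at hc
  have := (h1 (M.coact m)).symm.trans ((congrArg (fun z => TensorProduct.rid k M.carrier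
    ((Finsupp.lapply (g * h) ∘ₗ
      (MonoidAlgebra.coeffLinearEquiv k).toLinearMap).lTensor M.carrier z)) hc).trans (h2 _))
  exact this.symm

/-- The module over the quantum double that corresponds to a Yetter-Drinfeld module: `φ_g ⊗ h`
acts by `m ↦ ∑ φ_g((h m)₁) (h m)₀`. -/
def doubleAct [Fintype G] [DecidableEq G] : DrinfeldDouble k G →ₐ[k] Module.End k M.carrier :=
  AlgHom.ofLinearMap
    { toFun := fun d => ∑ g : G, ∑ h : G,
        d.coeff g h • (M.component g ∘ₗ M.act (MonoidAlgebra.single h 1))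
      map_add' := fun x y => by
        simp only [DrinfeldDouble.coeff_add, add_smul, Finset.sum_add_distrib]
      map_smul' := fun c x => by
        simp only [DrinfeldDouble.coeff_smul, mul_smul, Finset.smul_sum, RingHom.id_apply] }
    (by
      ext m
      simp [DrinfeldDouble.coeff_one, ← MonoidAlgebra.one_def, sum_component])
    (by
      intro x y
      ext m
      have key : ∀ g a g' h' : G, M.component g (M.act (MonoidAlgebra.single a 1)
          (M.component g' (M.act (MonoidAlgebra.single h' 1) m))) =
          if a⁻¹ * g * a = g' then M.component g (M.act (MonoidAlgebra.single (a * h') 1) m)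
          else 0 := by
        intro g a g' h'
        rw [component_act, component_component]
        split_ifs with hg
        · have ha : M.act (MonoidAlgebra.single (a * h') 1) m =
              M.act (MonoidAlgebra.single a 1) (M.act (MonoidAlgebra.single h' 1) m) := by
            rw [← Module.End.mul_apply, ← map_mul]
            simp
          rw [← component_act, ha]
        · simp
      simp only [LinearMap.coe_mk, AddHom.coe_mk, Module.End.mul_apply, LinearMap.sum_apply,
        LinearMap.smul_apply, LinearMap.comp_apply]
      refine Finset.sum_congr rfl fun g _ => ?_
      simp only [DrinfeldDouble.coeff_mul, Finset.sum_smul, map_sum, map_smul, key]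
      rw [Finset.sum_comm]
      refine Finset.sum_congr rfl fun a _ => ?_
      rw [Finset.sum_comm, Finset.smul_sum]
      refine (Fintype.sum_equiv (Equiv.mulLeft a) _ _ fun b => ?_).symm
      simp [mul_smul])

instance [Fintype G] [DecidableEq G] : Module (DrinfeldDouble k G) M.carrier :=
  Module.compHom M.carrier M.doubleAct.toRingHom

theorem double_smul_def [Fintype G] [DecidableEq G] (d : DrinfeldDouble k G) (m : M.carrier) :
    d • m = ∑ g : G, ∑ h : G,
      d.coeff g h • M.component g (M.act (MonoidAlgebra.single h 1) m) := by
  change M.doubleAct d m = _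
  simp [doubleAct]

instance [Fintype G] [DecidableEq G] : IsScalarTower k (DrinfeldDouble k G) M.carrier where
  smul_assoc c d m := by
    change M.doubleAct (c • d) m = c • M.doubleAct d m
    simp

end YetterDrinfeldModule

/-- A module is indecomposable if it is nonzero and not the direct sum of two nonzero
submodules. -/
def IsIndecomposableModule (R : Type*) (M : Type*) [Ring R] [AddCommGroup M] [Module R M] : Prop :=
  Nontrivial M ∧ ∀ N₁ N₂ : Submodule R M, IsCompl N₁ N₂ → N₁ = ⊥ ∨ N₂ = ⊥

/-! ### Representations of cyclic and dihedral groups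

In `DihedralGroup n` we write `a = r 1` and `b = sr 0`, so that `r i = a ^ i` and
`sr i = b * a ^ i`. The cyclic group `C_n = ⟨a⟩` is `Multiplicative (ZMod n)`. -/

namespace DihedralYD

open DihedralGroup Polynomial

theorem pow_val_add {M : Type*} [Monoid M] {n : ℕ} [NeZero n] {x : M} (hx : x ^ n = 1)
    (i j : ZMod n) : x ^ (i + j).val = x ^ i.val * x ^ j.val := by
  rw [ZMod.val_add, ← pow_add, pow_eq_pow_mod (i.val + j.val) hx]

/-- The homomorphism `C_n → M` with `a ↦ x`. -/
def cyclicLift {M : Type*} [Monoid M] {n : ℕ} [NeZero n] (x : M) (hx : x ^ n = 1) :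
    Multiplicative (ZMod n) →* M where
  toFun i := x ^ i.toAdd.val
  map_one' := by simp
  map_mul' i j := by rw [toAdd_mul, pow_val_add hx]

/-- The homomorphism `D_n → M` with `a ↦ x` and `b ↦ y`. -/
def dihedralLift {M : Type*} [Monoid M] {n : ℕ} [NeZero n] (x y : M) (hx : x ^ n = 1)
    (hy : y * y = 1) (hxy : x * y * (x * y) = 1) : DihedralGroup n →* M where
  toFun
    | r i => x ^ i.val
    | sr i => y * x ^ i.val
  map_one' := by
    change x ^ (0 : ZMod n).val = 1
    simp
  map_mul' := by
    have h1 : x * y * x = y := by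
      calc x * y * x = x * y * (x * y) * y := by simp only [mul_assoc, hy, mul_one]
        _ = y := by rw [hxy, one_mul]
    have h2 : ∀ m : ℕ, x ^ m * y * x ^ m = y := by
      intro m
      induction m with
      | zero => simp
      | succ m ih =>
        calc x ^ (m + 1) * y * x ^ (m + 1) = x ^ m * (x * y * x) * x ^ m := by
              rw [pow_succ x m]
              nth_rewrite 2 [(Commute.refl x).pow_left m |>.eq]
              simp only [mul_assoc]
          _ = y := by rw [h1, ih]
    have h3 : ∀ i j : ZMod n, x ^ i.val * (y * x ^ j.val) = y * x ^ (j - i).val := by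
      intro i j
      calc x ^ i.val * (y * x ^ j.val) = x ^ i.val * (y * x ^ (i + (j - i)).val) := by
            rw [add_sub_cancel]
        _ = x ^ i.val * y * x ^ i.val * x ^ (j - i).val := by
            rw [pow_val_add hx]; simp only [mul_assoc]
        _ = _ := by rw [h2]
    rintro (i | i) (j | j)
    · rw [r_mul_r]; exact pow_val_add hx i j
    · rw [r_mul_sr]; exact (h3 i j).symm
    · rw [sr_mul_r]
      change y * x ^ (i + j).val = y * x ^ i.val * x ^ j.val
      rw [pow_val_add hx, mul_assoc]
    · rw [sr_mul_sr]
      change x ^ (j - i).val = y * x ^ i.val * (y * x ^ j.val)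
      rw [mul_assoc, h3, ← mul_assoc, hy, one_mul]

section Matrices

variable {k : Type u} [Field k]

/-- The Jordan block of size `r` with eigenvalue `c` (and `1`s above the diagonal). -/
def jordanBlock (r : ℕ) (c : k) : Matrix (Fin r) (Fin r) k :=
  Matrix.of fun i j => if i = j then c else if i.val + 1 = j.val then 1 else 0

/-- The upper triangular matrix `T` with, for `1 ≤ i, j ≤ r`, the entries
`T_{ij} = (-1)^{r-i} * binom(r-i, r-j)`, that is, `T_{rr} = 1`, `T_{ii} = -T_{i+1,i+1}` and
`T_{ij} = -T_{i+1,j} - T_{i+1,j+1}` for `i < j`, where `T_{i,r+1} = 0`. In the code the indices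
start from `0`. -/
def involutionMatrix (k : Type u) [Field k] (r : ℕ) : Matrix (Fin r) (Fin r) k :=
  Matrix.of fun i j => (-1) ^ (r - 1 - i.val) * ((r - 1 - i.val).choose (r - 1 - j.val) : k)

theorem jordanBlock_pow {p s t n r : ℕ} [Fact p.Prime] [CharP k p] (hn : n = p ^ s * t)
    (hr : r ≤ p ^ s) {ξ : k} (hξ : IsPrimitiveRoot ξ t) (i : ℕ) :
    jordanBlock r (ξ ^ i) ^ n = 1 := by
  rcases Nat.eq_zero_or_pos r with rfl | hr0
  · exact Subsingleton.elim _ _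
  have : Nonempty (Fin r) := ⟨⟨0, hr0⟩⟩
  set c := ξ ^ i with hc
  have hnil : (jordanBlock r c - Matrix.scalar (Fin r) c) ^ r = 0 := by
    have h1 : (jordanBlock r c).charpoly = (X - C c) ^ r := by
      rw [Matrix.charpoly_of_isUpperTriangular]
      · simp [jordanBlock]
      · intro a b hab
        have hab' : b.val < a.val := hab
        have h2 : a ≠ b := fun h => by simp [h] at hab'
        have h3 : a.val + 1 ≠ b.val := by omega
        simp [jordanBlock, h2, h3]
    have h2 := Matrix.aeval_self_charpoly (jordanBlock r c)
    rw [h1] at h2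
    simpa [Algebra.algebraMap_eq_smul_one, Matrix.smul_one_eq_diagonal] using h2
  have hcomm : Commute (jordanBlock r c) (Matrix.scalar (Fin r) c) :=
    (Matrix.scalar_commute c (fun _ => mul_comm _ _) _).symm
  have h1 : (jordanBlock r c - Matrix.scalar (Fin r) c) ^ p ^ s = 0 :=
    pow_eq_zero_of_le hr hnil
  rw [sub_pow_char_pow_of_commute _ _ hcomm, sub_eq_zero] at h1
  rw [hn, pow_mul, h1, ← pow_mul, ← map_pow, hc, ← pow_mul, mul_comm (p ^ s) t, mul_left_comm,
    pow_mul, hξ.pow_eq_one, one_pow, map_one]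

theorem involutionMatrix_mul_self (r : ℕ) :
    involutionMatrix k r * involutionMatrix k r = 1 := by
  have key : ∀ N p s : ℕ, p < N →
      ∑ q ∈ Finset.range N, ((-1) ^ p * (p.choose q : k)) * ((-1) ^ q * (q.choose s : k)) =
        if p = s then 1 else 0 := by
    intro N p s hN
    have h1 : ((-(1 + X) + 1 : k[X]) ^ p).coeff s = (-1) ^ p * if p = s then 1 else 0 := by
      have : (-(1 + X) + 1 : k[X]) = C (-1) * X := by simp
      rw [this, mul_pow, ← C_pow, coeff_C_mul, coeff_X_pow]
      simp [eq_comm]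
    rw [add_pow, finsetSum_coeff] at h1
    have h2 : ∑ q ∈ Finset.range N, ((-1) ^ p * (p.choose q : k)) * ((-1) ^ q * (q.choose s : k)) =
        ∑ q ∈ Finset.range (p + 1),
          ((-1) ^ p * (p.choose q : k)) * ((-1) ^ q * (q.choose s : k)) := by
      symm
      refine Finset.sum_subset (by intro q; simp; omega) fun q _ hq => ?_
      rw [Nat.choose_eq_zero_of_lt (by simpa using hq)]
      simp
    have h3 : ∀ q : ℕ, ((-(1 + X) : k[X]) ^ q * 1 ^ (p - q) * (p.choose q : k[X])).coeff s =
        (-1) ^ q * (q.choose s : k) * (p.choose q : k) := by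
      intro q
      rw [one_pow, mul_one, ← C_eq_natCast, coeff_mul_C, neg_pow, ← C_1, ← C_neg, ← C_pow,
        coeff_C_mul, C_1, coeff_one_add_X_pow]
    simp only [h3] at h1
    rw [h2]
    have h4 : ((-1 : k) ^ p) * (-1) ^ p = 1 := by rw [← mul_pow]; simp
    calc _ = (-1) ^ p * ∑ q ∈ Finset.range (p + 1),
          (-1) ^ q * (q.choose s : k) * (p.choose q : k) := by
          rw [Finset.mul_sum]; exact Finset.sum_congr rfl fun q _ => by ring
      _ = _ := by rw [h1, ← mul_assoc, h4, one_mul]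
  ext i j
  rw [Matrix.mul_apply, ← Equiv.sum_comp Fin.revPerm]
  have hr : ∀ x : Fin r, r - 1 - (Fin.revPerm x).val = x.val := by
    intro x
    rw [Fin.revPerm_apply, Fin.val_rev]; omega
  simp only [involutionMatrix, Matrix.of_apply, hr]
  rw [Fin.sum_univ_eq_sum_range (fun q => ((-1) ^ (r - 1 - i.val) *
    ((r - 1 - i.val).choose q : k)) * ((-1) ^ q * (q.choose (r - 1 - j.val) : k))) r,
    key r _ _ (by omega), Matrix.one_apply]
  refine if_congr ?_ rfl rfl
  rw [Fin.ext_iff]; omega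

theorem jordanBlock_mul_involutionMatrix_mul (r : ℕ) :
    jordanBlock r (1 : k) * involutionMatrix k r * jordanBlock r 1 = involutionMatrix k r := by
  have hJ : ∀ i c : Fin r, jordanBlock r (1 : k) i c =
      (if i = c then 1 else 0) + if i.val + 1 = c.val then 1 else 0 := by
    intro i c
    simp only [jordanBlock, Matrix.of_apply]
    by_cases h : i = c
    · subst h; simp
    · simp [h]
  have hL : ∀ (B : Matrix (Fin r) (Fin r) k) (i j : Fin r), (jordanBlock r (1 : k) * B) i j =
      B i j + if h : i.val + 1 < r then B ⟨i.val + 1, h⟩ j else 0 := by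
    intro B i j
    simp only [Matrix.mul_apply, hJ, add_mul, Finset.sum_add_distrib, ite_mul, one_mul, zero_mul,
      Finset.sum_ite_eq, Finset.mem_univ, if_true]
    congr 1
    split_ifs with h
    · rw [Finset.sum_eq_single ⟨i.val + 1, h⟩]
      · simp
      · intro c _ hc
        exact if_neg fun h' => hc (Fin.ext h'.symm)
      · simp
    · exact Finset.sum_eq_zero fun c _ => if_neg fun h' => h (by have := c.isLt; omega)
  have hR : ∀ (B : Matrix (Fin r) (Fin r) k) (i j : Fin r), (B * jordanBlock r (1 : k)) i j =
      B i j + if h : 0 < j.val then B i ⟨j.val - 1, by omega⟩ else 0 := by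
    intro B i j
    simp only [Matrix.mul_apply, hJ, mul_add, Finset.sum_add_distrib, mul_ite, mul_one, mul_zero,
      Finset.sum_ite_eq', Finset.mem_univ, if_true]
    congr 1
    split_ifs with h
    · rw [Finset.sum_eq_single ⟨j.val - 1, by omega⟩]
      · exact if_pos (by simp only; omega)
      · intro c _ hc
        exact if_neg fun h' => hc (Fin.ext (by simp only; omega))
      · simp
    · exact Finset.sum_eq_zero fun c _ => if_neg fun h' => h (by omega)
  ext i j
  rw [hR, hL]
  simp only [hL, involutionMatrix, Matrix.of_apply]
  obtain ⟨i, hi⟩ := i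
  obtain ⟨j, hj⟩ := j
  simp only
  by_cases h1 : i + 1 < r
  · obtain ⟨m, rfl⟩ : ∃ m, r = i + 1 + (m + 1) := ⟨r - (i + 1) - 1, by omega⟩
    have e1 : i + 1 + (m + 1) - 1 - i = m + 1 := by omega
    have e2 : i + 1 + (m + 1) - 1 - (i + 1) = m := by omega
    simp only [h1, dif_pos, e1, e2]
    by_cases h2 : 0 < j
    · have e3 : i + 1 + (m + 1) - 1 - (j - 1) = i + 1 + (m + 1) - 1 - j + 1 := by omega
      simp only [h2, dif_pos, e3, Nat.choose_succ_succ, Nat.cast_add]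
      ring
    · have e3 : m.choose (i + 1 + m - j) = 0 := Nat.choose_eq_zero_of_lt (by omega)
      simp [h2, e3]
  · have e1 : r - 1 - i = 0 := by omega
    by_cases h2 : 0 < j
    · have e3 : Nat.choose 0 (r - 1 - (j - 1)) = 0 := Nat.choose_eq_zero_of_lt (by omega)
      simp [h1, h2, e1, e3]
    · simp [h1, h2]


end Matrices

/-- The representation of `D_n` on `k^ι` with given matrices of `a` and `b`. -/
def dihedralRep {k : Type u} [Field k] {n : ℕ} [NeZero n] {ι : Type} [Fintype ι] [DecidableEq ι]
    (A B : Matrix ι ι k) (hA : A ^ n = 1) (hB : B * B = 1) (hAB : A * B * (A * B) = 1) :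
    Representation k (DihedralGroup n) (ι → k) :=
  (Matrix.toLinAlgEquiv' : Matrix ι ι k ≃ₐ[k] _).toMonoidHom.comp (dihedralLift A B hA hB hAB)

/-! ### The indecomposable Yetter-Drinfeld modules -/

section Modules

variable {k : Type u} [Field k]

/-- The `kD_n`-module `V_{r,0}`: `a` acts by the Jordan block of size `r` with eigenvalue `1` and
`b` acts by `T`. -/
def moduleV {p s t n r : ℕ} [NeZero n] [Fact p.Prime] [CharP k p] (hn : n = p ^ s * t)
    (hr : r ≤ p ^ s) {ξ : k} (hξ : IsPrimitiveRoot ξ t) :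
    Representation k (DihedralGroup n) (Fin r → k) :=
  dihedralRep (jordanBlock r 1) (involutionMatrix k r)
    (by simpa using jordanBlock_pow hn hr hξ 0)
    (involutionMatrix_mul_self r)
    (by rw [← mul_assoc, jordanBlock_mul_involutionMatrix_mul, involutionMatrix_mul_self])

/-- The `kD_n`-module `V'_{r,0}`: `a` acts by the Jordan block of size `r` with eigenvalue `1` and
`b` acts by `-T`. -/
def moduleV' {p s t n r : ℕ} [NeZero n] [Fact p.Prime] [CharP k p] (hn : n = p ^ s * t)
    (hr : r ≤ p ^ s) {ξ : k} (hξ : IsPrimitiveRoot ξ t) :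
    Representation k (DihedralGroup n) (Fin r → k) :=
  dihedralRep (jordanBlock r 1) (-involutionMatrix k r)
    (by simpa using jordanBlock_pow hn hr hξ 0)
    (by rw [neg_mul_neg, involutionMatrix_mul_self])
    (by rw [mul_neg, neg_mul_neg, ← mul_assoc, jordanBlock_mul_involutionMatrix_mul,
      involutionMatrix_mul_self])

/-- The `kD_n`-module `W_{2r,i}`: `a` acts by `diag(A, A⁻¹)`, where `A` is the Jordan block of size
`r` with eigenvalue `ξ ^ i`, and `b` swaps the two blocks. -/
def moduleW {p s t n r : ℕ} [NeZero n] [Fact p.Prime] [CharP k p] (hn : n = p ^ s * t)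
    (hr : r ≤ p ^ s) {ξ : k} (hξ : IsPrimitiveRoot ξ t) (i : ℕ) :
    Representation k (DihedralGroup n) (Fin r ⊕ Fin r → k) :=
  dihedralRep
    (Matrix.fromBlocks (jordanBlock r (ξ ^ i)) 0 0 (jordanBlock r (ξ ^ i))⁻¹)
    (Matrix.fromBlocks 0 1 1 0)
    (by
      rw [Matrix.fromBlocks_diagonal_pow, Matrix.inv_pow', jordanBlock_pow hn hr hξ, inv_one,
        Matrix.fromBlocks_one])
    (by simp [Matrix.fromBlocks_multiply])
    (by
      have h : IsUnit (jordanBlock r (ξ ^ i)).det :=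
        (Matrix.isUnit_iff_isUnit_det _).1
          (IsUnit.of_pow_eq_one (jordanBlock_pow hn hr hξ i) (NeZero.ne n))
      simp [Matrix.fromBlocks_multiply, Matrix.mul_nonsing_inv _ h, Matrix.nonsing_inv_mul _ h])

/-- The one-dimensional module `U_j` of the centralizer `C(b)` on which `b` acts by `(-1)^j`. It is
written as the restriction to `C(b)` of the representation `a ↦ 1`, `b ↦ (-1)^j` of `D_n`; for odd
`n`, `C(b) = {1, b}`. -/
def moduleU (k : Type u) [Field k] (n : ℕ) [NeZero n] (j : ℕ) :
    Representation k (Subgroup.centralizer {(sr 0 : DihedralGroup n)}) k :=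
  ((algebraMap k (Module.End k k)).toMonoidHom.comp
    (dihedralLift (1 : k) ((-1) ^ j) (one_pow n)
      (by rw [← mul_pow]; simp) (by rw [one_mul, ← mul_pow]; simp))).comp
        (Subgroup.centralizer {(sr 0 : DihedralGroup n)}).subtype

/-- The `kC_n`-module `Q_{r,j}`: `a` acts by the Jordan block of size `r` with eigenvalue
`ξ ^ j`. -/
def moduleQ {p s t n r : ℕ} [NeZero n] [Fact p.Prime] [CharP k p] (hn : n = p ^ s * t)
    (hr : r ≤ p ^ s) {ξ : k} (hξ : IsPrimitiveRoot ξ t) (j : ℕ) :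
    Representation k (Multiplicative (ZMod n)) (Fin r → k) :=
  (Matrix.toLinAlgEquiv' : Matrix (Fin r) (Fin r) k ≃ₐ[k] _).toMonoidHom.comp
    (cyclicLift (jordanBlock r (ξ ^ j)) (jordanBlock_pow hn hr hξ j))

end Modules

/-- For `1 ≤ l ≤ (n - 1) / 2` the centralizer of `a ^ l` in `D_n` is `C_n`. -/
theorem exists_eq_r_of_mem_centralizer {n l : ℕ} (hl : 1 ≤ l) (hl' : l ≤ (n - 1) / 2)
    {g : DihedralGroup n} (hg : g ∈ Subgroup.centralizer {(r (l : ZMod n) : DihedralGroup n)}) :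
    ∃ i, g = r i := by
  rcases g with i | i
  · exact ⟨i, rfl⟩
  · rw [Subgroup.mem_centralizer_singleton_iff, sr_mul_r, r_mul_sr] at hg
    injection hg with hg
    have h : ((2 * l : ℕ) : ZMod n) = 0 := by
      push_cast
      linear_combination hg
    rw [ZMod.natCast_eq_zero_iff] at h
    have := Nat.le_of_dvd (by omega) h
    omega

/-- The identification of the centralizer of `a ^ l` with `C_n`, for `1 ≤ l ≤ (n - 1) / 2`. -/
def centralizerToCyclic {n l : ℕ} (hl : 1 ≤ l) (hl' : l ≤ (n - 1) / 2) :
    Subgroup.centralizer {(r (l : ZMod n) : DihedralGroup n)} →* Multiplicative (ZMod n) where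
  toFun g := match g.1 with
    | r i => Multiplicative.ofAdd i
    | sr _ => 1
  map_one' := rfl
  map_mul' := by
    rintro ⟨g, hg⟩ ⟨h, hh⟩
    obtain ⟨i, rfl⟩ := exists_eq_r_of_mem_centralizer hl hl' hg
    obtain ⟨j, rfl⟩ := exists_eq_r_of_mem_centralizer hl hl' hh
    rfl

/-- The index set of the list of indecomposable Yetter-Drinfeld modules. -/
inductive Index (p s t n : ℕ) : Type
  | V (r : ℕ) (hr : 1 ≤ r ∧ r ≤ p ^ s)
  | V' (r : ℕ) (hr : 1 ≤ r ∧ r ≤ p ^ s)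
  | W (r i : ℕ) (hr : 1 ≤ r ∧ r ≤ p ^ s) (hi : 1 ≤ i ∧ i ≤ (t - 1) / 2)
  | U (j : ℕ) (hj : 1 ≤ j ∧ j ≤ 2)
  | Q (r j l : ℕ) (hr : 1 ≤ r ∧ r ≤ p ^ s) (hj : j ≤ t - 1) (hl : 1 ≤ l ∧ l ≤ (n - 1) / 2)

open YetterDrinfeldModule in
/-- The list of Yetter-Drinfeld modules over `kD_n`, for `n = p ^ s * t`: the modules `V_{r,0}`,
`V'_{r,0}` and `W_{2r,i}` with trivial coaction, the modules `D(U_j)` induced from `C(b)`, and the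
modules `D(Q_{r,j}^l)` induced from `C(a ^ l) = C_n`. -/
def listed {k : Type u} [Field k] {p s t n : ℕ} [NeZero n] [Fact p.Prime] [CharP k p]
    (hn : n = p ^ s * t) {ξ : k} (hξ : IsPrimitiveRoot ξ t) :
    Index p s t n → YetterDrinfeldModule.{u, u, u} k (MonoidAlgebra k (DihedralGroup n))
  | .V _ hr => trivialCoaction (moduleV hn hr.2 hξ)
  | .V' _ hr => trivialCoaction (moduleV' hn hr.2 hξ)
  | .W _ i hr _ => trivialCoaction (moduleW hn hr.2 hξ i)
  | .U j _ => induced (sr 0) (moduleU k n j)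
  | .Q _ j l hr _ hl => induced (r (l : ZMod n))
      ((moduleQ hn hr.2 hξ j).comp (centralizerToCyclic hl.1 hl.2))

end DihedralYD

end

/-! A Yetter–Drinfeld module over `kG` is a representation of `G` with a `G`-grading that the action
permutes by conjugation; the coaction records the homogeneous components. A module over the quantum
double is the same data, with `φ_g` acting as the projection to degree `g`. Both halves of the
theorem are therefore statements about `ConjGrading`.

An indecomposable graded representation lives on a single conjugacy class (`exists_supportedOn`).
There it is determined by its component of degree `g`, a representation of the centralizer of `g`:
indecomposability passes in both directions (`indecOn_fiber`, `indecOn_of_fiber`), and so do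
isomorphisms (`iso_of_fiber`, `Iso.fiber`). For odd `n` the classes of `D_n` are represented by `1`,
`b` and `a ^ l` with `1 ≤ l ≤ (n - 1) / 2`; the centralizers are `D_n`, `{1, b}` and `C_n`.

For `C_n` and `{1, b}` the task is to classify an indecomposable operator `T` of finite order.
Fitting's lemma leaves a single eigenvalue. If `T ^ n = 1`, it is a power of `ξ`, because `x ^ n - 1
= (x ^ t - 1) ^ (p ^ s)`. A longest cyclic subspace has a stable complement cut out by a linear
functional, so `T` is one Jordan block; its size is at most `p ^ s`
(`sub_pow_eq_zero_of_isNilpotent`).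

For `D_n`, let `c` be an eigenvalue of `a`. The operator `a + a⁻¹ - (c + c⁻¹)` commutes with `a` and
`b` and is not injective, hence is nilpotent. If `c ≠ c⁻¹`, then `V = K ⊕ b K` with `K` the
generalized eigenspace of `c`, on which `a` is a Jordan block; this gives `W`. Otherwise `c = 1`,
since `t` is odd, and `a` is unipotent. As `2` is invertible, the cyclic vector and the functional
can be adapted to the involutions, so that a Jordan block splits off under both `a` and `b`; on it
`b` is `T` or `-T` (`exists_equiv_unipotent`).

Conversely, in the fiber of each listed module one fixed nonzero vector lies in every nonzero stable
subspace, which makes the module indecomposable. The conjugacy class, the dimension, the eigenvalues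
of `a` and the sign of `b` on a distinguished line tell the listed modules apart. -/

noncomputable section

/-! ### Indecomposability relative to a family of subspaces -/

/-- The space `V` is nonzero and is not the direct sum of two nonzero subspaces satisfying `P`. -/
def IndecOn {k : Type u} [Field k] {V : Type v} [AddCommGroup V] [Module k V]
    (P : Submodule k V → Prop) : Prop :=
  Nontrivial V ∧ ∀ N₁ N₂ : Submodule k V, P N₁ → P N₂ → IsCompl N₁ N₂ → N₁ = ⊥ ∨ N₂ = ⊥

namespace IndecOn

variable {k : Type u} [Field k] {V : Type v} [AddCommGroup V] [Module k V]
  {V' : Type v'} [AddCommGroup V'] [Module k V']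

theorem mono {P Q : Submodule k V → Prop} (hP : IndecOn P) (h : ∀ N, Q N → P N) : IndecOn Q :=
  ⟨hP.1, fun N₁ N₂ h₁ h₂ => hP.2 N₁ N₂ (h _ h₁) (h _ h₂)⟩

theorem congr {P Q : Submodule k V → Prop} (h : ∀ N, P N ↔ Q N) : IndecOn P ↔ IndecOn Q :=
  ⟨fun hP => hP.mono fun N => (h N).2, fun hP => hP.mono fun N => (h N).1⟩

theorem map_equiv {P : Submodule k V → Prop} {Q : Submodule k V' → Prop} (e : V ≃ₗ[k] V')
    (hP : IndecOn P) (h : ∀ N, Q N → P (N.comap e.toLinearMap)) : IndecOn Q := by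
  refine ⟨have := hP.1; e.symm.toEquiv.nontrivial, fun N₁ N₂ h₁ h₂ hc => ?_⟩
  have hc' : IsCompl (N₁.comap e.toLinearMap) (N₂.comap e.toLinearMap) :=
    (Submodule.orderIsoMapComap e).symm.isCompl hc
  have key : ∀ N : Submodule k V', N.comap e.toLinearMap = ⊥ → N = ⊥ := by
    intro N hN
    rw [Submodule.eq_bot_iff] at hN ⊢
    intro x hx
    have := hN (e.symm x) (by simpa using hx)
    simpa using this
  exact (hP.2 _ _ (h _ h₁) (h _ h₂) hc').imp (key N₁) (key N₂)

/-- Such a vector would lie in both summands of a decomposition. All the listed modules are shown to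
be indecomposable in this way, on the fiber. -/
theorem of_common_vector {P : Submodule k V → Prop} (v : V) (hv : v ≠ 0)
    (h : ∀ N, P N → N ≠ ⊥ → v ∈ N) : IndecOn P := by
  refine ⟨⟨v, 0, hv⟩, fun N₁ N₂ h₁ h₂ hc => ?_⟩
  by_contra! hN
  exact hv ((Submodule.disjoint_def.1 hc.disjoint) v (h _ h₁ hN.1) (h _ h₂ hN.2))

theorem eq_top {P : Submodule k V → Prop} (hP : IndecOn P) {N₁ N₂ : Submodule k V} (h₁ : P N₁)
    (h₂ : P N₂) (hc : IsCompl N₁ N₂) (hN : N₁ ≠ ⊥) : N₁ = ⊤ := by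
  have := (hP.2 _ _ h₁ h₂ hc).resolve_left hN
  rw [this] at hc
  exact eq_top_of_isCompl_bot hc

end IndecOn

/-! ### Graded representations -/

/-- A representation of `G` on a space graded by `G`, compatibly with conjugation. The grading is
given by the projections `E g` to the homogeneous components. -/
structure ConjGrading (k : Type u) (G : Type w) (V : Type v) [Field k] [Group G] [Fintype G]
    [DecidableEq G] [AddCommGroup V] [Module k V] where
  /-- The action of `G`. -/
  ρ : Representation k G V
  /-- The projections to the homogeneous components. -/
  E : G → Module.End k V
  E_E : ∀ g g' v, E g (E g' v) = if g = g' then E g v else 0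
  sum_E : ∀ v, ∑ g, E g v = v
  E_ρ : ∀ g h v, E g (ρ h v) = ρ h (E (h⁻¹ * g * h) v)

namespace ConjGrading

variable {k : Type u} {G : Type w} [Field k] [Group G] [Fintype G] [DecidableEq G]
  {V : Type v} [AddCommGroup V] [Module k V] {V' : Type v'} [AddCommGroup V'] [Module k V']
  (S : ConjGrading k G V) (S' : ConjGrading k G V')

/-- The subspaces stable under the action and the projections. -/
def Stable (N : Submodule k V) : Prop :=
  (∀ h, ∀ v ∈ N, S.ρ h v ∈ N) ∧ ∀ g, ∀ v ∈ N, S.E g v ∈ N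

/-- There is a linear bijection compatible with the action and the projections. -/
def Iso : Prop :=
  ∃ e : V ≃ₗ[k] V', (∀ h v, e (S.ρ h v) = S'.ρ h (e v)) ∧ ∀ g v, e (S.E g v) = S'.E g (e v)

variable {S S'} in
theorem Iso.symm (h : S.Iso S') : S'.Iso S := by
  obtain ⟨e, h₁, h₂⟩ := h
  exact ⟨e.symm, fun h v => e.injective (by simp [h₁]), fun g v => e.injective (by simp [h₂])⟩

/-- The homogeneous component of degree `g`. -/
def fiber (g : G) : Submodule k V := LinearMap.range (S.E g)

/-- The subspaces of a homogeneous component that are stable under the centralizer. -/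
def FiberStable (g : G) (N : Submodule k (S.fiber g)) : Prop :=
  ∀ h, Commute h g → ∀ v ∈ N, ∀ w : S.fiber g, (w : V) = S.ρ h v → w ∈ N

/-- The grading is supported on the conjugacy class of `g`. -/
def SupportedOn (g : G) : Prop := ∀ x, ¬ IsConj g x → S.E x = 0

variable {S S'}

theorem mem_fiber {g : G} {v : V} : v ∈ S.fiber g ↔ S.E g v = v := by
  constructor
  · rintro ⟨w, rfl⟩
    simp [S.E_E]
  · intro h
    exact ⟨v, h⟩

theorem E_of_mem_fiber {g x : G} {v : V} (hv : v ∈ S.fiber g) :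
    S.E x v = if x = g then v else 0 := by
  rw [← mem_fiber.1 hv, S.E_E]
  split_ifs with h
  · rw [h]
  · rfl

theorem E_mem_fiber (g : G) (v : V) : S.E g v ∈ S.fiber g := ⟨v, rfl⟩

@[simp]
theorem ρ_ρ_inv (h : G) (v : V) : S.ρ h (S.ρ h⁻¹ v) = v := by
  rw [← Module.End.mul_apply, ← map_mul]; simp

theorem ρ_mul (h h' : G) (v : V) : S.ρ (h * h') v = S.ρ h (S.ρ h' v) := by
  rw [map_mul, Module.End.mul_apply]

theorem ρ_E (g h : G) (v : V) : S.ρ h (S.E g v) = S.E (h * g * h⁻¹) (S.ρ h v) := by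
  rw [S.E_ρ]; congr 2; group

theorem ρ_mem_fiber {g h : G} (hc : Commute h g) {v : V} (hv : v ∈ S.fiber g) :
    S.ρ h v ∈ S.fiber g := by
  rw [mem_fiber, S.E_ρ]
  have : h⁻¹ * g * h = g := by rw [mul_assoc, ← hc.eq, inv_mul_cancel_left]
  rw [this, mem_fiber.1 hv]

theorem ext_E {v w : V} (h : ∀ g, S.E g v = S.E g w) : v = w := by
  rw [← S.sum_E v, ← S.sum_E w]; exact Finset.sum_congr rfl fun g _ => h g

/-- The component of degree `c g c⁻¹` is the image under `ρ c` of the component of degree `g`, so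
the degree-`g` parts of all translates of a vector determine it. Testing equalities in this way
avoids choosing coset representatives. -/
theorem SupportedOn.ext {g : G} (hS : S.SupportedOn g) {v w : V}
    (h : ∀ x, S.E g (S.ρ x v) = S.E g (S.ρ x w)) : v = w := by
  refine ext_E (S := S) fun x => ?_
  by_cases hx : IsConj g x
  · obtain ⟨c, hc⟩ := isConj_iff.1 hx
    have key : ∀ u, S.E x u = S.ρ c (S.E g (S.ρ c⁻¹ u)) := by
      intro u
      rw [ρ_E, hc, ρ_ρ_inv]
    rw [key, key, h]
  · rw [hS x hx]; rfl

theorem SupportedOn.fiber_ne_bot {g : G} (hS : S.SupportedOn g) [Nontrivial V] :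
    S.fiber g ≠ ⊥ := by
  intro hb
  obtain ⟨v, hv⟩ := exists_ne (0 : V)
  refine hv (hS.ext fun x => ?_)
  have : ∀ u, S.E g u = 0 := fun u => by
    have := E_mem_fiber (S := S) g u
    rwa [hb, Submodule.mem_bot] at this
  rw [this, this]

theorem SupportedOn.conj {g g' : G} (hS : S.SupportedOn g) (h : IsConj g g') :
    S.SupportedOn g' := fun x hx => hS x fun hg => hx (h.symm.trans hg)

theorem SupportedOn.isConj {g g' : G} (hS : S.SupportedOn g) (hS' : S.SupportedOn g')
    [Nontrivial V] : IsConj g g' := by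
  by_contra h
  apply hS'.fiber_ne_bot
  rw [fiber, hS _ h, LinearMap.range_zero]

theorem SupportedOn.of_iso {g : G} (hS : S.SupportedOn g) (h : S.Iso S') :
    S'.SupportedOn g := by
  obtain ⟨e, -, he⟩ := h
  intro x hx
  ext v
  obtain ⟨v, rfl⟩ := e.surjective v
  rw [← he, hS x hx]; simp

theorem SupportedOn.E_eq_ite (hS : S.SupportedOn 1) (g : G) (v : V) :
    S.E g v = if g = 1 then v else 0 := by
  have h0 : ∀ g, g ≠ 1 → S.E g = 0 := fun g hg => hS g fun h => hg (isConj_one_right.1 h)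
  split_ifs with hg
  · rw [hg]
    conv_rhs => rw [← S.sum_E v, Finset.sum_eq_single 1 (fun g _ hg => by rw [h0 g hg]; rfl)
      (by simp)]
  · rw [h0 g hg]; rfl

/-- The action permutes the degrees within each class. Hence the components in the class of `g` and
those outside it span complementary stable subspaces, each of which is the common kernel of the
projections belonging to the other. -/
theorem exists_supportedOn (hS : IndecOn S.Stable) : ∃ g, S.SupportedOn g := by
  obtain ⟨hn, hS⟩ := hS
  obtain ⟨v, hv⟩ := exists_ne (0 : V)
  obtain ⟨g, hg⟩ : ∃ g, S.E g v ≠ 0 := by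
    by_contra! h
    exact hv (ext_E (S := S) fun g => by simp [h g])
  refine ⟨g, ?_⟩
  -- For a conjugation-invariant set of degrees, the vectors without components in these degrees
  -- form a stable subspace.
  have hst : ∀ p : G → Prop, (∀ x h, p x → p (h⁻¹ * x * h)) →
      S.Stable (⨅ x : {x // p x}, LinearMap.ker (S.E x.1)) := by
    intro p hp
    simp only [Stable, Submodule.mem_iInf, LinearMap.mem_ker, Subtype.forall]
    refine ⟨fun h v hv x hx => ?_, fun y v hv x hx => ?_⟩
    · rw [S.E_ρ, hv _ (hp x h hx), map_zero]
    · rw [S.E_E, hv x hx, ite_self]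
  have hconj : ∀ x h : G, IsConj g x ↔ IsConj g (h⁻¹ * x * h) := by
    intro x h
    have : IsConj x (h⁻¹ * x * h) := isConj_iff.2 ⟨h⁻¹, by simp⟩
    exact ⟨fun hx => hx.trans this, fun hx => hx.trans this.symm⟩
  have h1 := hst (fun x => IsConj g x) fun x h => (hconj x h).1
  have h2 := hst (fun x => ¬ IsConj g x) fun x h => (not_congr (hconj x h)).1
  classical
  have hc : IsCompl (⨅ x : {x // IsConj g x}, LinearMap.ker (S.E x.1))
      (⨅ x : {x // ¬ IsConj g x}, LinearMap.ker (S.E x.1)) := by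
    constructor
    · rw [Submodule.disjoint_def]
      simp only [Submodule.mem_iInf, LinearMap.mem_ker, Subtype.forall]
      intro v hv hv'
      refine ext_E (S := S) fun x => ?_
      by_cases hx : IsConj g x
      · rw [hv x hx, map_zero]
      · rw [hv' x hx, map_zero]
    · rw [codisjoint_iff, Submodule.eq_top_iff']
      intro v
      rw [← S.sum_E v]
      refine Submodule.sum_mem _ fun y _ => ?_
      by_cases hy : IsConj g y
      · refine Submodule.mem_sup_right ?_
        simp only [Submodule.mem_iInf, LinearMap.mem_ker, Subtype.forall]
        intro x hx
        rw [S.E_E, if_neg]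
        rintro rfl
        exact hx hy
      · refine Submodule.mem_sup_left ?_
        simp only [Submodule.mem_iInf, LinearMap.mem_ker, Subtype.forall]
        intro x hx
        rw [S.E_E, if_neg]
        rintro rfl
        exact hy hx
  -- One of the two kernels is zero and the other is everything. In the second case every vector has
  -- zero component in degree `g`, against the choice of `v`.
  rcases hS _ _ h1 h2 hc with hb | hb
  · rw [hb] at hc
    intro x hx
    have := eq_top_of_bot_isCompl hc
    ext w
    have hw : w ∈ (⨅ x : {x // ¬ IsConj g x}, LinearMap.ker (S.E x.1)) := this ▸ trivial
    simp only [Submodule.mem_iInf, LinearMap.mem_ker, Subtype.forall] at hw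
    simpa using hw x hx
  · rw [hb] at hc
    have := eq_top_of_isCompl_bot hc
    have hw : v ∈ (⨅ x : {x // IsConj g x}, LinearMap.ker (S.E x.1)) := this ▸ trivial
    simp only [Submodule.mem_iInf, LinearMap.mem_ker, Subtype.forall] at hw
    exact absurd (hw g (IsConj.refl g)) hg

/-! ### Passage between a graded representation and one homogeneous component -/

/-- The projection to the homogeneous component of degree `g`, as a map to this component. -/
def toFiber (S : ConjGrading k G V) (g : G) : V →ₗ[k] S.fiber g := (S.E g).rangeRestrict

@[simp]
theorem coe_toFiber (g : G) (v : V) : (S.toFiber g v : V) = S.E g v := rfl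

@[simp]
theorem toFiber_coe (g : G) (v : S.fiber g) : S.toFiber g v = v :=
  Subtype.ext (mem_fiber.1 v.2)

/-- The subspace generated by a subspace of a homogeneous component. -/
def extend (S : ConjGrading k G V) (g : G) (N : Submodule k (S.fiber g)) : Submodule k V :=
  ⨅ h : G, N.comap (S.toFiber g ∘ₗ S.ρ h)

theorem mem_extend {g : G} {N : Submodule k (S.fiber g)} {v : V} :
    v ∈ S.extend g N ↔ ∀ h, S.toFiber g (S.ρ h v) ∈ N := by
  simp [extend]

theorem extend_stable (g : G) (N : Submodule k (S.fiber g)) : S.Stable (S.extend g N) := by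
  constructor
  · intro h v hv
    rw [mem_extend] at hv ⊢
    intro x
    rw [← ρ_mul]
    exact hv _
  · intro y v hv
    rw [mem_extend] at hv ⊢
    intro x
    by_cases hg : g = x * y * x⁻¹
    · have : S.toFiber g (S.ρ x (S.E y v)) = S.toFiber g (S.ρ x v) := by
        ext
        rw [coe_toFiber, ρ_E, ← hg, S.E_E, if_pos rfl, coe_toFiber]
      rw [this]
      exact hv x
    · have : S.toFiber g (S.ρ x (S.E y v)) = 0 := by
        ext
        rw [coe_toFiber, ρ_E, S.E_E, if_neg hg]; rfl
      rw [this]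
      exact N.zero_mem

/-- If `h` centralizes `g`, the translate stays in the fiber and stability of `N` applies; otherwise
it has another degree, and its degree-`g` part is zero. -/
theorem mem_extend_of_mem {g : G} {N : Submodule k (S.fiber g)} (hN : S.FiberStable g N)
    {v : S.fiber g} (hv : v ∈ N) : (v : V) ∈ S.extend g N := by
  rw [mem_extend]
  intro h
  by_cases hc : Commute h g
  · exact hN h hc v hv _ (by rw [coe_toFiber, mem_fiber.1 (ρ_mem_fiber hc v.2)])
  · have : S.toFiber g (S.ρ h v) = 0 := by
      ext
      rw [coe_toFiber, S.E_ρ, E_of_mem_fiber v.2, if_neg, map_zero]; rfl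
      intro hg
      apply hc
      rw [Commute, SemiconjBy]
      nth_rewrite 1 [← hg]
      group
    rw [this]
    exact N.zero_mem

/-- Complementary stable subspaces of the fiber extend to complementary stable subspaces of `V`.
They span because a component of degree `c g c⁻¹` can be moved to the fiber by `ρ c⁻¹`, split there,
and moved back. -/
theorem indecOn_fiber {g : G} (hS : S.SupportedOn g) (h : IndecOn S.Stable) :
    IndecOn (S.FiberStable g) := by
  obtain ⟨hn, h⟩ := h
  refine ⟨Submodule.nontrivial_iff_ne_bot.2 hS.fiber_ne_bot, fun N₁ N₂ h₁ h₂ hc => ?_⟩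
  have hc' : IsCompl (S.extend g N₁) (S.extend g N₂) := by
    constructor
    · rw [Submodule.disjoint_def]
      intro v hv₁ hv₂
      rw [mem_extend] at hv₁ hv₂
      refine hS.ext fun x => ?_
      have := Submodule.disjoint_def.1 hc.disjoint _ (hv₁ x) (hv₂ x)
      rw [← coe_toFiber, this]; simp
    · rw [codisjoint_iff, Submodule.eq_top_iff']
      intro v
      rw [← S.sum_E v]
      refine Submodule.sum_mem _ fun y _ => ?_
      by_cases hy : IsConj g y
      · obtain ⟨c, rfl⟩ := isConj_iff.1 hy
        have hv : S.toFiber g (S.ρ c⁻¹ v) ∈ N₁ ⊔ N₂ := by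
          rw [hc.sup_eq_top]; trivial
        obtain ⟨a, ha, b, hb, hab⟩ := Submodule.mem_sup.1 hv
        have hE : S.E (c * g * c⁻¹) v = S.ρ c (a : V) + S.ρ c (b : V) := by
          rw [← map_add, ← Submodule.coe_add, hab, coe_toFiber, ρ_E, ρ_ρ_inv]
        rw [hE]
        exact Submodule.add_mem_sup ((extend_stable g N₁).1 _ _ (mem_extend_of_mem h₁ ha))
          ((extend_stable g N₂).1 _ _ (mem_extend_of_mem h₂ hb))
      · rw [hS y hy]; exact Submodule.zero_mem _
  have key : ∀ N : Submodule k (S.fiber g), S.FiberStable g N → S.extend g N = ⊥ → N = ⊥ := by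
    intro N hN hb
    rw [Submodule.eq_bot_iff]
    intro v hv
    have := mem_extend_of_mem hN hv
    rw [hb, Submodule.mem_bot] at this
    exact Subtype.ext this
  exact (h _ _ (extend_stable g N₁) (extend_stable g N₂) hc').imp (key N₁ h₁) (key N₂ h₂)

/-- A decomposition of `V` restricts to the fiber because `E g` preserves both summands, and a
stable subspace that meets the fiber in zero is itself zero. -/
theorem indecOn_of_fiber {g : G} (hS : S.SupportedOn g) (h : IndecOn (S.FiberStable g)) :
    IndecOn S.Stable := by
  obtain ⟨hn, h⟩ := h
  refine ⟨(Subtype.coe_injective (p := (· ∈ S.fiber g))).nontrivial, fun N₁ N₂ h₁ h₂ hc => ?_⟩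
  have hst : ∀ N, S.Stable N → S.FiberStable g (N.comap (S.fiber g).subtype) := by
    intro N hN h _ v hv w hw
    rw [Submodule.mem_comap, Submodule.subtype_apply, hw]
    exact hN.1 _ _ hv
  have hc' : IsCompl (N₁.comap (S.fiber g).subtype) (N₂.comap (S.fiber g).subtype) := by
    constructor
    · rw [Submodule.disjoint_def]
      intro v hv₁ hv₂
      exact Subtype.ext (Submodule.disjoint_def.1 hc.disjoint _ hv₁ hv₂)
    · rw [codisjoint_iff, Submodule.eq_top_iff']
      intro v
      have hv : (v : V) ∈ N₁ ⊔ N₂ := by rw [hc.sup_eq_top]; trivial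
      obtain ⟨a, ha, b, hb, hab⟩ := Submodule.mem_sup.1 hv
      have : v = S.toFiber g a + S.toFiber g b := by
        rw [← map_add, hab, toFiber_coe]
      rw [this]
      exact Submodule.add_mem_sup (h₁.2 _ _ ha) (h₂.2 _ _ hb)
  have key : ∀ N, S.Stable N → N.comap (S.fiber g).subtype = ⊥ → N = ⊥ := by
    intro N hN hb
    rw [Submodule.eq_bot_iff] at hb ⊢
    intro v hv
    refine hS.ext fun x => ?_
    have := hb (S.toFiber g (S.ρ x v)) (hN.2 _ _ (hN.1 _ _ hv))
    rw [← coe_toFiber, this]; simp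
  exact (h _ _ (hst N₁ h₁) (hst N₂ h₂) hc').imp (key N₁ h₁) (key N₂ h₂)

theorem finiteDimensional_of_fiber {g : G} (hS : S.SupportedOn g)
    [FiniteDimensional k (S.fiber g)] : FiniteDimensional k V := by
  refine FiniteDimensional.of_injective (LinearMap.pi fun x : G => S.toFiber g ∘ₗ S.ρ x) ?_
  intro v w h
  refine hS.ext fun x => ?_
  exact congrArg Subtype.val (congrFun h x)

theorem bijective_of_fiber {g : G} (hS : S.SupportedOn g) (hS' : S'.SupportedOn g)
    (f : V →ₗ[k] V') (hρ : ∀ h v, f (S.ρ h v) = S'.ρ h (f v))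
    (hE : ∀ x v, f (S.E x v) = S'.E x (f v))
    (hinj : ∀ v ∈ S.fiber g, f v = 0 → v = 0)
    (hsurj : ∀ w ∈ S'.fiber g, ∃ v, f v = w) : Function.Bijective f := by
  constructor
  · rw [← LinearMap.ker_eq_bot, Submodule.eq_bot_iff]
    intro v hv
    refine hS.ext fun x => ?_
    rw [map_zero, map_zero]
    refine hinj _ (E_mem_fiber _ _) ?_
    rw [hE, hρ, LinearMap.mem_ker.1 hv, map_zero, map_zero]
  · intro w
    rw [← LinearMap.mem_range, ← S'.sum_E w]
    refine Submodule.sum_mem _ fun y _ => ?_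
    by_cases hy : IsConj g y
    · obtain ⟨c, rfl⟩ := isConj_iff.1 hy
      obtain ⟨v, hv⟩ := hsurj (S'.E g (S'.ρ c⁻¹ w)) (E_mem_fiber _ _)
      exact ⟨S.ρ c v, by rw [hρ, hv, ρ_E, ρ_ρ_inv]⟩
    · rw [hS' y hy]; exact Submodule.zero_mem _

/-- An isomorphism of homogeneous components over the centralizer extends to an isomorphism. -/
theorem iso_of_fiber {g : G} (hS : S.SupportedOn g) (hS' : S'.SupportedOn g)
    (e : S.fiber g ≃ₗ[k] S'.fiber g)
    (he : ∀ h, Commute h g → ∀ v w : S.fiber g, (w : V) = S.ρ h v → (e w : V') = S'.ρ h (e v)) :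
    S.Iso S' := by
  classical
  -- A conjugating element `c y` is chosen for each degree `y` in the class; `f` carries the
  -- component of degree `y` to the fiber by `(c y)⁻¹`, applies `e`, and carries it back.
  choose! c hc using fun (y : G) (hy : IsConj g y) => isConj_iff.1 hy
  let f : V →ₗ[k] V' := ∑ y : G, if IsConj g y then
    S'.ρ (c y) ∘ₗ (S'.fiber g).subtype ∘ₗ e.toLinearMap ∘ₗ S.toFiber g ∘ₗ S.ρ (c y)⁻¹ else 0
  -- The result does not depend on the choices: any `x` may be used in place of the chosen
  -- conjugating element. Equivariance of `f` follows from this.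
  have hf : ∀ x v, S'.E (x * g * x⁻¹) (f v) =
      S'.ρ x (e (S.toFiber g (S.ρ x⁻¹ v)) : V') := by
    intro x v
    have hx : IsConj g (x * g * x⁻¹) := isConj_iff.2 ⟨x, rfl⟩
    simp only [f, LinearMap.sum_apply, map_sum]
    rw [Finset.sum_eq_single (x * g * x⁻¹)]
    · rw [if_pos hx]
      have hc' := hc _ hx
      set c := c (x * g * x⁻¹)
      simp only [LinearMap.comp_apply, Submodule.subtype_apply, LinearEquiv.coe_coe]
      rw [← hc', ← ρ_E, mem_fiber.1 (Subtype.coe_prop _)]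
      -- Two elements conjugating `g` to the same element differ by an element of the centralizer,
      -- with which `e` is compatible.
      have hcomm : Commute (c⁻¹ * x) g := by
        rw [Commute, SemiconjBy]
        calc c⁻¹ * x * g = c⁻¹ * (x * g * x⁻¹) * x := by group
          _ = g * (c⁻¹ * x) := by rw [← hc']; group
      have := he _ hcomm (S.toFiber g (S.ρ x⁻¹ v)) (S.toFiber g (S.ρ c⁻¹ v)) (by
        have h1 : c⁻¹ * x * g * (c⁻¹ * x)⁻¹ = g := by rw [hcomm.eq, mul_inv_cancel_right]
        rw [coe_toFiber, coe_toFiber, ρ_E, h1, ← ρ_mul, mul_assoc, mul_inv_cancel, mul_one])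
      rw [this, ← ρ_mul]
      simp
    · intro y _ hy
      split_ifs with hy'
      · have hc' := hc _ hy'
        set c := c y
        simp only [LinearMap.comp_apply, Submodule.subtype_apply, LinearEquiv.coe_coe]
        rw [← mem_fiber.1 (Subtype.coe_prop (e _)), ρ_E, hc', S'.E_E, if_neg (Ne.symm hy)]
      · simp
    · simp
  have hf' : ∀ x v, S'.E g (S'.ρ x (f v)) = (e (S.toFiber g (S.ρ x v)) : V') := by
    intro x v
    have := hf x⁻¹ v
    rw [inv_inv] at this
    rw [S'.E_ρ, this, ρ_ρ_inv]
  have hρ : ∀ h v, f (S.ρ h v) = S'.ρ h (f v) := by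
    intro h v
    refine hS'.ext fun x => ?_
    rw [hf', ← ρ_mul, ← ρ_mul, hf']
  have hE : ∀ x v, f (S.E x v) = S'.E x (f v) := by
    intro x v
    refine hS'.ext fun y => ?_
    rw [hf', ρ_E (S := S'), S'.E_E]
    have : S.toFiber g (S.ρ y (S.E x v)) =
        if g = y * x * y⁻¹ then S.toFiber g (S.ρ y v) else 0 := by
      ext
      rw [coe_toFiber, ρ_E, S.E_E]
      split_ifs <;> rfl
    rw [this]
    split_ifs
    · rw [hf']
    · simp
  have hfib : ∀ v : S.fiber g, f v = e v := by
    intro v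
    have h1 := hf' 1 v
    simp only [map_one, Module.End.one_apply, toFiber_coe] at h1
    rw [← h1, ← hE, mem_fiber.1 v.2]
  have hb : Function.Bijective f := by
    refine bijective_of_fiber hS hS' f hρ hE (fun v hv h0 => ?_) fun w hw => ?_
    · have := hfib ⟨v, hv⟩
      rw [h0] at this
      have h1 : e ⟨v, hv⟩ = 0 := Subtype.ext this.symm
      rw [map_eq_zero_iff e e.injective] at h1
      exact congrArg Subtype.val h1
    · exact ⟨e.symm ⟨w, hw⟩, by rw [hfib]; simp⟩
  exact ⟨LinearEquiv.ofBijective f hb, hρ, hE⟩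

/-- The isomorphism of homogeneous components given by an isomorphism. -/
theorem Iso.fiber (h : S.Iso S') (g : G) : ∃ e : S.fiber g ≃ₗ[k] S'.fiber g,
    ∀ h, ∀ v w : S.fiber g, (w : V) = S.ρ h v → (e w : V') = S'.ρ h (e v) := by
  obtain ⟨e, h₁, h₂⟩ := h
  refine ⟨e.submoduleMap (S.fiber g) ≪≫ₗ LinearEquiv.ofEq _ _ ?_, ?_⟩
  · ext w
    simp only [Submodule.mem_map, mem_fiber]
    constructor
    · rintro ⟨v, hv, rfl⟩
      simp [← h₂, hv]
    · intro hw
      refine ⟨e.symm w, e.injective ?_, by simp⟩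
      simp [h₂, hw]
  · intro h v w hw
    simp [hw, h₁]

end ConjGrading


/-! ### Yetter–Drinfeld modules as graded representations -/

namespace YetterDrinfeldModule

variable {k : Type u} {G : Type w} [Field k] [Group G] [Fintype G] [DecidableEq G]
  (M : YetterDrinfeldModule.{u, v, max u w} k (MonoidAlgebra k G))
  (M' : YetterDrinfeldModule.{u, v', max u w} k (MonoidAlgebra k G))

/-- The graded representation of a Yetter-Drinfeld module. -/
def grading : ConjGrading k G M.carrier where
  ρ := M.act.toMonoidHom.comp (MonoidAlgebra.of k G)
  E := M.component
  E_E := M.component_component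
  sum_E := M.sum_component
  E_ρ g h m := M.component_act g h m

theorem grading_ρ (h : G) (m : M.carrier) :
    M.grading.ρ h m = M.act (MonoidAlgebra.single h 1) m := rfl

theorem grading_E (g : G) (m : M.carrier) : M.grading.E g m = M.component g m := rfl

omit [DecidableEq G] in
variable {M} in
theorem act_eq_sum (x : MonoidAlgebra k G) (m : M.carrier) :
    M.act x m = ∑ h : G, x.coeff h • M.act (MonoidAlgebra.single h 1) m := by
  induction x using MonoidAlgebra.induction_linear with
  | zero => simp
  | add x y hx hy => simp [hx, hy, add_smul, Finset.sum_add_distrib]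
  | single g r =>
    rw [Finset.sum_eq_single g]
    · rw [← LinearMap.smul_apply, ← map_smul]; simp
    · intro h _ hh
      simp [hh.symm]
    · simp

-- The group elements form a basis of `kG`, so a coaction carries exactly the information of its
-- components.
omit [DecidableEq G] in
variable {M} in
theorem coact_eq_sum (m : M.carrier) :
    M.coact m = ∑ g : G, M.component g m ⊗ₜ[k] MonoidAlgebra.single g (1 : k) := by
  simp only [component, LinearMap.comp_apply]
  generalize M.coact m = c
  induction c with
  | zero => simp
  | add a b ha hb =>
    simp only [map_add, TensorProduct.add_tmul, Finset.sum_add_distrib, ← ha, ← hb]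
  | tmul a b =>
    have hb : b = ∑ g : G, b.coeff g • MonoidAlgebra.single g (1 : k) := by
      ext x
      simp
    conv_lhs => rw [hb]
    simp [TensorProduct.tmul_sum, TensorProduct.smul_tmul]

theorem isSubobject_iff_stable (N : Submodule k M.carrier) :
    M.IsSubobject N ↔ M.grading.Stable N := by
  refine and_congr ⟨fun h x m hm => h _ m hm, fun h x m hm => ?_⟩ ⟨fun h g m hm => ?_,
    fun h m hm => ?_⟩
  · rw [act_eq_sum]
    exact N.sum_mem fun y _ => N.smul_mem _ (h y m hm)
  · obtain ⟨z, hz⟩ := h m hm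
    rw [grading_E, component, LinearMap.comp_apply, LinearMap.comp_apply, ← hz]
    clear hz
    induction z with
    | zero => simp
    | add a b ha hb => simp only [map_add]; exact N.add_mem ha hb
    | tmul a b => simpa using N.smul_mem _ a.2
  · rw [coact_eq_sum]
    refine Submodule.sum_mem _ fun g _ => ⟨⟨_, h g m hm⟩ ⊗ₜ[k] MonoidAlgebra.single g (1 : k), ?_⟩
    simp [grading_E]

theorem isIndecomposable_iff : M.IsIndecomposable ↔ IndecOn M.grading.Stable :=
  IndecOn.congr M.isSubobject_iff_stable

theorem isomorphic_iff : M.Isomorphic M' ↔ M.grading.Iso M'.grading := by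
  refine exists_congr fun e => and_congr ⟨fun h x m => h _ m, fun h x m => ?_⟩
    ⟨fun h g m => ?_, fun h m => ?_⟩
  · rw [act_eq_sum, act_eq_sum, map_sum]
    exact Finset.sum_congr rfl fun y _ => by rw [map_smul, ← grading_ρ, h]; rfl
  · simp only [grading_E, component, LinearMap.comp_apply]
    rw [h]
    generalize M.coact m = c
    induction c with
    | zero => simp
    | add a b ha hb => simp only [map_add, ha, hb]
    | tmul a b => simp
  · rw [coact_eq_sum, coact_eq_sum, map_sum]
    exact Finset.sum_congr rfl fun g _ => by
      rw [← grading_E, ← h]; rfl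

end YetterDrinfeldModule

/-! ### Modules over the quantum double as graded representations -/

namespace DrinfeldDouble

variable {k : Type u} {G : Type w} [Field k] [Group G] [Fintype G] [DecidableEq G]

/-- The element `∑ φ_g ⊗ h` of the quantum double. -/
def ofGroup (k : Type u) {G : Type w} [Field k] [DecidableEq G] (h : G) : DrinfeldDouble k G :=
  ⟨fun _ h' => if h' = h then 1 else 0⟩

theorem ofGroup_mul (h h' : G) : ofGroup k (h * h') = ofGroup k h * ofGroup k h' := by
  ext a b
  simp only [coeff_mul, ofGroup, ite_mul, one_mul, zero_mul, Finset.sum_ite_eq',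
    Finset.mem_univ, if_true]
  exact if_congr (by rw [inv_mul_eq_iff_eq_mul]) rfl rfl

theorem basis_mul_ofGroup (g h : G) : basis k g 1 * ofGroup k h = basis k g h := by
  ext a b
  rw [coeff_mul, Finset.sum_eq_single 1]
  · simp [basis, ofGroup, ← ite_and, and_comm]
  · intro c _ hc
    simp [basis, hc]
  · simp

theorem ofGroup_mul_basis (g h : G) :
    ofGroup k h * basis k g 1 = basis k (h * g * h⁻¹) 1 * ofGroup k h := by
  rw [basis_mul_ofGroup]
  ext a b
  simp only [coeff_mul, ofGroup, basis, ite_mul, one_mul, zero_mul, Finset.sum_ite_eq',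
    Finset.mem_univ, if_true]
  refine if_congr (and_congr ?_ ?_) rfl rfl
  · constructor
    · rintro rfl; group
    · rintro rfl; group
  · rw [inv_mul_eq_one, eq_comm]

theorem coeff_sum {ι : Type*} (s : Finset ι) (f : ι → DrinfeldDouble k G) (a b : G) :
    (∑ i ∈ s, f i).coeff a b = ∑ i ∈ s, (f i).coeff a b := by
  classical
  induction s using Finset.induction_on with
  | empty => simp [coeff_zero]
  | insert i s hi ih => rw [Finset.sum_insert hi, Finset.sum_insert hi, coeff_add, ih]

theorem sum_basis_one : ∑ g : G, basis k g 1 = 1 := by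
  ext a b
  simp [coeff_sum, basis, coeff_one, ite_and]

/-- Since `φ_g ⊗ h` factors as `(φ_g ⊗ 1) (∑ φ_x ⊗ h)`, the action of the double is determined by
the projections and the group action. -/
theorem eq_sum (d : DrinfeldDouble k G) :
    d = ∑ g : G, ∑ h : G, d.coeff g h • (basis k g 1 * ofGroup k h) := by
  ext a b
  simp only [coeff_sum, basis_mul_ofGroup, coeff_smul]
  simp [basis, ite_and]

section Modules

variable (M : Type v) [AddCommGroup M] [Module k M] [Module (DrinfeldDouble k G) M]
  [IsScalarTower k (DrinfeldDouble k G) M]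
  (M' : Type v') [AddCommGroup M'] [Module k M'] [Module (DrinfeldDouble k G) M']
  [IsScalarTower k (DrinfeldDouble k G) M']

variable (k G) in
/-- The graded representation of a module over the quantum double. -/
def grading : ConjGrading k G M where
  ρ := (Algebra.lsmul k k M : DrinfeldDouble k G →ₐ[k] Module.End k M).toMonoidHom.comp
    { toFun := ofGroup k
      map_one' := rfl
      map_mul' := ofGroup_mul }
  E g := Algebra.lsmul k k M (basis k g (1 : G))
  E_E g g' m := by
    simp [smul_smul, basis_mul_basis]
  sum_E m := by
    simp only [Algebra.lsmul_coe, ← Finset.sum_smul, sum_basis_one, one_smul]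
  E_ρ g h m := by
    change basis k g 1 • ofGroup k h • m = ofGroup k h • basis k (h⁻¹ * g * h) 1 • m
    rw [smul_smul, smul_smul, ofGroup_mul_basis]
    congr 3
    group

variable {M M'}

theorem grading_ρ (h : G) (m : M) : (grading k G M).ρ h m = ofGroup k h • m := rfl

theorem grading_E (g : G) (m : M) : (grading k G M).E g m = basis k g (1 : G) • m := rfl

theorem smul_eq_sum (d : DrinfeldDouble k G) (m : M) :
    d • m = ∑ g : G, ∑ h : G, d.coeff g h • (grading k G M).E g ((grading k G M).ρ h m) := by
  conv_lhs => rw [eq_sum d]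
  simp only [Finset.sum_smul, smul_assoc, mul_smul]
  rfl

theorem isIndecomposableModule_iff :
    IsIndecomposableModule (DrinfeldDouble k G) M ↔ IndecOn (grading k G M).Stable := by
  refine and_congr Iff.rfl ⟨fun h => ?_, fun h => ?_⟩
  · intro N₁ N₂ h₁ h₂ hc
    let f : ∀ N : Submodule k M, (grading k G M).Stable N →
        Submodule (DrinfeldDouble k G) M := fun N hN =>
      { N with
        smul_mem' := fun d m hm => by
          rw [smul_eq_sum]
          exact N.sum_mem fun g _ => N.sum_mem fun h _ => N.smul_mem _ (hN.2 _ _ (hN.1 _ _ hm)) }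
    have hf : ∀ N hN m, m ∈ f N hN ↔ m ∈ N := fun _ _ _ => Iff.rfl
    have hc' : IsCompl (f N₁ h₁) (f N₂ h₂) := by
      constructor
      · rw [Submodule.disjoint_def]
        exact fun m => Submodule.disjoint_def.1 hc.disjoint m
      · rw [codisjoint_iff, Submodule.eq_top_iff']
        intro m
        have hm : m ∈ N₁ ⊔ N₂ := by rw [hc.sup_eq_top]; trivial
        obtain ⟨a, ha, b, hb, rfl⟩ := Submodule.mem_sup.1 hm
        exact Submodule.add_mem_sup (S := f N₁ h₁) ha hb
    refine (h _ _ hc').imp (fun hb => ?_) (fun hb => ?_) <;>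
    · rw [Submodule.eq_bot_iff] at hb ⊢
      exact hb
  · intro N₁ N₂ hc
    have hst : ∀ N : Submodule (DrinfeldDouble k G) M,
        (grading k G M).Stable (N.restrictScalars k) := fun N =>
      ⟨fun h m hm => N.smul_mem (ofGroup k h) hm, fun g m hm => N.smul_mem (basis k g 1) hm⟩
    have hc' : IsCompl (N₁.restrictScalars k) (N₂.restrictScalars k) := by
      constructor
      · rw [Submodule.disjoint_def]
        exact fun m => Submodule.disjoint_def.1 hc.disjoint m
      · rw [codisjoint_iff, Submodule.eq_top_iff']
        intro m
        have hm : m ∈ N₁ ⊔ N₂ := by rw [hc.sup_eq_top]; trivial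
        obtain ⟨a, ha, b, hb, rfl⟩ := Submodule.mem_sup.1 hm
        exact Submodule.add_mem_sup (S := N₁.restrictScalars k) ha hb
    refine (h _ _ (hst _) (hst _) hc').imp (fun hb => ?_) (fun hb => ?_) <;>
    · rw [Submodule.eq_bot_iff] at hb ⊢
      exact hb

theorem nonempty_linearEquiv_iff :
    Nonempty (M ≃ₗ[DrinfeldDouble k G] M') ↔
      (grading k G M).Iso (grading k G M') := by
  constructor
  · rintro ⟨e⟩
    exact ⟨e.restrictScalars k, fun h m => e.map_smul _ m, fun g m => e.map_smul _ m⟩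
  · rintro ⟨e, h₁, h₂⟩
    refine ⟨{ e with map_smul' := fun d m => ?_ }⟩
    change e (d • m) = d • e m
    simp only [smul_eq_sum, map_sum, map_smul, h₁, h₂]

end Modules

/-- The two routes from a Yetter–Drinfeld module to a graded representation agree, so a
classification of graded representations serves both halves of the theorem. -/
theorem grading_yetterDrinfeldModule
    (M : YetterDrinfeldModule.{u, v, max u w} k (MonoidAlgebra k G)) :
    grading k G M.carrier = M.grading := by
  have h₁ : (grading k G M.carrier).ρ = M.grading.ρ := by
    ext h m
    rw [grading_ρ, M.double_smul_def]
    simp [ofGroup, M.sum_component]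
    rfl
  have h₂ : (grading k G M.carrier).E = M.grading.E := by
    ext g m
    rw [grading_E, M.double_smul_def]
    simp [basis, ite_and, ← MonoidAlgebra.one_def]
    rfl
  -- The remaining fields of the structure are propositions, so equality of `ρ` and `E` suffices.
  generalize grading k G M.carrier = S at *
  generalize M.grading = S' at *
  cases S; cases S'
  subst h₁ h₂
  rfl

end DrinfeldDouble


/-! ### Nilpotent operators and Jordan blocks -/

namespace DihedralYD

variable {k : Type u} [Field k] {V : Type v} [AddCommGroup V] [Module k V]

theorem jordanBlock_mulVec (r : ℕ) (c : k) (x : Fin r → k) (i : Fin r) :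
    (jordanBlock r c *ᵥ x) i = c * x i + if h : i.val + 1 < r then x ⟨i.val + 1, h⟩ else 0 := by
  have hJ : ∀ j : Fin r, jordanBlock r c i j * x j =
      (if i = j then c * x j else 0) + if i.val + 1 = j.val then x j else 0 := by
    intro j
    simp only [jordanBlock, Matrix.of_apply]
    by_cases h : i = j
    · subst h; simp
    · simp [h]
  simp only [Matrix.mulVec, dotProduct, hJ, Finset.sum_add_distrib, Finset.sum_ite_eq,
    Finset.mem_univ, if_true]
  congr 1
  split_ifs with h
  · rw [Finset.sum_eq_single ⟨i.val + 1, h⟩]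
    · simp
    · intro j _ hj
      exact if_neg fun h' => hj (Fin.ext h'.symm)
    · simp
  · exact Finset.sum_eq_zero fun j _ => if_neg fun h' => h (by have := j.isLt; omega)

/-- In coordinates the equation reads `x (i + 1) = (μ - c) x i`, with `x (i + 1)` replaced by zero
at the last index. If `μ ≠ c`, all coordinates vanish from the last one back; if `μ = c`, all but
the first vanish. -/
theorem eigenvector_jordanBlock {r : ℕ} {c μ : k} {x : Fin (r + 1) → k} (hx : x ≠ 0)
    (h : jordanBlock (r + 1) c *ᵥ x = μ • x) : μ = c ∧ ∃ d : k, d ≠ 0 ∧ x = Pi.single 0 d := by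
  have hi : ∀ i : Fin (r + 1), c * x i +
      (if h : i.val + 1 < r + 1 then x ⟨i.val + 1, h⟩ else 0) = μ * x i := fun i => by
    rw [← jordanBlock_mulVec, h]; rfl
  have hμ : μ = c := by
    by_contra hne
    have hz : ∀ m (i : Fin (r + 1)), r - i.val = m → x i = 0 := by
      intro m
      induction m with
      | zero =>
        intro i him
        have := hi i
        rw [dif_neg (by omega), add_zero] at this
        have h' : (μ - c) * x i = 0 := by rw [sub_mul, this, sub_self]
        exact (mul_eq_zero.1 h').resolve_left (sub_ne_zero.2 hne)
      | succ m ih =>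
        intro i him
        have := hi i
        rw [dif_pos (by omega), ih ⟨i.val + 1, by omega⟩ (by simp only; omega), add_zero] at this
        have h' : (μ - c) * x i = 0 := by rw [sub_mul, this, sub_self]
        exact (mul_eq_zero.1 h').resolve_left (sub_ne_zero.2 hne)
    exact hx (funext fun i => hz _ i rfl)
  subst hμ
  have hx' : x = Pi.single 0 (x 0) := by
    ext i
    induction i using Fin.cases with
    | zero => simp
    | succ i =>
      have := hi i.castSucc
      rw [dif_pos (by simp), add_eq_left] at this
      rw [Pi.single_eq_of_ne (Fin.succ_ne_zero i)]
      exact this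
  refine ⟨rfl, x 0, fun h0 => hx ?_, hx'⟩
  rw [hx', h0, Pi.single_zero]

theorem jordanBlock_mulVec_single_zero (r : ℕ) (c d : k) :
    jordanBlock (r + 1) c *ᵥ Pi.single 0 d = c • Pi.single 0 d := by
  ext i
  rw [jordanBlock_mulVec, Pi.smul_apply, smul_eq_mul, add_eq_left]
  split_ifs with h
  · refine Pi.single_eq_of_ne (fun h' => ?_) _
    have := congrArg Fin.val h'
    simp only [Fin.val_zero] at this
    omega
  · rfl

theorem jordanBlock_mulVec_single_succ {r : ℕ} (c : k) (i : ℕ) (h : i + 1 < r) :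
    jordanBlock r c *ᵥ Pi.single ⟨i + 1, h⟩ 1 =
      c • Pi.single ⟨i + 1, h⟩ 1 + Pi.single ⟨i, by omega⟩ 1 := by
  ext j
  rw [jordanBlock_mulVec, Pi.add_apply, Pi.smul_apply, smul_eq_mul]
  congr 1
  simp only [Pi.single_apply, Fin.ext_iff]
  split_ifs <;> first | rfl | omega

/-- The last basis vector is cyclic: the block sends `e_(i+1)` to `c e_(i+1) + e_i`, so the basis
vectors are reached from the last one back to the first. -/
theorem eq_top_of_last_mem_of_jordanBlock {r : ℕ} (c : k) (N : Submodule k (Fin (r + 1) → k))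
    (h : Pi.single (Fin.last r) 1 ∈ N) (hN : ∀ x ∈ N, jordanBlock (r + 1) c *ᵥ x ∈ N) :
    N = ⊤ := by
  have key : ∀ m (i : Fin (r + 1)), r - i.val = m → Pi.single i (1 : k) ∈ N := by
    intro m
    induction m with
    | zero =>
      intro i hi
      have : i = Fin.last r := Fin.ext (by rw [Fin.val_last]; omega)
      rwa [this]
    | succ m ih =>
      intro i hi
      have h1 := ih ⟨i.val + 1, by omega⟩ (by simp only; omega)
      have h2 := hN _ h1
      rw [jordanBlock_mulVec_single_succ c i.val (by omega)] at h2
      exact (N.add_mem_iff_right (N.smul_mem c h1)).1 h2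
  rw [Submodule.eq_top_iff']
  intro x
  rw [pi_eq_sum_univ' x]
  exact N.sum_mem fun i _ => N.smul_mem _ (by
    have := key _ i rfl
    convert this using 1)

/-- The linear map `k^r → V` that sends the standard basis to `N^(r-1) v, …, N v, v`. -/
def cyclicMap (N : Module.End k V) (v : V) (r : ℕ) : (Fin r → k) →ₗ[k] V :=
  Fintype.linearCombination k fun i : Fin r => (N ^ (r - 1 - i.val)) v

theorem cyclicMap_apply (N : Module.End k V) (v : V) (r : ℕ) (x : Fin r → k) :
    cyclicMap N v r x = ∑ i, x i • (N ^ (r - 1 - i.val)) v := rfl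

theorem cyclicMap_last (N : Module.End k V) (v : V) (r : ℕ) :
    cyclicMap N v (r + 1) (Pi.single (Fin.last r) 1) = v := by
  rw [cyclicMap, Fintype.linearCombination_apply_single]
  simp

/-- The nilpotent part moves each vector `N ^ (r - 1 - i) v` to its predecessor in the list and
kills the first, which is what the superdiagonal of the block does. -/
theorem cyclicMap_jordanBlock (T : Module.End k V) (c : k) (v : V) (r : ℕ)
    (hv : ((T - algebraMap k _ c) ^ r) v = 0) (x : Fin r → k) :
    cyclicMap (T - algebraMap k _ c) v r (jordanBlock r c *ᵥ x) =
      T (cyclicMap (T - algebraMap k _ c) v r x) := by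
  set N := T - algebraMap k _ c with hN
  have hT : ∀ w, T w = c • w + N w := by
    intro w; simp [hN, Module.algebraMap_end_apply]
  have h1 : N (cyclicMap N v r x) = ∑ i : Fin r,
      (if h : i.val + 1 < r then x ⟨i.val + 1, h⟩ else 0) • (N ^ (r - 1 - i.val)) v := by
    rw [cyclicMap_apply]
    simp only [map_sum, map_smul, ← Module.End.mul_apply, ← pow_succ']
    cases r with
    | zero => simp
    | succ m =>
      -- The left sum loses its first term, `N ^ r v = 0`, and the right sum its last, whose
      -- coefficient is the default value `0`; the rest agree after a shift of the index.
      rw [Fin.sum_univ_succ, Fin.sum_univ_castSucc]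
      have h0 : (N ^ (m + 1 - 1 - (0 : Fin (m + 1)).val + 1)) v = 0 := by simpa using hv
      rw [h0]
      simp only [smul_zero, zero_add, Fin.val_last, lt_self_iff_false, dif_neg, not_false_eq_true,
        zero_smul, add_zero]
      refine Finset.sum_congr rfl fun i _ => ?_
      have hi := i.isLt
      rw [dif_pos (by simp)]
      congr 2
      congr 1
      simp only [Fin.val_succ, Fin.val_castSucc]
      omega
  rw [hT, h1, cyclicMap_apply, cyclicMap_apply, Finset.smul_sum, ← Finset.sum_add_distrib]
  refine Finset.sum_congr rfl fun i _ => ?_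
  rw [jordanBlock_mulVec, add_smul, mul_smul]

/-- The linear map `V → k^r` with the coordinates `w ↦ f (N^j w)`. -/
def cocyclicMap (N : Module.End k V) (f : V →ₗ[k] k) (r : ℕ) : V →ₗ[k] (Fin r → k) :=
  LinearMap.pi fun j => f ∘ₗ N ^ j.val

/-- Without the bound on `j` the condition is visibly stable under `N`. -/
theorem mem_ker_cocyclicMap {N : Module.End k V} {f : V →ₗ[k] k} {r : ℕ} (hN : N ^ r = 0)
    {w : V} : w ∈ LinearMap.ker (cocyclicMap N f r) ↔ ∀ j : ℕ, f ((N ^ j) w) = 0 := by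
  rw [LinearMap.mem_ker]
  constructor
  · intro h j
    by_cases hj : j < r
    · exact congrFun h ⟨j, hj⟩
    · rw [pow_eq_zero_of_le (not_lt.1 hj) hN]; simp
  · intro h
    exact funext fun j => h j

/-- The composite has the matrix `f (N ^ (j + r - 1 - i) v)`. It is upper triangular, since the
exponent is at least `r` when `i < j`, and its diagonal is constantly `f (N ^ (r - 1) v) ≠ 0`.
Consequently the cyclic subspace of `v` is complementary to the kernel of the cocyclic map. -/
theorem cocyclicMap_cyclicMap_bijective {N : Module.End k V} {v : V} {f : V →ₗ[k] k} {r : ℕ}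
    (hN : N ^ r = 0) (hf : f ((N ^ (r - 1)) v) ≠ 0) :
    Function.Bijective (cocyclicMap N f r ∘ₗ cyclicMap N v r) := by
  let B : Matrix (Fin r) (Fin r) k := Matrix.of fun j i => f ((N ^ (j.val + (r - 1 - i.val))) v)
  have hB : cocyclicMap N f r ∘ₗ cyclicMap N v r = B.mulVecLin := by
    ext x j
    simp [cocyclicMap, cyclicMap_apply, B, Matrix.mulVec, dotProduct, ← Module.End.mul_apply,
      ← pow_add, Pi.single_apply]
  have hdet : IsUnit B := by
    rw [Matrix.isUnit_iff_isUnit_det, Matrix.det_of_isUpperTriangular, isUnit_iff_ne_zero,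
      Finset.prod_ne_zero_iff]
    · intro i _
      have : i.val + (r - 1 - i.val) = r - 1 := by omega
      simpa [B, this] using hf
    · intro j i hij
      have hij' : i.val < j.val := hij
      have := j.isLt
      simp only [B, Matrix.of_apply]
      rw [pow_eq_zero_of_le (by omega) hN]; simp
  have hinj : Function.Injective (cocyclicMap N f r ∘ₗ cyclicMap N v r) := by
    rw [hB]
    exact Matrix.mulVec_injective_iff_isUnit.2 hdet
  exact ⟨hinj, LinearMap.injective_iff_surjective.1 hinj⟩

theorem isCompl_range_ker_of_bijective {W : Type*} [AddCommGroup W] [Module k W]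
    {φ : W →ₗ[k] V} {ψ : V →ₗ[k] W} (h : Function.Bijective (ψ ∘ₗ φ)) :
    IsCompl (LinearMap.range φ) (LinearMap.ker ψ) := by
  constructor
  · rw [Submodule.disjoint_def]
    rintro _ ⟨x, rfl⟩ hx
    have : x = 0 := h.1 (by rw [map_zero]; exact hx)
    rw [this, map_zero]
  · rw [codisjoint_iff, Submodule.eq_top_iff']
    intro v
    obtain ⟨x, hx⟩ := h.2 (ψ v)
    rw [← add_sub_cancel (φ x) v]
    refine Submodule.add_mem_sup ⟨x, rfl⟩ ?_
    rw [LinearMap.mem_ker, map_sub, ← hx, LinearMap.comp_apply, sub_self]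

/-- If the image of the cyclic map and its natural complement satisfy `P`, and `V` is
indecomposable relative to `P`, then the cyclic map is bijective. -/
theorem cyclicMap_bijective {P : Submodule k V → Prop} (hP : IndecOn P) {N : Module.End k V}
    {v : V} {f : V →ₗ[k] k} {r : ℕ} (hr : 1 ≤ r) (hN : N ^ r = 0)
    (hf : f ((N ^ (r - 1)) v) ≠ 0) (h₁ : P (LinearMap.range (cyclicMap N v r)))
    (h₂ : P (LinearMap.ker (cocyclicMap N f r))) :
    Function.Bijective (cyclicMap N v r) := by
  have hb := cocyclicMap_cyclicMap_bijective hN hf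
  refine ⟨fun x y h => hb.1 (by simp [h]), LinearMap.range_eq_top.1 ?_⟩
  refine hP.eq_top h₁ h₂ (isCompl_range_ker_of_bijective hb) fun hbot => hf ?_
  obtain ⟨m, rfl⟩ : ∃ m, r = m + 1 := ⟨r - 1, by omega⟩
  have hv : v ∈ LinearMap.range (cyclicMap N v (m + 1)) := ⟨_, cyclicMap_last N v m⟩
  rw [hbot, Submodule.mem_bot] at hv
  simp [hv]

theorem exists_dual_ne_zero {v : V} (hv : v ≠ 0) : ∃ f : V →ₗ[k] k, f v ≠ 0 := by
  by_contra! h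
  exact hv ((Module.forall_dual_apply_eq_zero_iff k v).1 h)

/-- An indecomposable operator with a single eigenvalue is a Jordan block. -/
theorem exists_equiv_jordanBlock {T : Module.End k V}
    (hT : IndecOn fun N : Submodule k V => ∀ v ∈ N, T v ∈ N) {c : k} {q : ℕ}
    (hq : (T - algebraMap k _ c) ^ q = 0) :
    ∃ r, (1 ≤ r ∧ r ≤ q) ∧ ∃ e : (Fin r → k) ≃ₗ[k] V,
      ∀ x, e (jordanBlock r c *ᵥ x) = T (e x) := by
  have := hT.1
  set N : Module.End k V := T - algebraMap k _ c with hN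
  have hTN : ∀ w, T w = c • w + N w := by
    intro w; simp [hN, Module.algebraMap_end_apply]
  have hnil : IsNilpotent N := ⟨q, hq⟩
  set r := nilpotencyClass N with hr
  have hr1 : 1 ≤ r := pos_nilpotencyClass_iff.2 hnil
  have hNr : N ^ r = 0 := pow_nilpotencyClass hnil
  obtain ⟨v, hv⟩ : ∃ v, (N ^ (r - 1)) v ≠ 0 := by
    by_contra! h
    exact pow_pred_nilpotencyClass hnil (LinearMap.ext fun w => h w)
  obtain ⟨f, hf⟩ := exists_dual_ne_zero (k := k) hv
  have hφ := cyclicMap_jordanBlock T c v r (by rw [← hN, hNr]; rfl)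
  have hb := cyclicMap_bijective hT hr1 hNr hf
    (by
      rintro _ ⟨x, rfl⟩
      exact ⟨_, hφ x⟩)
    (by
      intro w hw
      rw [mem_ker_cocyclicMap hNr] at hw ⊢
      intro j
      rw [hTN, map_add, map_add, map_smul, map_smul, hw, ← Module.End.mul_apply, ← pow_succ, hw]
      simp)
  exact ⟨r, ⟨hr1, csInf_le' hq⟩, LinearEquiv.ofBijective _ hb, hφ⟩

/-- Fitting's lemma. -/
theorem isNilpotent_of_indecOn [FiniteDimensional k V] {P : Submodule k V → Prop}
    (hP : IndecOn P) (F : Module.End k V) (h₁ : ∀ m, P (LinearMap.ker (F ^ m)))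
    (h₂ : ∀ m, P (LinearMap.range (F ^ m))) {v : V} (hv : v ≠ 0) (hFv : F v = 0) :
    IsNilpotent F := by
  obtain ⟨m, hm⟩ := Filter.eventually_atTop.1 (LinearMap.eventually_isCompl_ker_pow_range_pow F)
  -- The exponent is taken positive so that `v`, which `F` kills, lies in the kernel of the power.
  have hm' := hm (m + 1) (by omega)
  refine ⟨m + 1, ?_⟩
  rw [← LinearMap.ker_eq_top]
  refine hP.eq_top (h₁ _) (h₂ _) hm' fun hb => hv ?_
  have : v ∈ LinearMap.ker (F ^ (m + 1)) := by
    rw [LinearMap.mem_ker, pow_succ, Module.End.mul_apply, hFv, map_zero]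
  rwa [hb] at this

theorem isNilpotent_sub_of_indecOn [FiniteDimensional k V] {T : Module.End k V}
    (hT : IndecOn fun N : Submodule k V => ∀ v ∈ N, T v ∈ N) {c : k} {v : V} (hv : v ≠ 0)
    (hTv : T v = c • v) : IsNilpotent (T - algebraMap k _ c) := by
  have hc : Commute T (T - algebraMap k _ c) :=
    (Commute.refl T).sub_right (Algebra.commutes c T).symm
  refine isNilpotent_of_indecOn hT _ (fun m w hw => ?_) (fun m => ?_) hv
    (by simp [hTv, Module.algebraMap_end_apply])
  · rw [LinearMap.mem_ker] at hw ⊢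
    rw [← Module.End.mul_apply, ← (hc.pow_right m).eq, Module.End.mul_apply, hw, map_zero]
  · rintro _ ⟨w, rfl⟩
    exact ⟨T w, by rw [← Module.End.mul_apply, ← (hc.pow_right m).eq, Module.End.mul_apply]⟩

theorem pow_smul_of_eigenvector {T : Module.End k V} {c : k} {v : V} (h : T v = c • v) (m : ℕ) :
    (T ^ m) v = c ^ m • v := by
  induction m with
  | zero => simp
  | succ m ih => rw [pow_succ, Module.End.mul_apply, h, map_smul, ih, smul_smul, pow_succ']

section CharP

variable {p s t n : ℕ} [Fact p.Prime] [CharP k p]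

/-- In characteristic `p`, `c ^ n - 1 = (c ^ t - 1) ^ (p ^ s)`, so `c` is already a `t`-th root of
unity. -/
theorem eigenvalue_eq_pow {T : Module.End k V} (hn : n = p ^ s * t) [NeZero n]
    (hT : T ^ n = 1) {ξ : k} (hξ : IsPrimitiveRoot ξ t) {c : k} {v : V} (hv : v ≠ 0)
    (hc : T v = c • v) : ∃ j < t, ξ ^ j = c := by
  have h1 : c ^ n = 1 := by
    have := pow_smul_of_eigenvector hc n
    rw [hT, Module.End.one_apply] at this
    have h2 : (c ^ n - 1) • v = 0 := by rw [sub_smul, one_smul, ← this, sub_self]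
    exact sub_eq_zero.1 ((smul_eq_zero.1 h2).resolve_right hv)
  have h2 : c ^ t = 1 := by
    rw [hn, mul_comm, pow_mul, ← sub_eq_zero, ← one_pow (p ^ s), ← sub_pow_char_pow] at h1
    exact sub_eq_zero.1 (eq_zero_of_pow_eq_zero h1)
  have : NeZero t := ⟨by rintro rfl; exact NeZero.ne n (by simpa using hn)⟩
  exact hξ.eq_pow_of_pow_eq_one h2

/-- This bounds the block size. The operator `U = c ^ (-p ^ s) T ^ (p ^ s)` is unipotent, so some
`p`-power of it is `1`; also `U ^ t = 1` with `t` prime to `p`. Hence `U = 1`, and `(T - c) ^ (p ^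
s) = T ^ (p ^ s) - c ^ (p ^ s)` vanishes. -/
theorem sub_pow_eq_zero_of_isNilpotent [Nontrivial V] {T : Module.End k V}
    (hn : n = p ^ s * t) (ht : ¬ p ∣ t) (hT : T ^ n = 1) {c : k} (hc : c ^ t = 1)
    (ht0 : t ≠ 0) (hnil : IsNilpotent (T - algebraMap k _ c)) :
    (T - algebraMap k _ c) ^ p ^ s = 0 := by
  have hp : p.Prime := Fact.out
  have : CharP (Module.End k V) p := charP_of_injective_algebraMap (algebraMap k _).injective p
  have hcomm : Commute T (algebraMap k (Module.End k V) c) := (Algebra.commutes c T).symm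
  have hc0 : c ≠ 0 := by rintro rfl; simp [ht0] at hc
  have hpow := sub_pow_char_pow_of_commute p s hcomm
  set U : Module.End k V := (c ^ p ^ s)⁻¹ • T ^ p ^ s with hU
  have hU1 : U - 1 = (c ^ p ^ s)⁻¹ • (T - algebraMap k _ c) ^ p ^ s := by
    rw [hpow, smul_sub, ← map_pow, Algebra.algebraMap_eq_smul_one, smul_smul,
      inv_mul_cancel₀ (pow_ne_zero _ hc0), one_smul]
  have hUnil : IsNilpotent (U - 1) := by
    obtain ⟨m, hm⟩ := hnil
    refine ⟨m, ?_⟩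
    rw [hU1, smul_pow, ← pow_mul, mul_comm, pow_mul, hm, zero_pow (pow_ne_zero _ hp.ne_zero),
      smul_zero]
  obtain ⟨m, hm⟩ := hUnil
  -- The exponent `p ^ m` exceeds `m`, so `U ^ (p ^ m) - 1 = (U - 1) ^ (p ^ m) = 0`.
  have h1 : U ^ p ^ m = 1 := by
    have h2 := sub_pow_char_pow_of_commute p m (Commute.one_right U)
    rw [pow_eq_zero_of_le (Nat.lt_pow_self hp.one_lt).le hm, one_pow] at h2
    exact (sub_eq_zero.1 h2.symm)
  have h2 : U ^ t = 1 := by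
    rw [hU, smul_pow, ← pow_mul, ← hn, hT, inv_pow, ← pow_mul, mul_comm, pow_mul, hc, one_pow,
      inv_one, one_smul]
  have h3 : U = 1 := by
    have := pow_gcd_eq_one.2 ⟨h1, h2⟩
    rwa [Nat.Coprime.gcd_eq_one (Nat.Coprime.pow_left m ((Nat.Prime.coprime_iff_not_dvd hp).2 ht)),
      pow_one] at this
  rw [h3, sub_self] at hU1
  exact (smul_eq_zero.1 hU1.symm).resolve_left (inv_ne_zero (pow_ne_zero _ hc0))

/-- An indecomposable operator `T` with `T ^ n = 1` is a Jordan block. -/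
theorem exists_equiv_jordanBlock_of_pow_eq_one [IsAlgClosed k] [FiniteDimensional k V] [NeZero n]
    {T : Module.End k V} (hn : n = p ^ s * t) (ht : ¬ p ∣ t) (hT : T ^ n = 1) {ξ : k}
    (hξ : IsPrimitiveRoot ξ t) (hT' : IndecOn fun N : Submodule k V => ∀ v ∈ N, T v ∈ N) :
    ∃ r j, (1 ≤ r ∧ r ≤ p ^ s) ∧ j < t ∧ ∃ e : (Fin r → k) ≃ₗ[k] V,
      ∀ x, e (jordanBlock r (ξ ^ j) *ᵥ x) = T (e x) := by
  have := hT'.1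
  obtain ⟨c, hc⟩ := Module.End.exists_eigenvalue T
  obtain ⟨v, hv⟩ := hc.exists_hasEigenvector
  obtain ⟨j, hj, rfl⟩ := eigenvalue_eq_pow hn hT hξ hv.2 hv.apply_eq_smul
  have hnil := isNilpotent_sub_of_indecOn hT' hv.2 hv.apply_eq_smul
  have ht0 : t ≠ 0 := by omega
  have h0 := sub_pow_eq_zero_of_isNilpotent hn ht hT
    (by rw [← pow_mul, mul_comm, pow_mul, hξ.pow_eq_one, one_pow]) ht0 hnil
  obtain ⟨r, hr, e, he⟩ := exists_equiv_jordanBlock hT' h0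
  exact ⟨r, j, hr, hj, e, he⟩

end CharP

end DihedralYD


namespace DihedralYD

variable {k : Type u} [Field k] {V : Type v} [AddCommGroup V] [Module k V]

/-! ### Pairs of operators satisfying the relations of a dihedral group -/

/-- The subspaces stable under two operators. -/
def PairStable (a b : Module.End k V) (N : Submodule k V) : Prop :=
  ∀ v ∈ N, a v ∈ N ∧ b v ∈ N

variable {n : ℕ} {a b : Module.End k V}

theorem pow_mem_of_forall {N : Submodule k V} (h : ∀ v ∈ N, a v ∈ N) (m : ℕ)
    {v : V} (hv : v ∈ N) : (a ^ m) v ∈ N := by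
  induction m with
  | zero => exact hv
  | succ m ih => rw [pow_succ', Module.End.mul_apply]; exact h _ ih

/-- Throughout, `a ^ (n - 1)` plays the role of `a⁻¹` in the endomorphism ring. -/
theorem pow_pred_mul [NeZero n] (ha : a ^ n = 1) : a ^ (n - 1) * a = 1 := by
  rw [← pow_succ, Nat.sub_add_cancel (NeZero.pos n), ha]

theorem mul_pow_pred [NeZero n] (ha : a ^ n = 1) : a * a ^ (n - 1) = 1 := by
  rw [← pow_succ', Nat.sub_add_cancel (NeZero.pos n), ha]

theorem mul_eq_pow_pred_mul [NeZero n] (ha : a ^ n = 1) (hab : a * b * a = b) :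
    b * a = a ^ (n - 1) * b := by
  nth_rewrite 2 [← hab]
  rw [← mul_assoc, ← mul_assoc, pow_pred_mul ha, one_mul]

theorem mul_pow_pred_eq [NeZero n] (ha : a ^ n = 1) (hab : a * b * a = b) :
    b * a ^ (n - 1) = a * b := by
  nth_rewrite 1 [← hab]
  rw [mul_assoc, mul_pow_pred ha, mul_one]

/-- An operator commuting with `a` and `b` that is not injective is nilpotent if `V` is
indecomposable under `a` and `b`. -/
theorem isNilpotent_of_commute [FiniteDimensional k V] (hV : IndecOn (PairStable a b))
    {F : Module.End k V} (h₁ : Commute a F) (h₂ : Commute b F) {v : V} (hv : v ≠ 0)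
    (hFv : F v = 0) : IsNilpotent F := by
  have key : ∀ {c : Module.End k V}, Commute c F → ∀ m w, (F ^ m) (c w) = c ((F ^ m) w) := by
    intro c hc m w
    rw [← Module.End.mul_apply, ← (hc.pow_right m).eq, Module.End.mul_apply]
  refine isNilpotent_of_indecOn hV F (fun m w hw => ?_) (fun m => ?_) hv hFv
  · rw [LinearMap.mem_ker] at hw
    simp only [LinearMap.mem_ker, key h₁, key h₂, hw, map_zero, and_self]
  · rintro _ ⟨w, rfl⟩
    exact ⟨⟨a w, key h₁ m w⟩, ⟨b w, key h₂ m w⟩⟩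

/-- The last column of `T` has alternating signs, which cancel in consecutive pairs under `1 +
shift`, except at the last index. This relation and `J T J = T` determine `T`. -/
theorem involutionMatrix_last (r : ℕ) :
    jordanBlock (r + 1) (1 : k) *ᵥ (involutionMatrix k (r + 1) *ᵥ Pi.single (Fin.last r) 1) =
      Pi.single (Fin.last r) 1 := by
  have hT : involutionMatrix k (r + 1) *ᵥ Pi.single (Fin.last r) 1 =
      fun i => (-1) ^ (r - i.val) := by
    ext i
    simp [involutionMatrix]
  rw [hT]
  ext i
  rw [jordanBlock_mulVec, one_mul]
  split_ifs with h
  · have h1 : r - i.val = r - (i.val + 1) + 1 := by omega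
    rw [Pi.single_eq_of_ne (fun h' => by simp [h'] at h), h1, pow_succ]
    ring
  · have : i = Fin.last r := Fin.ext (by rw [Fin.val_last]; omega)
    subst this
    simp

/-- By `J T J = T` and `a b a = b`, the vectors on which `b` agrees with `ε T` form a subspace
stable under the Jordan block. The last basis vector generates everything, so one check there
suffices. -/
theorem equiv_involutionMatrix {r : ℕ} (e : (Fin (r + 1) → k) ≃ₗ[k] V)
    (he : ∀ x, e (jordanBlock (r + 1) 1 *ᵥ x) = a (e x)) (ha : Function.Injective a)
    (hab : a * b * a = b) {ε : k}
    (hv : a (b (e (Pi.single (Fin.last r) 1))) = ε • e (Pi.single (Fin.last r) 1))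
    (x : Fin (r + 1) → k) : e (ε • involutionMatrix k (r + 1) *ᵥ x) = b (e x) := by
  have hab' : ∀ w, a (b (a w)) = b w := fun w => LinearMap.congr_fun hab w
  have htop := eq_top_of_last_mem_of_jordanBlock (1 : k)
    (LinearMap.ker (e.toLinearMap ∘ₗ (ε • (involutionMatrix k (r + 1)).mulVecLin) -
      b ∘ₗ e.toLinearMap))
    (by
      rw [LinearMap.mem_ker, LinearMap.sub_apply, sub_eq_zero]
      refine ha ?_
      simp only [LinearMap.comp_apply, LinearMap.smul_apply, Matrix.mulVecLin_apply,
        LinearEquiv.coe_coe, hv, map_smul]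
      rw [← he, involutionMatrix_last])
    (by
      intro y hy
      rw [LinearMap.mem_ker, LinearMap.sub_apply, sub_eq_zero] at hy ⊢
      simp only [LinearMap.comp_apply, LinearMap.smul_apply, Matrix.mulVecLin_apply,
        LinearEquiv.coe_coe, map_smul] at hy ⊢
      refine ha ?_
      rw [he, hab', ← hy, map_smul, ← he, Matrix.mulVec_mulVec, Matrix.mulVec_mulVec,
        jordanBlock_mul_involutionMatrix_mul])
  have hx : x ∈ (⊤ : Submodule k (Fin (r + 1) → k)) := trivial
  rw [← htop, LinearMap.mem_ker, LinearMap.sub_apply, sub_eq_zero] at hx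
  simpa [Matrix.smul_mulVec] using hx

theorem injective_of_pow_eq_one [NeZero n] (ha : a ^ n = 1) : Function.Injective a := by
  intro x y h
  have h1 : ∀ w, (a ^ (n - 1)) (a w) = w := fun w => by
    rw [← Module.End.mul_apply, pow_pred_mul ha]; rfl
  rw [← h1 x, h, h1]

section Unipotent

variable [NeZero n]

/-- From `b a = a⁻¹ b` comes `b (a - 1) = -a⁻¹ (a - 1) b`, and the factors on the right that involve
`a` commute. -/
theorem mul_pow_sub_one (ha : a ^ n = 1) (hab : a * b * a = b) (j : ℕ) :
    b * (a - 1) ^ j = (-1) ^ j * (a ^ (n - 1)) ^ j * (a - 1) ^ j * b := by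
  have h1 : b * (a - 1) = (-(a ^ (n - 1) * (a - 1))) * b := by
    rw [mul_sub, mul_sub, pow_pred_mul ha, mul_eq_pow_pred_mul ha hab]; noncomm_ring
  have h2 : b * (a - 1) ^ j = (-(a ^ (n - 1) * (a - 1))) ^ j * b :=
    (SemiconjBy.pow_right (show SemiconjBy b (a - 1) (-(a ^ (n - 1) * (a - 1))) from h1) j)
  have hc : Commute (a ^ (n - 1)) (a - 1) :=
    ((Commute.refl a).sub_right (Commute.one_right a)).pow_left _
  rw [h2, neg_pow, hc.mul_pow]
  simp only [mul_assoc]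

theorem pow_sub_one_mul (ha : a ^ n = 1) (hab : a * b * a = b) (j : ℕ) :
    (a - 1) ^ j * b = b * (-1) ^ j * (a - 1) ^ j * (a ^ (n - 1)) ^ j := by
  have h1 : (-((a - 1) * a ^ (n - 1))) = a ^ (n - 1) - 1 := by
    rw [sub_mul, mul_pow_pred ha, one_mul, neg_sub]
  have h2 : b * (-((a - 1) * a ^ (n - 1))) = (a - 1) * b := by
    rw [h1, mul_sub, mul_pow_pred_eq ha hab, mul_one, sub_mul, one_mul]
  have h3 : b * (-((a - 1) * a ^ (n - 1))) ^ j = (a - 1) ^ j * b :=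
    (SemiconjBy.pow_right (show SemiconjBy b (-((a - 1) * a ^ (n - 1))) (a - 1) from h2) j)
  have hc : Commute (a - 1) (a ^ (n - 1)) :=
    (((Commute.refl a).sub_right (Commute.one_right a)).pow_left _).symm
  rw [← h3, neg_pow, hc.mul_pow]
  simp only [mul_assoc]

/-- An indecomposable pair with `a` unipotent. -/
theorem exists_equiv_unipotent (h2 : (2 : k) ≠ 0) (hodd : Odd n) (ha : a ^ n = 1) (hb : b * b = 1)
    (hab : a * b * a = b) (hV : IndecOn (PairStable a b)) {q : ℕ} (hq : (a - 1) ^ q = 0) :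
    ∃ r, (1 ≤ r ∧ r ≤ q) ∧ ∃ ε : k, (ε = 1 ∨ ε = -1) ∧ ∃ e : (Fin r → k) ≃ₗ[k] V,
      (∀ x, e (jordanBlock r 1 *ᵥ x) = a (e x)) ∧
      ∀ x, e (ε • involutionMatrix k r *ᵥ x) = b (e x) := by
  have := hV.1
  have hbb : ∀ w, b (b w) = w := fun w => by rw [← Module.End.mul_apply, hb]; rfl
  set N : Module.End k V := a - 1 with hN
  have hnil : IsNilpotent N := ⟨q, hq⟩
  set r := nilpotencyClass N with hr
  have hr1 : 1 ≤ r := pos_nilpotencyClass_iff.2 hnil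
  have hNr : N ^ r = 0 := pow_nilpotencyClass hnil
  have hrq : r ≤ q := csInf_le' hq
  -- Every vector is half the sum of the `b`-eigenvectors `w + b w` and `w - b w`, so `N ^ (r - 1)`
  -- cannot kill all eigenvectors of `b`.
  obtain ⟨v, ε, hε, hbv, hv⟩ : ∃ v : V, ∃ ε : k, (ε = 1 ∨ ε = -1) ∧ b v = ε • v ∧
      (N ^ (r - 1)) v ≠ 0 := by
    by_contra! h
    refine pow_pred_nilpotencyClass hnil (LinearMap.ext fun w => ?_)
    have h1 := h (w + b w) 1 (Or.inl rfl) (by rw [map_add, hbb, one_smul, add_comm])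
    have h3 := h (w - b w) (-1) (Or.inr rfl) (by rw [map_sub, hbb]; module)
    have h4 : (2 : k) • (N ^ (r - 1)) w = 0 := by
      have : (2 : k) • w = (w + b w) + (w - b w) := by module
      rw [← map_smul, this, map_add, h1, h3, add_zero]
    exact (smul_eq_zero.1 h4).resolve_left h2
  have hεε : ε * ε = 1 := by rcases hε with rfl | rfl <;> simp
  obtain ⟨m, hm⟩ := hodd
  -- powers of `a` act trivially on the image of `N ^ (r - 1)`
  have hfix : ∀ j, N ^ (r - 1) * a ^ j = N ^ (r - 1) := by
    intro j
    have h1 : N ^ (r - 1) * a = N ^ (r - 1) := by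
      have : a = N + 1 := by simp [hN]
      calc N ^ (r - 1) * a = N ^ (r - 1) * (N + 1) := by rw [← this]
        _ = N ^ (r - 1) := by
          rw [mul_add, ← pow_succ, Nat.sub_add_cancel hr1, hNr, zero_add, mul_one]
    induction j with
    | zero => simp
    | succ j ih => rw [pow_succ', ← mul_assoc, h1, ih]
  have hac : ∀ i j, a ^ i * N ^ j = N ^ j * a ^ i := fun i j =>
    (((Commute.refl a).sub_right (Commute.one_right a)).pow_pow i j).eq
  have hbN := fun j => mul_pow_sub_one (b := b) ha hab j
  have hNb := fun j => pow_sub_one_mul (b := b) ha hab j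
  rw [← hN] at hbN hNb
  have hneg : ∀ (j : ℕ) (w : V), ((-1 : Module.End k V) ^ j) w = (-1 : k) ^ j • w := by
    intro j w
    rcases Nat.even_or_odd j with hj | hj <;> simp [hj.neg_one_pow]
  -- With `n = 2 m + 1`, `a ^ (m + 1)` is a square root of `a`. It turns a `b`-eigenvector into an
  -- `a b`-eigenvector: `a b a ^ (m + 1) = b a ^ m = a ^ (-m) b = a ^ (m + 1) b`. This is the
  -- normalization of `involutionMatrix_last`.
  obtain ⟨v₀, hv₀⟩ : ∃ v₀ : V, v₀ = (a ^ (m + 1)) v := ⟨_, rfl⟩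
  have hbpow : ∀ j, b * a ^ j = (a ^ (n - 1)) ^ j * b := fun j =>
    (SemiconjBy.pow_right (show SemiconjBy b a (a ^ (n - 1)) from mul_eq_pow_pred_mul ha hab) j)
  have habv₀ : a (b v₀) = ε • v₀ := by
    have h1 : (a ^ (n - 1)) ^ m = a ^ (m + 1) := by
      have h3 : (a ^ (n - 1)) ^ m * a ^ m = 1 := by
        rw [← (Commute.pow_left (Commute.refl a) (n - 1)).mul_pow, pow_pred_mul ha, one_pow]
      calc (a ^ (n - 1)) ^ m = (a ^ (n - 1)) ^ m * a ^ n := by rw [ha, mul_one]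
        _ = (a ^ (n - 1)) ^ m * a ^ m * a ^ (m + 1) := by
          rw [mul_assoc, ← pow_add]; congr 2; omega
        _ = _ := by rw [h3, one_mul]
    have h3 : a * (b * a ^ (m + 1)) = a ^ (m + 1) * b := by
      rw [pow_succ', ← mul_assoc, ← mul_assoc, hab, hbpow, h1, ← pow_succ']
    have h4 := LinearMap.congr_fun h3 v
    simpa only [Module.End.mul_apply, hbv, map_smul, ← hv₀] using h4
  have hNv₀ : (N ^ (r - 1)) v₀ = (N ^ (r - 1)) v := by
    rw [hv₀, ← Module.End.mul_apply, hfix]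
  rw [← hNv₀] at hv
  -- Passing `b` through `N ^ (r - 1)` contributes the sign; the power of `a` that appears acts
  -- trivially there.
  set δ : k := (-1) ^ (r - 1) * ε with hδ
  have hδδ : δ * δ = 1 := by
    rw [hδ, mul_mul_mul_comm, hεε, ← mul_pow]; simp
  have hbu : b ((N ^ (r - 1)) v₀) = δ • (N ^ (r - 1)) v₀ := by
    rw [hNv₀, ← Module.End.mul_apply, hbN, mul_assoc ((-1) ^ (r - 1)), ← pow_mul, hac, hfix,
      Module.End.mul_apply, hbv, map_smul, Module.End.mul_apply, hneg, smul_smul, mul_comm ε]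
  obtain ⟨f₀, hf₀⟩ := exists_dual_ne_zero (k := k) hv
  -- Symmetrizing makes `f` an eigenvector of `b` with eigenvalue `δ`. On `N ^ (r - 1) v₀`, where
  -- `b` acts by the same `δ`, the value only doubles, so it stays nonzero.
  let f : V →ₗ[k] k := f₀ + δ • (f₀ ∘ₗ b)
  have hf : f ((N ^ (r - 1)) v₀) ≠ 0 := by
    have : f ((N ^ (r - 1)) v₀) = 2 * f₀ ((N ^ (r - 1)) v₀) := by
      simp only [f, LinearMap.add_apply, LinearMap.smul_apply, LinearMap.comp_apply, hbu,
        map_smul, smul_eq_mul]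
      rw [← mul_assoc, hδδ]; ring
    rw [this]
    exact mul_ne_zero h2 hf₀
  have hfb : ∀ w, f (b w) = δ * f w := by
    intro w
    simp only [f, LinearMap.add_apply, LinearMap.smul_apply, LinearMap.comp_apply, hbb,
      smul_eq_mul]
    rw [mul_add, ← mul_assoc, hδδ]; ring
  have hN' : a - algebraMap k (Module.End k V) 1 = N := by rw [map_one]
  have hφ := cyclicMap_jordanBlock a 1 v₀ r (by rw [hN', hNr]; rfl)
  rw [hN'] at hφ
  have hRa : ∀ w ∈ LinearMap.range (cyclicMap N v₀ r),
      a w ∈ LinearMap.range (cyclicMap N v₀ r) := by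
    rintro _ ⟨x, rfl⟩
    exact ⟨_, hφ x⟩
  have hvR : v₀ ∈ LinearMap.range (cyclicMap N v₀ r) := by
    obtain ⟨m, hm⟩ : ∃ m, r = m + 1 := ⟨r - 1, by omega⟩
    rw [hm]
    exact ⟨_, cyclicMap_last N v₀ m⟩
  have hbvR : b v₀ ∈ LinearMap.range (cyclicMap N v₀ r) := by
    have h1 : b v₀ = ε • (a ^ (n - 1)) v₀ := by
      rw [← map_smul, ← habv₀, ← Module.End.mul_apply, pow_pred_mul ha]; rfl
    rw [h1]
    exact Submodule.smul_mem _ _ (pow_mem_of_forall hRa _ hvR)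
  have hRN : ∀ w ∈ LinearMap.range (cyclicMap N v₀ r),
      N w ∈ LinearMap.range (cyclicMap N v₀ r) := fun w hw =>
    Submodule.sub_mem _ (hRa w hw) hw
  have hKN : ∀ w ∈ LinearMap.ker (cocyclicMap N f r),
      N w ∈ LinearMap.ker (cocyclicMap N f r) := by
    intro w hw
    rw [mem_ker_cocyclicMap hNr] at hw ⊢
    intro j
    rw [← Module.End.mul_apply, ← pow_succ, hw]
  have hKa : ∀ w ∈ LinearMap.ker (cocyclicMap N f r),
      a w ∈ LinearMap.ker (cocyclicMap N f r) := by
    intro w hw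
    have : a w = N w + w := by simp [hN]
    rw [this]
    exact Submodule.add_mem _ (hKN w hw) hw
  -- Both summands are stable under `b`. On the range, `b N ^ j v₀ = ± a ^ (-j) N ^ j b v₀` and `b
  -- v₀ = ε a⁻¹ v₀`; on the kernel, `f (N ^ j b w) = ± δ f (N ^ j a ^ (-j) w) = 0`.
  have hbij := cyclicMap_bijective hV hr1 hNr hf
    (by
      rintro w hw
      refine ⟨hRa w hw, ?_⟩
      obtain ⟨x, rfl⟩ := hw
      rw [cyclicMap_apply, map_sum]
      refine Submodule.sum_mem _ fun i _ => ?_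
      rw [map_smul, ← Module.End.mul_apply, hbN, Module.End.mul_apply, Module.End.mul_apply,
        Module.End.mul_apply, hneg, ← pow_mul]
      exact Submodule.smul_mem _ _ (Submodule.smul_mem _ _
        (pow_mem_of_forall hRa _ (pow_mem_of_forall hRN _ hbvR))))
    (by
      rintro w hw
      refine ⟨hKa w hw, ?_⟩
      rw [mem_ker_cocyclicMap hNr]
      intro j
      have h1 : (a ^ (n - 1)) ^ j = a ^ ((n - 1) * j) := by rw [pow_mul]
      have h3 := (mem_ker_cocyclicMap hNr).1 (pow_mem_of_forall hKa ((n - 1) * j) hw) j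
      rw [← Module.End.mul_apply, hNb, mul_assoc, mul_assoc, Module.End.mul_apply, hfb,
        Module.End.mul_apply, hneg, h1, Module.End.mul_apply, map_smul, h3, smul_zero, mul_zero])
  let e := LinearEquiv.ofBijective _ hbij
  have hea : ∀ x, e (jordanBlock r 1 *ᵥ x) = a (e x) := hφ
  refine ⟨r, ⟨hr1, hrq⟩, ε, hε, e, hea, ?_⟩
  have hev : ∀ m, r = m + 1 → ∃ i : Fin r, i.val = m ∧ e (Pi.single i 1) = v₀ := by
    rintro m hm
    exact ⟨⟨m, by omega⟩, rfl, by
      change cyclicMap N v₀ r _ = v₀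
      rw [cyclicMap, Fintype.linearCombination_apply_single]
      simp [hm]⟩
  clear_value e
  obtain ⟨m', hm'⟩ : ∃ m, r = m + 1 := ⟨r - 1, by omega⟩
  obtain ⟨i, hi, hiv⟩ := hev m' hm'
  clear_value r
  subst hm'
  have hil : i = Fin.last m' := Fin.ext hi
  subst hil
  rw [← hiv] at habv₀
  exact equiv_involutionMatrix e hea (injective_of_pow_eq_one ha) hab habv₀

end Unipotent

end DihedralYD


/-! ### Splitting by the eigenvalues of the rotation -/

namespace DihedralYD

variable {k : Type u} [Field k] {V : Type v} [AddCommGroup V] [Module k V]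
  {n : ℕ} {a b : Module.End k V} [NeZero n]

/-- The generalized eigenspaces of coprime eigenvalues are complementary. -/
theorem isCompl_ker_pow {c d : k} (hcd : c ≠ d) {m : ℕ}
    (h : (a - algebraMap k _ c) ^ m * (a - algebraMap k _ d) ^ m = 0) :
    IsCompl (LinearMap.ker ((a - algebraMap k _ c) ^ m))
      (LinearMap.ker ((a - algebraMap k _ d) ^ m)) := by
  have hco : IsCoprime ((Polynomial.X - Polynomial.C c) ^ m)
      ((Polynomial.X - Polynomial.C d) ^ m) :=
    (Polynomial.isCoprime_X_sub_C_of_isUnit_sub (sub_ne_zero.2 hcd).isUnit).pow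
  have h1 : ∀ c : k, Polynomial.aeval a ((Polynomial.X - Polynomial.C c) ^ m) =
      (a - algebraMap k _ c) ^ m := by intro c; simp
  constructor
  · have := Polynomial.disjoint_ker_aeval_of_isCoprime a hco
    rwa [h1, h1] at this
  · have := Polynomial.sup_ker_aeval_eq_ker_aeval_mul_of_coprime a hco
    rw [map_mul, h1, h1, h, LinearMap.ker_zero] at this
    rwa [codisjoint_iff]

/-- Moving `b` to the left turns `a - c⁻¹` into `a⁻¹ - c⁻¹ = -c⁻¹ a⁻¹ (a - c)`, a product of
commuting factors. -/
theorem ker_pow_map (ha : a ^ n = 1) (hab : a * b * a = b) {c : k} (hc : c ≠ 0)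
    {m : ℕ} {w : V} (hw : w ∈ LinearMap.ker ((a - algebraMap k _ c) ^ m)) :
    b w ∈ LinearMap.ker ((a - algebraMap k _ c⁻¹) ^ m) := by
  have h1 : (a - algebraMap k _ c⁻¹) * b =
      b * (-(algebraMap k (Module.End k V) c⁻¹) * a ^ (n - 1) * (a - algebraMap k _ c)) := by
    have h2 : -(algebraMap k (Module.End k V) c⁻¹) * a ^ (n - 1) * (a - algebraMap k _ c) =
        a ^ (n - 1) - algebraMap k _ c⁻¹ := by
      rw [mul_assoc, mul_sub, pow_pred_mul ha, ← Algebra.commutes c (a ^ (n - 1)), neg_mul,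
        mul_sub, mul_one, ← mul_assoc, ← map_mul, inv_mul_cancel₀ hc, map_one, one_mul, neg_sub]
    rw [h2, mul_sub, mul_pow_pred_eq ha hab, sub_mul, Algebra.commutes]
  have h3 : (a - algebraMap k _ c⁻¹) ^ m * b =
      b * (-(algebraMap k (Module.End k V) c⁻¹) * a ^ (n - 1) * (a - algebraMap k _ c)) ^ m :=
    (SemiconjBy.pow_right h1.symm m).symm
  have hcomm : Commute (-(algebraMap k (Module.End k V) c⁻¹) * a ^ (n - 1))
      (a - algebraMap k _ c) := by
    refine Commute.mul_left (Commute.neg_left (Algebra.commute_algebraMap_left _ _)) ?_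
    exact ((Commute.refl a).sub_right (Algebra.commute_algebraMap_right _ _)).pow_left _
  rw [LinearMap.mem_ker] at hw ⊢
  rw [← Module.End.mul_apply, h3, hcomm.mul_pow, Module.End.mul_apply, Module.End.mul_apply, hw,
    map_zero, map_zero]

/-- If `V = K ⊕ b K` is indecomposable under `a` and `b`, then `K` is indecomposable under `a`. -/
theorem indecOn_restrict (ha : a ^ n = 1) (hb : b * b = 1) (hab : a * b * a = b)
    (hV : IndecOn (PairStable a b)) {K : Submodule k V} (haK : ∀ w ∈ K, a w ∈ K)
    (hK : IsCompl K (K.map b)) :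
    IndecOn fun N : Submodule k K => ∀ v ∈ N, a.restrict haK v ∈ N := by
  have hbb : ∀ w, b (b w) = w := fun w => by rw [← Module.End.mul_apply, hb]; rfl
  have := hV.1
  -- The stable subspace of `V` generated by `N` is `N ⊕ b N`. It is stable under `a` because `a b =
  -- b a⁻¹`, and `a⁻¹` preserves `N` as a power of `a`.
  let D : Submodule k K → Submodule k V := fun N => N.map K.subtype ⊔ (N.map K.subtype).map b
  have hD : ∀ N, (∀ v ∈ N, a.restrict haK v ∈ N) → PairStable a b (D N) := by
    intro N hN w hw
    obtain ⟨x, hx, y, hy, rfl⟩ := Submodule.mem_sup.1 hw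
    obtain ⟨x, hx, rfl⟩ := hx
    obtain ⟨_, ⟨y, hy, rfl⟩, rfl⟩ := hy
    have h1 := pow_mem_of_forall hN (n - 1) hy
    have h2 : ((a.restrict haK ^ (n - 1)) y : V) = (a ^ (n - 1)) y := by
      rw [Module.End.pow_restrict]; rfl
    constructor
    · rw [map_add]
      refine Submodule.add_mem_sup ⟨_, hN x hx, rfl⟩ ⟨_, ⟨_, h1, rfl⟩, ?_⟩
      rw [Submodule.subtype_apply, h2, ← Module.End.mul_apply, mul_pow_pred_eq ha hab]
      rfl
    · rw [map_add, hbb, add_comm]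
      exact Submodule.add_mem_sup ⟨y, hy, rfl⟩ ⟨_, ⟨x, hx, rfl⟩, rfl⟩
  refine ⟨?_, fun N₁ N₂ h₁ h₂ hc => ?_⟩
  · rw [Submodule.nontrivial_iff_ne_bot]
    rintro rfl
    rw [Submodule.map_bot] at hK
    exact bot_ne_top (eq_top_of_isCompl_bot hK)
  have hc' : IsCompl (D N₁) (D N₂) := by
    constructor
    · rw [Submodule.disjoint_def]
      intro w hw₁ hw₂
      obtain ⟨_, ⟨x₁, hx₁, rfl⟩, _, ⟨_, ⟨y₁, hy₁, rfl⟩, rfl⟩, rfl⟩ := Submodule.mem_sup.1 hw₁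
      obtain ⟨_, ⟨x₂, hx₂, rfl⟩, _, ⟨_, ⟨y₂, hy₂, rfl⟩, rfl⟩, h⟩ := Submodule.mem_sup.1 hw₂
      simp only [Submodule.subtype_apply] at h ⊢
      have h3 : ((x₂ - x₁ : K) : V) = b ((y₁ - y₂ : K) : V) := by
        push_cast
        rw [map_sub, sub_eq_sub_iff_add_eq_add, h, add_comm]
      have h4 : ((x₂ - x₁ : K) : V) = 0 := Submodule.disjoint_def.1 hK.disjoint _ (x₂ - x₁).2
        (h3 ▸ ⟨_, (y₁ - y₂).2, rfl⟩)
      have h5 : x₂ = x₁ := sub_eq_zero.1 (Subtype.ext h4)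
      have h6 : ((y₁ - y₂ : K) : V) = 0 := by
        rw [← hbb ((y₁ - y₂ : K) : V), ← h3, h4, map_zero]
      have h7 : y₁ = y₂ := sub_eq_zero.1 (Subtype.ext h6)
      subst h5 h7
      rw [Submodule.disjoint_def.1 hc.disjoint _ hx₁ hx₂,
        Submodule.disjoint_def.1 hc.disjoint _ hy₁ hy₂]
      simp
    · rw [codisjoint_iff, Submodule.eq_top_iff']
      intro w
      have hsup : ∀ x : K, (x : V) ∈ N₁.map K.subtype ⊔ N₂.map K.subtype := by
        intro x
        rw [← Submodule.map_sup, hc.sup_eq_top]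
        exact ⟨x, trivial, rfl⟩
      have hw : w ∈ K ⊔ K.map b := by rw [hK.sup_eq_top]; trivial
      obtain ⟨x, hx, _, ⟨y, hy, rfl⟩, rfl⟩ := Submodule.mem_sup.1 hw
      obtain ⟨x₁, hx₁, x₂, hx₂, hx'⟩ := Submodule.mem_sup.1 (hsup ⟨x, hx⟩)
      obtain ⟨y₁, hy₁, y₂, hy₂, hy'⟩ := Submodule.mem_sup.1 (hsup ⟨y, hy⟩)
      simp only at hx' hy'
      rw [← hx', ← hy', map_add, add_add_add_comm]
      exact Submodule.add_mem_sup (Submodule.add_mem_sup hx₁ ⟨_, hy₁, rfl⟩)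
        (Submodule.add_mem_sup hx₂ ⟨_, hy₂, rfl⟩)
  have key : ∀ N, D N = ⊥ → N = ⊥ := by
    intro N hN
    rw [Submodule.eq_bot_iff]
    intro x hx
    have : (x : V) ∈ D N := Submodule.mem_sup_left ⟨x, hx, rfl⟩
    rw [hN, Submodule.mem_bot] at this
    exact Subtype.ext this
  exact (hV.2 _ _ (hD _ h₁) (hD _ h₂) hc').imp (key _) (key _)

/-- The linear bijection `k^r ⊕ k^r → K ⊕ b K`. -/
theorem exists_equiv_sum {r : ℕ} {K : Submodule k V} (haK : ∀ w ∈ K, a w ∈ K)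
    (hb : b * b = 1) (hab : a * b * a = b) (hK : IsCompl K (K.map b))
    {J : Matrix (Fin r) (Fin r) k} (hJ : J ^ n = 1) (e : (Fin r → k) ≃ₗ[k] K)
    (he : ∀ x, e (J *ᵥ x) = a.restrict haK (e x)) :
    ∃ E : (Fin r ⊕ Fin r → k) ≃ₗ[k] V,
      (∀ x, E (Matrix.fromBlocks J 0 0 J⁻¹ *ᵥ x) = a (E x)) ∧
      ∀ x, E (Matrix.fromBlocks 0 1 1 0 *ᵥ x) = b (E x) := by
  have hbb : ∀ w, b (b w) = w := fun w => by rw [← Module.End.mul_apply, hb]; rfl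
  let F : (Fin r ⊕ Fin r → k) →ₗ[k] V :=
    K.subtype ∘ₗ e.toLinearMap ∘ₗ LinearMap.funLeft k k Sum.inl +
      b ∘ₗ K.subtype ∘ₗ e.toLinearMap ∘ₗ LinearMap.funLeft k k Sum.inr
  have hF : ∀ x, F x = (e (x ∘ Sum.inl) : V) + b (e (x ∘ Sum.inr) : V) := fun x => rfl
  have hbij : Function.Bijective F := by
    constructor
    · rw [← LinearMap.ker_eq_bot, Submodule.eq_bot_iff]
      intro x hx
      rw [LinearMap.mem_ker, hF] at hx
      have h1 : (e (x ∘ Sum.inl) : V) = 0 := by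
        refine Submodule.disjoint_def.1 hK.disjoint _ (Subtype.coe_prop _) ?_
        rw [eq_neg_of_add_eq_zero_left hx]
        exact Submodule.neg_mem _ ⟨_, Subtype.coe_prop _, rfl⟩
      rw [h1, zero_add] at hx
      have h2 : (e (x ∘ Sum.inr) : V) = 0 := by rw [← hbb (e (x ∘ Sum.inr) : V), hx, map_zero]
      have h3 : x ∘ Sum.inl = 0 := e.injective (Subtype.ext (by simpa using h1))
      have h4 : x ∘ Sum.inr = 0 := e.injective (Subtype.ext (by simpa using h2))
      ext (i | i)
      · exact congrFun h3 i
      · exact congrFun h4 i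
    · intro w
      have hw : w ∈ K ⊔ K.map b := by rw [hK.sup_eq_top]; trivial
      obtain ⟨x, hx, _, ⟨y, hy, rfl⟩, rfl⟩ := Submodule.mem_sup.1 hw
      refine ⟨Sum.elim (e.symm ⟨x, hx⟩) (e.symm ⟨y, hy⟩), ?_⟩
      rw [hF]
      simp
  have hJ' : J * J⁻¹ = 1 := Matrix.mul_nonsing_inv _
    ((Matrix.isUnit_iff_isUnit_det _).1 (IsUnit.of_pow_eq_one hJ (NeZero.ne n)))
  have he' : ∀ x, (e (J *ᵥ x) : V) = a (e x) := fun x => by rw [he]; rfl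
  have hab' : ∀ w, a (b (a w)) = b w := fun w => LinearMap.congr_fun hab w
  refine ⟨LinearEquiv.ofBijective F hbij, fun x => ?_, fun x => ?_⟩
  · simp only [LinearEquiv.ofBijective_apply, hF, Matrix.fromBlocks_mulVec, Sum.elim_comp_inl,
      Sum.elim_comp_inr, Matrix.zero_mulVec, add_zero, zero_add, map_add, he']
    congr 1
    -- On the second half, `b e (J⁻¹ y) = a b a e (J⁻¹ y) = a b e (y)`.
    rw [← hab', ← he', Matrix.mulVec_mulVec, hJ', Matrix.one_mulVec]
  · simp only [LinearEquiv.ofBijective_apply, hF, Matrix.fromBlocks_mulVec, Sum.elim_comp_inl,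
      Sum.elim_comp_inr, Matrix.zero_mulVec, Matrix.one_mulVec, add_zero, zero_add, map_add, hbb]
    rw [add_comm]

/-- The indecomposable pairs satisfying the relations of the dihedral group. -/
theorem exists_equiv_of_pair [IsAlgClosed k] [FiniteDimensional k V] {p s t : ℕ} [Fact p.Prime]
    [CharP k p] (hp : Odd p) (ht : ¬ p ∣ t) (hn : n = p ^ s * t) (hodd : Odd n) {ξ : k}
    (hξ : IsPrimitiveRoot ξ t) (ha : a ^ n = 1) (hb : b * b = 1) (hab : a * b * a = b)
    (hV : IndecOn (PairStable a b)) :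
    ∃ r, (1 ≤ r ∧ r ≤ p ^ s) ∧
      ((∃ ε : k, (ε = 1 ∨ ε = -1) ∧ ∃ e : (Fin r → k) ≃ₗ[k] V,
        (∀ x, e (jordanBlock r 1 *ᵥ x) = a (e x)) ∧
        ∀ x, e (ε • involutionMatrix k r *ᵥ x) = b (e x)) ∨
      ∃ i, (1 ≤ i ∧ i ≤ (t - 1) / 2) ∧ ∃ e : (Fin r ⊕ Fin r → k) ≃ₗ[k] V,
        (∀ x, e (Matrix.fromBlocks (jordanBlock r (ξ ^ i)) 0 0 (jordanBlock r (ξ ^ i))⁻¹ *ᵥ x) =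
          a (e x)) ∧
        ∀ x, e (Matrix.fromBlocks 0 1 1 0 *ᵥ x) = b (e x)) := by
  have := hV.1
  have h2 : (2 : k) ≠ 0 := by
    have := Ring.two_ne_zero (R := k) (by
      rw [ringChar.eq k p]; rintro rfl; exact absurd hp (by decide))
    exact this
  have hbb : ∀ w, b (b w) = w := fun w => by rw [← Module.End.mul_apply, hb]; rfl
  have ht0 : t ≠ 0 := by rintro rfl; exact ht (dvd_zero p)
  have htodd : Odd t := by rw [hn] at hodd; exact (Nat.odd_mul.1 hodd).2
  have hξ0 : ξ ≠ 0 := hξ.ne_zero ht0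
  -- an eigenvector with eigenvalue `ξ ^ i`, where `i ≤ (t - 1) / 2`
  obtain ⟨i, hi, v, hv, hav⟩ : ∃ i ≤ (t - 1) / 2, ∃ v : V, v ≠ 0 ∧ a v = ξ ^ i • v := by
    obtain ⟨c, hc⟩ := Module.End.exists_eigenvalue a
    obtain ⟨v, hv⟩ := hc.exists_hasEigenvector
    obtain ⟨j, hj, rfl⟩ := eigenvalue_eq_pow hn ha hξ hv.2 hv.apply_eq_smul
    by_cases hj' : j ≤ (t - 1) / 2
    · exact ⟨j, hj', v, hv.2, hv.apply_eq_smul⟩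
    · obtain ⟨l, hl⟩ := htodd
      -- The involution inverts eigenvalues, and `ξ ^ (-j) = ξ ^ (t - j)` with `t - j ≤ (t - 1) /
      -- 2`.
      refine ⟨t - j, by omega, b v, fun h => hv.2 (by rw [← hbb v, h, map_zero]), ?_⟩
      have h1 : a (b (a v)) = b v := LinearMap.congr_fun hab v
      rw [hv.apply_eq_smul, map_smul, map_smul] at h1
      conv_rhs => rw [← h1, smul_smul, ← pow_add, Nat.sub_add_cancel hj.le, hξ.pow_eq_one, one_smul]
  set c := ξ ^ i with hc
  have hc0 : c ≠ 0 := pow_ne_zero _ hξ0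
  have hct : c ^ t = 1 := by rw [hc, ← pow_mul, mul_comm, pow_mul, hξ.pow_eq_one, one_pow]
  -- the central element
  set F : Module.End k V := a + a ^ (n - 1) - algebraMap k _ (c + c⁻¹) with hF
  -- Multiplying by the invertible `a` factors the central element. Its nilpotency then says that
  -- `a` has no eigenvalues besides `c` and `c⁻¹`.
  have haF : a * F = (a - algebraMap k _ c) * (a - algebraMap k _ c⁻¹) := by
    have h1 : algebraMap k (Module.End k V) c * algebraMap k _ c⁻¹ = 1 := by
      rw [← map_mul, mul_inv_cancel₀ hc0, map_one]
    rw [hF, mul_sub, mul_add, mul_pow_pred ha, map_add, sub_mul, mul_sub, mul_sub, h1, mul_add,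
      Algebra.commutes c a]
    abel
  have hcaF : Commute a F :=
    ((Commute.refl a).add_right (Commute.pow_right (Commute.refl a) _)).sub_right
      (Algebra.commute_algebraMap_right _ _)
  have hcbF : Commute b F := by
    refine Commute.sub_right ?_ (Algebra.commute_algebraMap_right _ _)
    rw [Commute, SemiconjBy, mul_add, mul_pow_pred_eq ha hab, mul_eq_pow_pred_mul ha hab, add_mul,
      add_comm]
  have hcomm : Commute (a - algebraMap k _ c) (a - algebraMap k _ c⁻¹) :=
    ((Commute.refl a).sub_left (Algebra.commute_algebraMap_left c a)).sub_right
      (Algebra.commute_algebraMap_right _ _)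
  have hFv : F v = 0 := by
    have h1 : (a - algebraMap k (Module.End k V) c) v = 0 := by
      rw [LinearMap.sub_apply, hav, Module.algebraMap_end_apply, sub_self]
    refine injective_of_pow_eq_one ha ?_
    rw [← Module.End.mul_apply, haF, hcomm.eq, Module.End.mul_apply, h1, map_zero, map_zero]
  obtain ⟨m, hm⟩ := isNilpotent_of_commute hV hcaF hcbF hv hFv
  have hm' : (a - algebraMap k _ c) ^ m * (a - algebraMap k _ c⁻¹) ^ m = 0 := by
    rw [← hcomm.mul_pow, ← haF, hcaF.mul_pow, hm, mul_zero]
  -- Either `c = 1` and `a` is unipotent, or `0 < 2 i < t`, which forces `c ≠ c⁻¹` and makes `b`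
  -- exchange two complementary generalized eigenspaces.
  rcases Nat.eq_zero_or_pos i with rfl | hi0
  · have hc1 : c = 1 := by rw [hc, pow_zero]
    rw [hc1, inv_one, ← pow_add] at hm'
    have hq := sub_pow_eq_zero_of_isNilpotent hn ht ha (one_pow t) ht0 ⟨_, hm'⟩
    rw [map_one] at hq
    obtain ⟨r, hr, h⟩ := exists_equiv_unipotent h2 hodd ha hb hab hV hq
    exact ⟨r, hr, Or.inl h⟩
  · have hcc : c ≠ c⁻¹ := by
      intro h
      have h1 : ξ ^ (2 * i) = 1 := by
        rw [mul_comm, pow_mul, ← hc, pow_two]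
        nth_rewrite 2 [h]
        exact mul_inv_cancel₀ hc0
      have := Nat.le_of_dvd (by omega) ((hξ.pow_eq_one_iff_dvd _).1 h1)
      omega
    have hcompl := isCompl_ker_pow hcc hm'
    set K := LinearMap.ker ((a - algebraMap k _ c) ^ m) with hK
    have hmap : LinearMap.ker ((a - algebraMap k _ c⁻¹) ^ m) = K.map b := by
      ext w
      constructor
      · intro hw
        refine ⟨b w, ?_, hbb w⟩
        have := ker_pow_map ha hab (inv_ne_zero hc0) hw
        rwa [inv_inv] at this
      · rintro ⟨w, hw, rfl⟩
        exact ker_pow_map ha hab hc0 hw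
    rw [hmap] at hcompl
    have haK : ∀ w ∈ K, a w ∈ K := by
      intro w hw
      rw [hK, LinearMap.mem_ker] at hw ⊢
      have h1 : Commute a ((a - algebraMap k _ c) ^ m) :=
        ((Commute.refl a).sub_right (Algebra.commute_algebraMap_right _ _)).pow_right _
      rw [← Module.End.mul_apply, ← h1.eq, Module.End.mul_apply, hw, map_zero]
    have hind := indecOn_restrict ha hb hab hV haK hcompl
    have := hind.1
    have hpow : a.restrict haK ^ n = 1 := by
      rw [Module.End.pow_restrict]
      ext x
      simp [LinearMap.restrict_apply, ha]
    have hnil : IsNilpotent (a.restrict haK - algebraMap k _ c) := by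
      refine ⟨m, ?_⟩
      ext x
      have h1 : ∀ (j : ℕ) (x : K), (((a.restrict haK - algebraMap k _ c) ^ j) x : V) =
          ((a - algebraMap k _ c) ^ j) x := by
        intro j
        induction j with
        | zero => intro x; rfl
        | succ j ih =>
          intro x
          rw [pow_succ, pow_succ, Module.End.mul_apply, Module.End.mul_apply, ih]
          simp [Module.algebraMap_end_apply]
      rw [h1]
      exact x.2
    have hq := sub_pow_eq_zero_of_isNilpotent hn ht hpow hct ht0 hnil
    obtain ⟨r, hr, e, he⟩ := exists_equiv_jordanBlock hind hq
    exact ⟨r, hr, Or.inr ⟨i, ⟨hi0, hi⟩,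
      exists_equiv_sum haK hb hab hcompl (jordanBlock_pow hn hr.2 hξ i) e he⟩⟩

end DihedralYD


/-! ### Graded representations with trivial coaction and induced ones -/

namespace YetterDrinfeldModule

variable {k : Type u} {G : Type w} [Field k] [Group G] [Fintype G] [DecidableEq G]

section Trivial

variable {V : Type v} [AddCommGroup V] [Module k V] (ρ : Representation k G V)
  {V' : Type v'} [AddCommGroup V'] [Module k V'] (ρ' : Representation k G V')

/-- The graded representation of `trivialCoaction ρ`, on the underlying space of `ρ`. -/
def trivialGrading : ConjGrading k G V := (trivialCoaction ρ).grading

theorem trivialGrading_ρ (h : G) (m : V) :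
    (trivialGrading ρ).ρ h m = ρ h m :=
  LinearMap.congr_fun (ρ.asAlgebraHom_single_one h) m

theorem trivialGrading_E (g : G) (m : V) :
    (trivialGrading ρ).E g m = if g = 1 then m else (0 : V) := by
  have : (trivialGrading ρ).E g m =
      ((MonoidAlgebra.coeff (1 : MonoidAlgebra k G)) g • m : V) := rfl
  rw [this, MonoidAlgebra.one_def]
  by_cases h : g = 1
  · subst h; simp
  · simp [h]

theorem supportedOn_trivialGrading : (trivialGrading ρ).SupportedOn 1 := by
  intro x hx
  ext m
  have hx' : x ≠ 1 := by rintro rfl; exact hx (IsConj.refl 1)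
  exact (trivialGrading_E ρ x m).trans (if_neg hx')

theorem indecOn_trivialGrading
    (h : IndecOn fun N : Submodule k V => ∀ h, ∀ v ∈ N, ρ h v ∈ N) :
    IndecOn (trivialGrading ρ).Stable := by
  refine IndecOn.mono (V := V) h fun N hN h v hv => ?_
  have := hN.1 h v hv
  rwa [trivialGrading_ρ] at this

variable {ρ ρ'} in
theorem exists_equiv_of_iso_trivialGrading
    (h : (trivialGrading ρ).Iso (trivialGrading ρ')) :
    ∃ e : V ≃ₗ[k] V', ∀ h v, e (ρ h v) = ρ' h (e v) := by
  obtain ⟨e, he, -⟩ := h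
  refine ⟨e, fun h v => ?_⟩
  have := he h v
  rwa [trivialGrading_ρ, trivialGrading_ρ] at this

variable {ρ'} in
theorem iso_trivialGrading {S : ConjGrading k G V} (hS : S.SupportedOn 1) (e : V' ≃ₗ[k] V)
    (he : ∀ h v, e (ρ' h v) = S.ρ h (e v)) : S.Iso (trivialGrading ρ') := by
  refine ConjGrading.Iso.symm ⟨e, fun h v => ?_, fun g v => ?_⟩
  · rw [trivialGrading_ρ]
    exact he h v
  · rw [trivialGrading_E, hS.E_eq_ite]
    split_ifs
    · rfl
    · exact map_zero e

end Trivial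

section Induced

variable (g : G) {N : Type v} [AddCommGroup N] [Module k N]
  (ρ : Representation k (Subgroup.centralizer {g}) N)

/-- The graded representation of `induced g ρ`, on the underlying space of the induced
representation. -/
def inducedGrading : ConjGrading k G (Representation.IndV (Subgroup.centralizer {g}).subtype ρ) :=
  (induced g ρ).grading

theorem inducedGrading_ρ (h x : G) (n : N) :
    (inducedGrading g ρ).ρ h (indMk g ρ x n) = indMk g ρ (x * h⁻¹) n :=
  (LinearMap.congr_fun (Representation.asAlgebraHom_single_one _ h) _).trans
    (ind_indMk g ρ h x n)

theorem inducedGrading_E (y x : G) (n : N) :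
    (inducedGrading g ρ).E y (indMk g ρ x n) =
      if x⁻¹ * g * x = y then indMk g ρ x n else 0 := by
  have h1 : (inducedGrading g ρ).E y (indMk g ρ x n) =
      (TensorProduct.rid k _).toLinearMap
        ((Finsupp.lapply y ∘ₗ (MonoidAlgebra.coeffLinearEquiv k).toLinearMap).lTensor _
          (inducedCoact g ρ (indMk g ρ x n))) := rfl
  rw [h1, inducedCoact_mk]
  by_cases h : x⁻¹ * g * x = y
  · subst h; simp
  · simp [h]

theorem supportedOn_inducedGrading : (inducedGrading g ρ).SupportedOn g := by
  intro y hy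
  refine LinearMap.ext (indMk_induction g ρ ((inducedGrading g ρ).E y) 0 fun x n => ?_)
  rw [inducedGrading_E, if_neg]
  · rfl
  · rintro rfl
    exact hy (isConj_iff.2 ⟨x⁻¹, by simp⟩)

open scoped Classical in
/-- The action of `x⁻¹` on `N`, extended by zero outside the centralizer. -/
def invAct (x : G) : Module.End k N :=
  if h : x ∈ Subgroup.centralizer {g} then ρ ⟨x, h⟩⁻¹ else 0

-- This is the relation through which `indRetraction` descends from the tensor product to the
-- induced module.
omit [Fintype G] [DecidableEq G] in
theorem invAct_mul (c : Subgroup.centralizer {g}) (x : G) (n : N) :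
    invAct g ρ (c * x) (ρ c n) = invAct g ρ x n := by
  have hcx : c * x ∈ Subgroup.centralizer {g} ↔ x ∈ Subgroup.centralizer {g} :=
    Subgroup.mul_mem_cancel_left _ c.2
  by_cases h : x ∈ Subgroup.centralizer {g}
  · rw [invAct, invAct, dif_pos h, dif_pos (hcx.2 h), ← Module.End.mul_apply, ← map_mul]
    congr 2
    ext
    simp
  · rw [invAct, invAct, dif_neg h, dif_neg (hcx.not.2 h)]; rfl

/-- The projection of the induced module to its component of degree `g`, with values in `N`. -/
def indRetraction : Representation.IndV (Subgroup.centralizer {g}).subtype ρ →ₗ[k] N :=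
  Representation.Coinvariants.lift _
    (TensorProduct.lift
      ((Finsupp.lsum k fun x : G => LinearMap.toSpanSingleton k _ (invAct g ρ x)) ∘ₗ
        (MonoidAlgebra.coeffLinearEquiv k).toLinearMap))
    (by
      intro c
      ext x n
      simpa using invAct_mul g ρ c x n)

omit [Fintype G] [DecidableEq G] in
theorem indRetraction_indMk (x : G) (n : N) :
    indRetraction g ρ (indMk g ρ x n) = invAct g ρ x n := by
  simp [indRetraction, indMk]

omit [Fintype G] [DecidableEq G] in
theorem indMk_mul {c : G} (hc : c ∈ Subgroup.centralizer {g}) (x : G) (n : N) :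
    indMk g ρ (c * x) (ρ ⟨c, hc⟩ n) = indMk g ρ x n := by
  have := Representation.Coinvariants.mk_self_apply
    (Representation.tprod ((Representation.leftRegular k G).comp
      (Subgroup.centralizer {g}).subtype) ρ) ⟨c, hc⟩ (MonoidAlgebra.single x (1 : k) ⊗ₜ[k] n)
  simpa [indMk] using this

/-- For `x` in the centralizer, the class of `x ⊗ n` equals that of `1 ⊗ x⁻¹ n` and has degree `g`;
for other `x` its degree differs from `g`, and both sides vanish. -/
theorem indMk_one_indRetraction (m) :
    indMk g ρ 1 (indRetraction g ρ m) =
      (inducedGrading g ρ).E g m := by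
  refine indMk_induction g ρ (indMk g ρ 1 ∘ₗ indRetraction g ρ) ((inducedGrading g ρ).E g)
    (fun x n => ?_) m
  rw [inducedGrading_E, LinearMap.comp_apply, indRetraction_indMk, invAct]
  by_cases h : x ∈ Subgroup.centralizer {g}
  · have h1 := indMk_mul g ρ (Subgroup.inv_mem _ h) x n
    rw [inv_mul_cancel] at h1
    rw [dif_pos h, if_pos]
    · exact h1
    · rw [Subgroup.mem_centralizer_singleton_iff] at h
      rw [mul_assoc, ← h, inv_mul_cancel_left]
  · rw [dif_neg h, if_neg]
    · exact map_zero _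
    · intro h1
      refine h ?_
      rw [Subgroup.mem_centralizer_singleton_iff]
      nth_rewrite 1 [← h1]
      group

/-- The component of degree `g` of the module induced from `N` is isomorphic to `N`. -/
def fiberInduced : N ≃ₗ[k] (inducedGrading g ρ).fiber g where
  toFun n := ⟨indMk g ρ 1 n, by
    rw [ConjGrading.mem_fiber, inducedGrading_E, if_pos (by simp)]⟩
  map_add' x y := Subtype.ext (map_add _ _ _)
  map_smul' c x := Subtype.ext (map_smul _ _ _)
  invFun m := indRetraction g ρ m.1
  left_inv n := by
    simp only
    rw [indRetraction_indMk, invAct, dif_pos (Subgroup.one_mem _)]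
    have : (⟨1, Subgroup.one_mem _⟩ : Subgroup.centralizer {g})⁻¹ = 1 := inv_one
    rw [this, map_one]; rfl
  right_inv m := Subtype.ext (by
    simp only
    rw [indMk_one_indRetraction, ConjGrading.mem_fiber.1 m.2])

theorem fiberInduced_apply (c : Subgroup.centralizer {g}) (n : N) :
    (fiberInduced g ρ (ρ c n)).1 =
      (inducedGrading g ρ).ρ c (fiberInduced g ρ n).1 := by
  have h1 := indMk_mul g ρ c.2 (c : G)⁻¹ n
  rw [mul_inv_cancel] at h1
  refine h1.trans ((inducedGrading_ρ g ρ c 1 n).trans ?_).symm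
  rw [one_mul]

theorem finiteDimensional_induced [FiniteDimensional k N] :
    FiniteDimensional k (Representation.IndV (Subgroup.centralizer {g}).subtype ρ) := by
  have : FiniteDimensional k ((inducedGrading g ρ).fiber g) :=
    Module.Finite.equiv (fiberInduced g ρ)
  exact ConjGrading.finiteDimensional_of_fiber (supportedOn_inducedGrading g ρ)

theorem indecOn_inducedGrading (h : IndecOn fun P : Submodule k N => ∀ c, ∀ n ∈ P, ρ c n ∈ P) :
    IndecOn (inducedGrading g ρ).Stable := by
  refine ConjGrading.indecOn_of_fiber (supportedOn_inducedGrading g ρ)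
    (h.map_equiv (fiberInduced g ρ) fun P hP c n hn => ?_)
  exact hP c (Subgroup.mem_centralizer_singleton_iff.1 c.2) _ hn _ (fiberInduced_apply g ρ c n)

variable {g ρ}

/-- The fiber of the induced module is the representation it is induced from, so identifying that
representation with the fiber of `S` is enough. -/
theorem iso_inducedGrading {V : Type v'} [AddCommGroup V] [Module k V] {S : ConjGrading k G V}
    (hS : S.SupportedOn g) (e : N ≃ₗ[k] S.fiber g)
    (he : ∀ c n, (e (ρ c n) : V) = S.ρ c (e n)) : S.Iso (inducedGrading g ρ) := by
  refine ConjGrading.Iso.symm (ConjGrading.iso_of_fiber (supportedOn_inducedGrading g ρ) hS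
    ((fiberInduced g ρ).symm ≪≫ₗ e) fun c hc v w hw => ?_)
  obtain ⟨n, rfl⟩ := (fiberInduced g ρ).surjective v
  have hc' : c ∈ Subgroup.centralizer {g} := Subgroup.mem_centralizer_singleton_iff.2 hc
  have : w = fiberInduced g ρ (ρ ⟨c, hc'⟩ n) :=
    Subtype.ext (hw.trans (fiberInduced_apply g ρ ⟨c, hc'⟩ n).symm)
  subst this
  simp only [LinearEquiv.trans_apply, LinearEquiv.symm_apply_apply]
  exact he ⟨c, hc'⟩ n

theorem exists_equiv_of_iso_inducedGrading {N' : Type v'} [AddCommGroup N'] [Module k N']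
    {ρ' : Representation k (Subgroup.centralizer {g}) N'}
    (h : (inducedGrading g ρ).Iso (inducedGrading g ρ')) :
    ∃ e : N ≃ₗ[k] N', ∀ c n, e (ρ c n) = ρ' c (e n) := by
  obtain ⟨e, he⟩ := h.fiber g
  refine ⟨fiberInduced g ρ ≪≫ₗ e ≪≫ₗ (fiberInduced g ρ').symm, fun c n => ?_⟩
  simp only [LinearEquiv.trans_apply]
  rw [LinearEquiv.symm_apply_eq]
  refine Subtype.ext ?_
  rw [he c _ _ (fiberInduced_apply g ρ c n), fiberInduced_apply, LinearEquiv.apply_symm_apply]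

end Induced

end YetterDrinfeldModule


namespace DihedralYD

open DihedralGroup YetterDrinfeldModule

/-! ### Representations of the dihedral group -/

section Representations

variable {k : Type u} [Field k] {n : ℕ} [NeZero n]
  {V : Type v} [AddCommGroup V] [Module k V] {V' : Type v'} [AddCommGroup V'] [Module k V']
  {ρ : Representation k (DihedralGroup n) V} {ρ' : Representation k (DihedralGroup n) V'}

omit [NeZero n] in
theorem pow_val_one {M : Type*} [Monoid M] {x : M} (hx : x ^ n = 1) :
    x ^ (1 : ZMod n).val = x := by
  rw [ZMod.val_one_eq_one_mod, ← pow_eq_pow_mod 1 hx, pow_one]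

theorem rep_r (i : ZMod n) : ρ (r i) = ρ (r 1) ^ i.val := by
  rw [← map_pow, r_one_pow, ZMod.natCast_zmod_val]

theorem rep_sr (i : ZMod n) : ρ (sr i) = ρ (sr 0) * ρ (r 1) ^ i.val := by
  rw [← rep_r, ← map_mul, sr_mul_r, zero_add]

omit [NeZero n] in
theorem rep_pow : ρ (r 1) ^ n = 1 := by
  rw [← map_pow, r_one_pow_n, map_one]

omit [NeZero n] in
theorem rep_sr_mul_self : ρ (sr 0) * ρ (sr 0) = 1 := by
  rw [← map_mul, sr_mul_self, map_one]

omit [NeZero n] in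
theorem rep_relation : ρ (r 1) * ρ (sr 0) * ρ (r 1) = ρ (sr 0) := by
  rw [← map_mul, ← map_mul, r_mul_sr, sr_mul_r, sub_add_cancel]

theorem map_rep_of_generators {e : V →ₗ[k] V'} (ha : ∀ v, e (ρ (r 1) v) = ρ' (r 1) (e v))
    (hb : ∀ v, e (ρ (sr 0) v) = ρ' (sr 0) (e v)) (h : DihedralGroup n) (v : V) :
    e (ρ h v) = ρ' h (e v) := by
  have hpow : ∀ m v, e ((ρ (r 1) ^ m) v) = (ρ' (r 1) ^ m) (e v) := by
    intro m
    induction m with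
    | zero => intro v; rfl
    | succ m ih =>
      intro v
      rw [pow_succ, pow_succ, Module.End.mul_apply, Module.End.mul_apply, ih, ha]
  rcases h with i | i
  · rw [rep_r, rep_r (ρ := ρ'), hpow]
  · rw [rep_sr, rep_sr (ρ := ρ'), Module.End.mul_apply, Module.End.mul_apply, hb, hpow]

theorem PairStable.rep {N : Submodule k V} (hN : PairStable (ρ (r 1)) (ρ (sr 0)) N)
    (h : DihedralGroup n) {v : V} (hv : v ∈ N) : ρ h v ∈ N := by
  rcases h with i | i
  · rw [rep_r]; exact pow_mem_of_forall (fun w hw => (hN w hw).1) _ hv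
  · rw [rep_sr]; exact (hN _ (pow_mem_of_forall (fun w hw => (hN w hw).1) _ hv)).2

variable {ι : Type} [Fintype ι] [DecidableEq ι] {A B : Matrix ι ι k} (hA : A ^ n = 1)
  (hB : B * B = 1) (hAB : A * B * (A * B) = 1)

theorem dihedralRep_r_one (x : ι → k) : dihedralRep A B hA hB hAB (r 1) x = A *ᵥ x := by
  change (A ^ (1 : ZMod n).val) *ᵥ x = _
  rw [pow_val_one hA]

theorem dihedralRep_sr_zero (x : ι → k) : dihedralRep A B hA hB hAB (sr 0) x = B *ᵥ x := by
  change (B * A ^ (0 : ZMod n).val) *ᵥ x = _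
  rw [ZMod.val_zero, pow_zero, mul_one]

end Representations

/-! ### Conjugacy classes of the dihedral group -/

section Conjugacy

variable {n : ℕ} [NeZero n]

omit [NeZero n] in
theorem isConj_sr_zero (hodd : Odd n) (i : ZMod n) : IsConj (sr 0 : DihedralGroup n) (sr i) := by
  obtain ⟨m, hm⟩ := hodd
  -- Conjugation by `r c` takes `sr 0` to `sr (-2 c)`, and `-2 m = 1` modulo `n = 2 m + 1`.
  refine isConj_iff.2 ⟨r (m * i), ?_⟩
  rw [r_mul_sr, inv_r, sr_mul_r]
  congr 1
  have h : ((2 * m + 1 : ℕ) : ZMod n) = 0 := by rw [← hm, ZMod.natCast_self]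
  push_cast at h
  linear_combination (-i) * h

omit [NeZero n] in
theorem isConj_r_neg (i : ZMod n) : IsConj (r (-i) : DihedralGroup n) (r i) := by
  refine isConj_iff.2 ⟨sr 0, ?_⟩
  rw [sr_mul_r, inv_sr, sr_mul_sr]
  simp

theorem exists_isConj (hodd : Odd n) (g : DihedralGroup n) :
    IsConj 1 g ∨ IsConj (sr 0) g ∨
      ∃ l : ℕ, (1 ≤ l ∧ l ≤ (n - 1) / 2) ∧ IsConj (r (l : ZMod n)) g := by
  rcases g with i | i
  · by_cases h0 : i = 0
    · subst h0
      exact Or.inl (IsConj.refl 1)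
    have hv : i.val ≠ 0 := fun h => h0 ((ZMod.val_eq_zero i).1 h)
    have hlt := ZMod.val_lt i
    obtain ⟨m, hm⟩ := hodd
    refine Or.inr (Or.inr ?_)
    by_cases h : i.val ≤ (n - 1) / 2
    · refine ⟨i.val, ⟨by omega, h⟩, ?_⟩
      rw [ZMod.natCast_zmod_val]
    · refine ⟨n - i.val, ⟨by omega, by omega⟩, ?_⟩
      rw [Nat.cast_sub hlt.le, ZMod.natCast_self, ZMod.natCast_zmod_val, zero_sub]
      exact isConj_r_neg i
  · exact Or.inr (Or.inl (isConj_sr_zero hodd i))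

omit [NeZero n] in
theorem not_isConj_r_sr (i j : ZMod n) : ¬ IsConj (r i : DihedralGroup n) (sr j) := by
  rw [isConj_iff]
  rintro ⟨c | c, h⟩
  · rw [r_mul_r, inv_r, r_mul_r] at h; cases h
  · rw [sr_mul_r, inv_sr, sr_mul_sr] at h; cases h

omit [NeZero n] in
theorem isConj_r_r {i j : ZMod n} (h : IsConj (r i : DihedralGroup n) (r j)) :
    i = j ∨ i = -j := by
  obtain ⟨c, h⟩ := isConj_iff.1 h
  rcases c with c | c
  · rw [r_mul_r, inv_r, r_mul_r] at h
    injection h with h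
    left
    linear_combination h
  · rw [sr_mul_r, inv_sr, sr_mul_sr] at h
    injection h with h
    right
    linear_combination -h

omit [NeZero n] in
theorem eq_of_isConj_r {l l' : ℕ} (hl : 1 ≤ l ∧ l ≤ (n - 1) / 2)
    (hl' : 1 ≤ l' ∧ l' ≤ (n - 1) / 2)
    (h : IsConj (r (l : ZMod n) : DihedralGroup n) (r (l' : ZMod n))) : l = l' := by
  rcases isConj_r_r h with h | h
  · rw [ZMod.natCast_eq_natCast_iff] at h
    exact Nat.ModEq.eq_of_lt_of_lt h (by omega) (by omega)
  · have h1 : ((l + l' : ℕ) : ZMod n) = 0 := by push_cast; rw [h, neg_add_cancel]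
    rw [ZMod.natCast_eq_zero_iff] at h1
    have := Nat.le_of_dvd (by omega) h1
    omega

omit [NeZero n] in
theorem not_isConj_one_r {l : ℕ} (hl : 1 ≤ l ∧ l ≤ (n - 1) / 2) :
    ¬ IsConj (1 : DihedralGroup n) (r (l : ZMod n)) := by
  rw [isConj_one_right, one_def]
  intro h
  injection h with h
  rw [ZMod.natCast_eq_zero_iff] at h
  have := Nat.le_of_dvd (by omega) h
  omega

omit [NeZero n] in
theorem commute_sr_zero (hodd : Odd n) {h : DihedralGroup n} (hc : Commute h (sr 0)) :
    h = 1 ∨ h = sr 0 := by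
  -- Doubling is injective modulo the odd number `n`.
  have key : ∀ i : ZMod n, i + i = 0 → i = 0 := by
    intro i hi
    obtain ⟨m, hm⟩ := hodd
    have h : ((2 * m + 1 : ℕ) : ZMod n) = 0 := by rw [← hm, ZMod.natCast_self]
    push_cast at h
    linear_combination i * h - m * hi
  rcases h with i | i
  · have := hc.eq
    rw [r_mul_sr, sr_mul_r] at this
    injection this with this
    left
    rw [key i (by linear_combination -this)]; rfl
  · have := hc.eq
    rw [sr_mul_sr, sr_mul_sr] at this
    injection this with this
    right
    rw [key i (by linear_combination -this)]

end Conjugacy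

/-! ### Indecomposability and distinctness of the listed modules -/

section Eigenvectors

variable {k : Type u} [Field k] {V : Type v} [AddCommGroup V] [Module k V]

theorem exists_eigenvector_mem [IsAlgClosed k] [FiniteDimensional k V] {T : Module.End k V}
    {N : Submodule k V} (hN : N ≠ ⊥) (h : ∀ v ∈ N, T v ∈ N) :
    ∃ v ∈ N, v ≠ 0 ∧ ∃ μ : k, T v = μ • v := by
  have := Submodule.nontrivial_iff_ne_bot.2 hN
  obtain ⟨μ, hμ⟩ := Module.End.exists_eigenvalue (T.restrict h)
  obtain ⟨v, hv⟩ := hμ.exists_hasEigenvector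
  exact ⟨v, v.2, fun h0 => hv.2 (Subtype.ext h0), μ, congrArg Subtype.val hv.apply_eq_smul⟩

/-- The span of the first basis vector is contained in every nonzero stable subspace. -/
theorem indecOn_jordanBlock [IsAlgClosed k] {r : ℕ} (hr : 1 ≤ r) (c : k)
    {P : Submodule k (Fin r → k) → Prop}
    (hP : ∀ N, P N → ∀ x ∈ N, jordanBlock r c *ᵥ x ∈ N) : IndecOn P := by
  obtain ⟨m, rfl⟩ : ∃ m, r = m + 1 := ⟨r - 1, by omega⟩
  refine IndecOn.of_common_vector (Pi.single 0 1 : Fin (m + 1) → k) (by simp) fun N hN hb => ?_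
  obtain ⟨x, hx, hx0, μ, hμ⟩ := exists_eigenvector_mem
    (T := (jordanBlock (m + 1) c).mulVecLin) hb (hP N hN)
  obtain ⟨-, d, hd, rfl⟩ := eigenvector_jordanBlock hx0 hμ
  have : (Pi.single 0 1 : Fin (m + 1) → k) = d⁻¹ • Pi.single 0 d := by
    rw [← Pi.single_smul, smul_eq_mul, inv_mul_cancel₀ hd]
  rw [this]
  exact N.smul_mem _ hx

/-- The dimension gives the size. The first basis vector goes to an eigenvector for `c`, while `c'`
is the only eigenvalue of the target. -/
theorem jordanBlock_unique {r r' : ℕ} (hr : 1 ≤ r) {c c' : k} (e : (Fin r → k) ≃ₗ[k] (Fin r' → k))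
    (he : ∀ x, e (jordanBlock r c *ᵥ x) = jordanBlock r' c' *ᵥ e x) : r = r' ∧ c = c' := by
  have hrr : r = r' := by simpa using e.finrank_eq
  subst hrr
  obtain ⟨m, rfl⟩ : ∃ m, r = m + 1 := ⟨r - 1, by omega⟩
  refine ⟨rfl, (eigenvector_jordanBlock (x := e (Pi.single 0 (1 : k))) ?_ ?_).1⟩
  · rw [Ne, map_eq_zero_iff e e.injective]; simp
  · rw [← he, jordanBlock_mulVec_single_zero, map_smul]

/-- The eigenvectors of `diag(J, J⁻¹)`. -/
theorem eigenvector_fromBlocks {r : ℕ} {c μ : k} (hc : c ≠ c⁻¹)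
    (hJ : IsUnit (jordanBlock (r + 1) c).det) {x : Fin (r + 1) ⊕ Fin (r + 1) → k} (hx : x ≠ 0)
    (h : Matrix.fromBlocks (jordanBlock (r + 1) c) 0 0 (jordanBlock (r + 1) c)⁻¹ *ᵥ x = μ • x) :
    (μ = c ∧ ∃ d : k, d ≠ 0 ∧ x = Sum.elim (Pi.single 0 d) 0) ∨
      (μ = c⁻¹ ∧ ∃ d : k, d ≠ 0 ∧
        x = Sum.elim (0 : Fin (r + 1) → k) (Pi.single 0 d)) := by
  set J := jordanBlock (r + 1) c with hJdef
  rw [Matrix.fromBlocks_mulVec] at h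
  simp only [Matrix.zero_mulVec, add_zero, zero_add] at h
  have h1 : J *ᵥ (x ∘ Sum.inl) = μ • (x ∘ Sum.inl) := funext fun i => congrFun h (Sum.inl i)
  have h2 : J⁻¹ *ᵥ (x ∘ Sum.inr) = μ • (x ∘ Sum.inr) := funext fun i => congrFun h (Sum.inr i)
  -- An eigenvector of `J⁻¹` for `μ` is one of `J` for `μ⁻¹`, so the description of the eigenvectors
  -- of a Jordan block applies to both halves.
  have h3 : x ∘ Sum.inr = μ • (J *ᵥ (x ∘ Sum.inr)) := by
    rw [← Matrix.mulVec_smul, ← h2, Matrix.mulVec_mulVec, Matrix.mul_nonsing_inv _ hJ,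
      Matrix.one_mulVec]
  have hx' : x = Sum.elim (x ∘ Sum.inl) (x ∘ Sum.inr) := by ext (i | i) <;> rfl
  have hr : x ∘ Sum.inr ≠ 0 → μ = c⁻¹ ∧ ∃ d : k, d ≠ 0 ∧ x ∘ Sum.inr = Pi.single 0 d := by
    intro hne
    have hμ : μ ≠ 0 := by rintro rfl; exact hne (by rw [h3, zero_smul])
    obtain ⟨hcμ, hd⟩ := eigenvector_jordanBlock (μ := μ⁻¹) hne (by
      conv_rhs => rw [h3, smul_smul, inv_mul_cancel₀ hμ, one_smul])
    exact ⟨by rw [← hcμ, inv_inv], hd⟩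
  by_cases hl : x ∘ Sum.inl = 0
  · right
    have hne : x ∘ Sum.inr ≠ 0 := by
      intro h0
      apply hx
      rw [hx', hl, h0]
      ext (i | i) <;> rfl
    obtain ⟨hμ, d, hd, hxd⟩ := hr hne
    exact ⟨hμ, d, hd, by rw [hx', hl, hxd]⟩
  · left
    obtain ⟨hμ, d, hd, hxd⟩ := eigenvector_jordanBlock hl h1
    refine ⟨hμ, d, hd, ?_⟩
    have h0 : x ∘ Sum.inr = 0 := by
      by_contra hne
      exact hc (hμ ▸ (hr hne).1)
    rw [hx', hxd, h0]

/-- `T` is upper triangular, so it preserves the eigenline of the Jordan block. Its sign there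
separates `V` from `V'`. -/
theorem involutionMatrix_single_zero (r : ℕ) (d : k) :
    involutionMatrix k (r + 1) *ᵥ Pi.single 0 d = (-1 : k) ^ r • Pi.single 0 d := by
  ext i
  rw [Matrix.mulVec_single]
  induction i using Fin.cases with
  | zero => simp [involutionMatrix]
  | succ i =>
    have : (r - (i.val + 1)).choose r = 0 := Nat.choose_eq_zero_of_lt (by have := i.isLt; omega)
    simp [involutionMatrix, this]

theorem pow_ne_inv {ξ : k} {t i : ℕ} (hξ : IsPrimitiveRoot ξ t)
    (hi : 1 ≤ i ∧ i ≤ (t - 1) / 2) : ξ ^ i ≠ (ξ ^ i)⁻¹ := by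
  intro h
  have h0 : ξ ^ i ≠ 0 := pow_ne_zero _ (hξ.ne_zero (by omega))
  have h1 : ξ ^ (i + i) = 1 := by
    rw [pow_add]
    nth_rewrite 2 [h]
    exact mul_inv_cancel₀ h0
  have := Nat.le_of_dvd (by omega) ((hξ.pow_eq_one_iff_dvd _).1 h1)
  omega

theorem pow_ne_one {ξ : k} {t i : ℕ} (hξ : IsPrimitiveRoot ξ t)
    (hi : 1 ≤ i ∧ i ≤ (t - 1) / 2) : ξ ^ i ≠ 1 := by
  intro h
  exact pow_ne_inv hξ hi (by rw [h, inv_one])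

theorem pow_ne_inv_pow {ξ : k} {t i j : ℕ} (hξ : IsPrimitiveRoot ξ t)
    (hi : 1 ≤ i ∧ i ≤ (t - 1) / 2) (hj : 1 ≤ j ∧ j ≤ (t - 1) / 2) : ξ ^ i ≠ (ξ ^ j)⁻¹ := by
  intro h
  have h0 : ξ ^ j ≠ 0 := pow_ne_zero _ (hξ.ne_zero (by omega))
  have h1 : ξ ^ (i + j) = 1 := by rw [pow_add, h, inv_mul_cancel₀ h0]
  have := Nat.le_of_dvd (by omega) ((hξ.pow_eq_one_iff_dvd _).1 h1)
  omega

end Eigenvectors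

end DihedralYD


/-! ### Indecomposability and distinctness of the listed modules -/

namespace DihedralYD

open DihedralGroup YetterDrinfeldModule

section Listed

variable {k : Type u} [Field k] {p s t n : ℕ} [NeZero n] [Fact p.Prime] [CharP k p]

section Actions

variable {r' : ℕ} (hn : n = p ^ s * t) (hr : r' ≤ p ^ s) {ξ : k} (hξ : IsPrimitiveRoot ξ t)

theorem moduleV_r_one (x : Fin r' → k) : moduleV hn hr hξ (r 1) x = jordanBlock r' 1 *ᵥ x :=
  dihedralRep_r_one _ _ _ x

theorem moduleV_sr_zero (x : Fin r' → k) :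
    moduleV hn hr hξ (sr 0) x = involutionMatrix k r' *ᵥ x :=
  dihedralRep_sr_zero _ _ _ x

theorem moduleV'_r_one (x : Fin r' → k) : moduleV' hn hr hξ (r 1) x = jordanBlock r' 1 *ᵥ x :=
  dihedralRep_r_one _ _ _ x

theorem moduleV'_sr_zero (x : Fin r' → k) :
    moduleV' hn hr hξ (sr 0) x = -(involutionMatrix k r' *ᵥ x) :=
  (dihedralRep_sr_zero _ _ _ x).trans (Matrix.neg_mulVec _ _)

theorem moduleW_r_one (i : ℕ) (x : Fin r' ⊕ Fin r' → k) : moduleW hn hr hξ i (r 1) x =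
    Matrix.fromBlocks (jordanBlock r' (ξ ^ i)) 0 0 (jordanBlock r' (ξ ^ i))⁻¹ *ᵥ x :=
  dihedralRep_r_one _ _ _ x

theorem moduleW_sr_zero (i : ℕ) (x : Fin r' ⊕ Fin r' → k) : moduleW hn hr hξ i (sr 0) x =
    Matrix.fromBlocks 0 1 1 0 *ᵥ x :=
  dihedralRep_sr_zero _ _ _ x

theorem moduleU_sr_zero (j : ℕ) (h : sr 0 ∈ Subgroup.centralizer {(sr 0 : DihedralGroup n)})
    (x : k) : moduleU k n j ⟨sr 0, h⟩ x = (-1) ^ j * x := by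
  have h1 : moduleU k n j ⟨sr 0, h⟩ =
      algebraMap k (Module.End k k) ((-1) ^ j * 1 ^ (0 : ZMod n).val) := rfl
  rw [h1, one_pow, mul_one, Module.algebraMap_end_apply, smul_eq_mul]

theorem moduleQ_apply (j l : ℕ) (hl : 1 ≤ l ∧ l ≤ (n - 1) / 2) (i : ZMod n)
    (h : r i ∈ Subgroup.centralizer {(r (l : ZMod n) : DihedralGroup n)}) (x : Fin r' → k) :
    (moduleQ hn hr hξ j).comp (centralizerToCyclic hl.1 hl.2) ⟨r i, h⟩ x =
      (jordanBlock r' (ξ ^ j) ^ i.val) *ᵥ x := rfl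

theorem moduleQ_r_one (j l : ℕ) (hl : 1 ≤ l ∧ l ≤ (n - 1) / 2)
    (h : r 1 ∈ Subgroup.centralizer {(r (l : ZMod n) : DihedralGroup n)}) (x : Fin r' → k) :
    (moduleQ hn hr hξ j).comp (centralizerToCyclic hl.1 hl.2) ⟨r 1, h⟩ x =
      jordanBlock r' (ξ ^ j) *ᵥ x := by
  rw [moduleQ_apply hn hr hξ j l hl, pow_val_one (jordanBlock_pow hn hr hξ j)]

omit [NeZero n] in
theorem r_mem_centralizer (i j : ZMod n) :
    r i ∈ Subgroup.centralizer {(r j : DihedralGroup n)} := by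
  rw [Subgroup.mem_centralizer_singleton_iff, r_mul_r, r_mul_r, add_comm]

omit [NeZero n] in
theorem sr_zero_mem_centralizer :
    sr 0 ∈ Subgroup.centralizer {(sr 0 : DihedralGroup n)} := by
  rw [Subgroup.mem_centralizer_singleton_iff]

/-- The eigenvectors of `a` lie on one line in each half, and `b` exchanges these two lines; a
nonzero stable subspace therefore contains the line in the first half. -/
theorem indecOn_moduleW [IsAlgClosed k] (hr1 : 1 ≤ r') {i : ℕ}
    (hi : 1 ≤ i ∧ i ≤ (t - 1) / 2) :
    IndecOn fun N : Submodule k (Fin r' ⊕ Fin r' → k) =>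
      ∀ h, ∀ v ∈ N, moduleW hn hr hξ i h v ∈ N := by
  obtain ⟨m, rfl⟩ : ∃ m, r' = m + 1 := ⟨r' - 1, by omega⟩
  have hdet : IsUnit (jordanBlock (m + 1) (ξ ^ i)).det :=
    (Matrix.isUnit_iff_isUnit_det _).1
      (IsUnit.of_pow_eq_one (jordanBlock_pow hn hr hξ i) (NeZero.ne n))
  refine IndecOn.of_common_vector
    (Sum.elim (Pi.single 0 1) 0 : Fin (m + 1) ⊕ Fin (m + 1) → k) (fun h0 => ?_) fun N hN hb => ?_
  · simpa using congrFun h0 (Sum.inl 0)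
  · have key : ∀ d : k, d ≠ 0 →
        (Sum.elim (Pi.single 0 d) 0 : Fin (m + 1) ⊕ Fin (m + 1) → k) ∈ N →
        (Sum.elim (Pi.single 0 1) 0 : Fin (m + 1) ⊕ Fin (m + 1) → k) ∈ N := by
      intro d hd h
      have : (Sum.elim (Pi.single 0 1) 0 : Fin (m + 1) ⊕ Fin (m + 1) → k) =
          d⁻¹ • Sum.elim (Pi.single 0 d) 0 := by
        ext (j | j)
        · simp [Pi.single_apply, hd]
        · simp
      rw [this]
      exact N.smul_mem _ h
    obtain ⟨x, hx, hx0, μ, hμ⟩ := exists_eigenvector_mem hb (hN (r 1))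
    rw [moduleW_r_one] at hμ
    rcases eigenvector_fromBlocks (pow_ne_inv hξ hi) hdet hx0 hμ with
      ⟨-, d, hd, rfl⟩ | ⟨-, d, hd, rfl⟩
    · exact key d hd hx
    · refine key d hd ?_
      have := hN (sr 0) _ hx
      rw [moduleW_sr_zero, Matrix.fromBlocks_mulVec] at this
      simpa only [Sum.elim_comp_inl, Sum.elim_comp_inr, Matrix.zero_mulVec, Matrix.one_mulVec,
        add_zero, zero_add] using this

end Actions

variable {hn : n = p ^ s * t} {ξ : k} {hξ : IsPrimitiveRoot ξ t}

theorem finiteDimensional_listed (x : Index p s t n) :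
    FiniteDimensional k (listed hn hξ x).carrier := by
  cases x with
  | V r hr => exact (inferInstance : FiniteDimensional k (Fin r → k))
  | V' r hr => exact (inferInstance : FiniteDimensional k (Fin r → k))
  | W r i hr hi => exact (inferInstance : FiniteDimensional k (Fin r ⊕ Fin r → k))
  | U j hj => exact finiteDimensional_induced _ _
  | Q r j l hr hj hl => exact finiteDimensional_induced _ _

theorem indecOn_listed [IsAlgClosed k] (x : Index p s t n) :
    IndecOn (listed hn hξ x).grading.Stable := by
  cases x with
  | V r' hr =>
    refine indecOn_trivialGrading (moduleV hn hr.2 hξ)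
      (indecOn_jordanBlock hr.1 1 fun N hN x hx => ?_)
    rw [← moduleV_r_one hn hr.2 hξ]
    exact hN (r 1) x hx
  | V' r' hr =>
    refine indecOn_trivialGrading (moduleV' hn hr.2 hξ)
      (indecOn_jordanBlock hr.1 1 fun N hN x hx => ?_)
    rw [← moduleV'_r_one hn hr.2 hξ]
    exact hN (r 1) x hx
  | W r' i hr hi => exact indecOn_trivialGrading _ (indecOn_moduleW hn hr.2 hξ hr.1 hi)
  | U j hj =>
    refine indecOn_inducedGrading _ _ (IndecOn.of_common_vector (1 : k) one_ne_zero
      fun N _ hb => ?_)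
    obtain ⟨x, hx, hx0⟩ := Submodule.exists_mem_ne_zero_of_ne_bot hb
    have := N.smul_mem x⁻¹ hx
    rwa [smul_eq_mul, inv_mul_cancel₀ hx0] at this
  | Q r' j l hr hj hl =>
    refine indecOn_inducedGrading _ ((moduleQ hn hr.2 hξ j).comp (centralizerToCyclic hl.1 hl.2))
      (indecOn_jordanBlock hr.1 (ξ ^ j) fun N hN x hx => ?_)
    rw [← moduleQ_r_one hn hr.2 hξ j l hl (r_mem_centralizer 1 _)]
    exact hN _ x hx

/-- A representative of the conjugacy class that supports a listed module. -/
def Index.support : Index p s t n → DihedralGroup n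
  | .V _ _ => 1
  | .V' _ _ => 1
  | .W _ _ _ _ => 1
  | .U _ _ => sr 0
  | .Q _ _ l _ _ _ => r (l : ZMod n)

theorem supportedOn_listed (x : Index p s t n) :
    (listed hn hξ x).grading.SupportedOn x.support := by
  cases x with
  | V r' hr => exact supportedOn_trivialGrading _
  | V' r' hr => exact supportedOn_trivialGrading _
  | W r' i hr hi => exact supportedOn_trivialGrading _
  | U j hj => exact supportedOn_inducedGrading _ _
  | Q r' j l hr hj hl => exact supportedOn_inducedGrading _ _

theorem isConj_support [IsAlgClosed k] {x y : Index p s t n}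
    (h : (listed hn hξ x).grading.Iso (listed hn hξ y).grading) :
    IsConj x.support y.support :=
  have := (indecOn_listed (hn := hn) (hξ := hξ) y).1
  ((supportedOn_listed x).of_iso h).isConj (supportedOn_listed y)

theorem one_ne_neg_one (hp : Odd p) : (1 : k) ≠ -1 := by
  have h : ringChar k ≠ 2 := by
    rw [ringChar.eq k p]; rintro rfl; exact absurd hp (by decide)
  exact (Ring.neg_one_ne_one_of_char_ne_two h).symm

/-- An isomorphism matches the eigenlines of `a`, on which `b` acts by `(-1) ^ (r - 1)` and by its
negative; these differ in odd characteristic. -/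
theorem not_iso_V_V' (hp : Odd p) {r₁ r₂ : ℕ} {h₁ : r₁ ≤ p ^ s} {h₂ : r₂ ≤ p ^ s} (hr : 1 ≤ r₁)
    (e : (Fin r₁ → k) ≃ₗ[k] (Fin r₂ → k))
    (he : ∀ h x, e (moduleV hn h₁ hξ h x) = moduleV' hn h₂ hξ h (e x)) : False := by
  have ha := fun x => he (r 1) x
  have hb := fun x => he (sr 0) x
  simp only [moduleV_r_one, moduleV'_r_one, moduleV_sr_zero, moduleV'_sr_zero] at ha hb
  obtain ⟨rfl, -⟩ := jordanBlock_unique hr e ha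
  obtain ⟨m, rfl⟩ : ∃ m, r₁ = m + 1 := ⟨r₁ - 1, by omega⟩
  have hne : e (Pi.single 0 1) ≠ 0 := by rw [Ne, map_eq_zero_iff e e.injective]; simp
  obtain ⟨-, d, hd, hed⟩ := eigenvector_jordanBlock (μ := 1) hne (by
    rw [← ha, jordanBlock_mulVec_single_zero, map_smul])
  have h1 := hb (Pi.single 0 1)
  rw [involutionMatrix_single_zero, map_smul, hed, involutionMatrix_single_zero, ← neg_smul] at h1
  have h2 := congrFun h1 0
  simp only [Pi.smul_apply, Pi.single_eq_same, smul_eq_mul] at h2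
  have h3 := mul_right_cancel₀ hd h2
  rcases neg_one_pow_eq_or k m with h | h <;> rw [h] at h3
  · exact one_ne_neg_one hp h3
  · rw [neg_neg] at h3
    exact one_ne_neg_one hp h3.symm

/-- The eigenvalues of `a` on `W_{2r,i}`. -/
theorem eigenvalue_moduleW {r₁ r₂ i : ℕ} (hr : 1 ≤ r₁) {h₂ : r₂ ≤ p ^ s}
    (hi : 1 ≤ i ∧ i ≤ (t - 1) / 2) {V : Type v} [AddCommGroup V] [Module k V]
    {T : Module.End k V} {c : k} (f : (Fin r₁ → k) →ₗ[k] V) (hf : Function.Injective f)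
    (hfT : ∀ x, f (jordanBlock r₁ c *ᵥ x) = T (f x))
    (e : V ≃ₗ[k] (Fin r₂ ⊕ Fin r₂ → k)) (he : ∀ x, e (T x) = moduleW hn h₂ hξ i (r 1) (e x)) :
    c = ξ ^ i ∨ c = (ξ ^ i)⁻¹ := by
  obtain ⟨m, rfl⟩ : ∃ m, r₁ = m + 1 := ⟨r₁ - 1, by omega⟩
  have hne : e (f (Pi.single 0 1)) ≠ 0 := by
    rw [Ne, map_eq_zero_iff e e.injective, map_eq_zero_iff f hf]; simp
  have h1 : moduleW hn h₂ hξ i (r 1) (e (f (Pi.single 0 1))) = c • e (f (Pi.single 0 1)) := by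
    rw [← he, ← hfT, jordanBlock_mulVec_single_zero, map_smul, map_smul]
  rw [moduleW_r_one] at h1
  rcases Nat.eq_zero_or_pos r₂ with rfl | hr₂
  -- Size `r₂ = 0` is not excluded by the hypotheses, but the target would then have no nonzero
  -- vector.
  · exact absurd (Subsingleton.elim _ _) hne
  obtain ⟨m', rfl⟩ : ∃ m, r₂ = m + 1 := ⟨r₂ - 1, by omega⟩
  have hdet : IsUnit (jordanBlock (m' + 1) (ξ ^ i)).det :=
    (Matrix.isUnit_iff_isUnit_det _).1
      (IsUnit.of_pow_eq_one (jordanBlock_pow hn h₂ hξ i) (NeZero.ne n))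
  exact (eigenvector_fromBlocks (pow_ne_inv hξ hi) hdet hne h1).imp And.left And.left

/-- On `W_{2r,i}` the eigenvalues of `a` are `ξ ^ i` and `ξ ^ (-i)`, and the range `1 ≤ i ≤ (t - 1)
/ 2` contains at most one exponent from each such pair modulo `t`. -/
theorem index_eq_of_iso_W {r₁ r₂ i₁ i₂ : ℕ} {h₁ : 1 ≤ r₁ ∧ r₁ ≤ p ^ s} {h₂ : 1 ≤ r₂ ∧ r₂ ≤ p ^ s}
    (hi₁ : 1 ≤ i₁ ∧ i₁ ≤ (t - 1) / 2) (hi₂ : 1 ≤ i₂ ∧ i₂ ≤ (t - 1) / 2)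
    (e : (Fin r₁ ⊕ Fin r₁ → k) ≃ₗ[k] (Fin r₂ ⊕ Fin r₂ → k))
    (he : ∀ h x, e (moduleW hn h₁.2 hξ i₁ h x) = moduleW hn h₂.2 hξ i₂ h (e x)) :
    r₁ = r₂ ∧ i₁ = i₂ := by
  have hrr : r₁ = r₂ := by
    have := e.finrank_eq
    simp only [Module.finrank_fintype_fun_eq_card, Fintype.card_sum, Fintype.card_fin] at this
    omega
  refine ⟨hrr, ?_⟩
  let f : (Fin r₁ → k) →ₗ[k] (Fin r₁ ⊕ Fin r₁ → k) :=
    (LinearEquiv.sumArrowLequivProdArrow (Fin r₁) (Fin r₁) k k).symm.toLinearMap ∘ₗ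
      LinearMap.inl k _ _
  have hf : ∀ x, f x = Sum.elim x 0 := fun x => by ext (i | i) <;> rfl
  have := eigenvalue_moduleW (T := moduleW hn h₁.2 hξ i₁ (r 1)) (c := ξ ^ i₁) h₁.1 hi₂ f
    (fun x y h => by
      rw [hf, hf] at h
      exact funext fun i => congrFun h (Sum.inl i))
    (fun x => by rw [moduleW_r_one, Matrix.fromBlocks_mulVec, hf, hf]; simp) e (he (r 1))
  have h := this.resolve_right (pow_ne_inv_pow hξ hi₁ hi₂)
  exact hξ.pow_inj (by omega) (by omega) h

theorem not_iso_jordanBlock_W {r₁ r₂ i : ℕ} (hr : 1 ≤ r₁) {h₂ : r₂ ≤ p ^ s}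
    (hi : 1 ≤ i ∧ i ≤ (t - 1) / 2) (e : (Fin r₁ → k) ≃ₗ[k] (Fin r₂ ⊕ Fin r₂ → k))
    (he : ∀ x, e (jordanBlock r₁ 1 *ᵥ x) = moduleW hn h₂ hξ i (r 1) (e x)) : False := by
  have := eigenvalue_moduleW (T := (jordanBlock r₁ (1 : k)).mulVecLin) (c := 1) hr hi
    LinearMap.id Function.injective_id (fun x => rfl) e he
  have hne := pow_ne_one hξ hi
  rcases this with h | h
  · exact hne h.symm
  · exact hne (by rw [← inv_inv (ξ ^ i), ← h, inv_one])

/-- The conjugacy class of the support separates trivial coaction, `U` and `Q`, and determines `l`.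
Within one class the representations of the centralizer are compared. -/
theorem listed_injective [IsAlgClosed k] (hp : Odd p) {x y : Index p s t n}
    (h : (listed hn hξ x).grading.Iso (listed hn hξ y).grading) : x = y := by
  have hs := isConj_support h
  have hsr : ∀ {i : ZMod n}, ¬ IsConj (1 : DihedralGroup n) (sr i) := by
    intro i; rw [one_def]; exact not_isConj_r_sr 0 i
  cases x with
  | V r₁ h₁ =>
    cases y with
    | V r₂ h₂ =>
      obtain ⟨e, he⟩ := exists_equiv_of_iso_trivialGrading (ρ := moduleV hn h₁.2 hξ)
        (ρ' := moduleV hn h₂.2 hξ) h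
      have ha := fun x => he (r 1) x
      simp only [moduleV_r_one] at ha
      obtain ⟨rfl, -⟩ := jordanBlock_unique h₁.1 e ha
      rfl
    | V' r₂ h₂ =>
      obtain ⟨e, he⟩ := exists_equiv_of_iso_trivialGrading h
      exact (not_iso_V_V' hp h₁.1 e he).elim
    | W r₂ i h₂ hi =>
      obtain ⟨e, he⟩ := exists_equiv_of_iso_trivialGrading h
      exact (not_iso_jordanBlock_W h₁.1 hi e fun x => by
        rw [← moduleV_r_one hn h₁.2 hξ]; exact he _ x).elim
    | U j hj => exact (hsr hs).elim
    | Q r₂ j l h₂ hj hl => exact (not_isConj_one_r hl hs).elim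
  | V' r₁ h₁ =>
    cases y with
    | V r₂ h₂ =>
      obtain ⟨e, he⟩ := exists_equiv_of_iso_trivialGrading h.symm
      exact (not_iso_V_V' hp h₂.1 e he).elim
    | V' r₂ h₂ =>
      obtain ⟨e, he⟩ := exists_equiv_of_iso_trivialGrading (ρ := moduleV' hn h₁.2 hξ)
        (ρ' := moduleV' hn h₂.2 hξ) h
      have ha := fun x => he (r 1) x
      simp only [moduleV'_r_one] at ha
      obtain ⟨rfl, -⟩ := jordanBlock_unique h₁.1 e ha
      rfl
    | W r₂ i h₂ hi =>
      obtain ⟨e, he⟩ := exists_equiv_of_iso_trivialGrading h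
      exact (not_iso_jordanBlock_W h₁.1 hi e fun x => by
        rw [← moduleV'_r_one hn h₁.2 hξ]; exact he _ x).elim
    | U j hj => exact (hsr hs).elim
    | Q r₂ j l h₂ hj hl => exact (not_isConj_one_r hl hs).elim
  | W r₁ i₁ h₁ hi₁ =>
    cases y with
    | V r₂ h₂ =>
      obtain ⟨e, he⟩ := exists_equiv_of_iso_trivialGrading h.symm
      exact (not_iso_jordanBlock_W h₂.1 hi₁ e fun x => by
        rw [← moduleV_r_one hn h₂.2 hξ]; exact he _ x).elim
    | V' r₂ h₂ =>
      obtain ⟨e, he⟩ := exists_equiv_of_iso_trivialGrading h.symm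
      exact (not_iso_jordanBlock_W h₂.1 hi₁ e fun x => by
        rw [← moduleV'_r_one hn h₂.2 hξ]; exact he _ x).elim
    | W r₂ i₂ h₂ hi₂ =>
      obtain ⟨e, he⟩ := exists_equiv_of_iso_trivialGrading h
      obtain ⟨rfl, rfl⟩ := index_eq_of_iso_W (h₁ := h₁) (h₂ := h₂) hi₁ hi₂ e he
      rfl
    | U j hj => exact (hsr hs).elim
    | Q r₂ j l h₂ hj hl => exact (not_isConj_one_r hl hs).elim
  | U j₁ hj₁ =>
    cases y with
    | V r₂ h₂ => exact (hsr hs.symm).elim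
    | V' r₂ h₂ => exact (hsr hs.symm).elim
    | W r₂ i h₂ hi => exact (hsr hs.symm).elim
    | U j₂ hj₂ =>
      obtain ⟨e, he⟩ := exists_equiv_of_iso_inducedGrading h
      have h1 := he ⟨sr 0, sr_zero_mem_centralizer⟩ 1
      rw [moduleU_sr_zero, moduleU_sr_zero, ← smul_eq_mul, map_smul, smul_eq_mul] at h1
      have h2 := mul_right_cancel₀ (by rw [Ne, map_eq_zero_iff e e.injective]; simp) h1
      have hne := one_ne_neg_one (k := k) hp
      obtain rfl | rfl : j₁ = 1 ∨ j₁ = 2 := by omega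
      · obtain rfl | rfl : j₂ = 1 ∨ j₂ = 2 := by omega
        · rfl
        · exact absurd (by simpa using h2.symm) hne
      · obtain rfl | rfl : j₂ = 1 ∨ j₂ = 2 := by omega
        · exact absurd (by simpa using h2) hne
        · rfl
    | Q r₂ j l h₂ hj hl => exact (not_isConj_r_sr _ _ hs.symm).elim
  | Q r₁ j₁ l₁ h₁ hj₁ hl₁ =>
    cases y with
    | V r₂ h₂ => exact (not_isConj_one_r hl₁ hs.symm).elim
    | V' r₂ h₂ => exact (not_isConj_one_r hl₁ hs.symm).elim
    | W r₂ i h₂ hi => exact (not_isConj_one_r hl₁ hs.symm).elim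
    | U j hj => exact (not_isConj_r_sr _ _ hs).elim
    | Q r₂ j₂ l₂ h₂ hj₂ hl₂ =>
      obtain rfl := eq_of_isConj_r hl₁ hl₂ hs
      obtain ⟨e, he⟩ := exists_equiv_of_iso_inducedGrading
        (ρ := (moduleQ hn h₁.2 hξ j₁).comp (centralizerToCyclic hl₁.1 hl₁.2))
        (ρ' := (moduleQ hn h₂.2 hξ j₂).comp (centralizerToCyclic hl₁.1 hl₁.2)) h
      have ha := fun x => he ⟨r 1, r_mem_centralizer 1 _⟩ x
      simp only [moduleQ_r_one hn _ hξ _ _ hl₁] at ha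
      obtain ⟨rfl, hc⟩ := jordanBlock_unique h₁.1 e ha
      have ht : t ≠ 0 := by rintro rfl; exact NeZero.ne n (by simpa using hn)
      obtain rfl := hξ.pow_inj (by omega) (by omega) hc
      rfl

end Listed

end DihedralYD


namespace DihedralYD

open DihedralGroup YetterDrinfeldModule

/-! ### Completeness of the list -/

section Complete

variable {k : Type u} [Field k] [IsAlgClosed k] {p s t n : ℕ} [NeZero n] [Fact p.Prime] [CharP k p]
  {hn : n = p ^ s * t} {ξ : k} {hξ : IsPrimitiveRoot ξ t} {M : Type v} [AddCommGroup M] [Module k M]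
  [FiniteDimensional k M] {S : ConjGrading k (DihedralGroup n) M}

/-- Here the grading is trivial, and what remains is a representation of `D_n`, that is, a pair of
operators satisfying its relations. -/
theorem exists_iso_of_supportedOn_one (hp : Odd p) (ht : ¬ p ∣ t) (hodd : Odd n)
    (hS : S.SupportedOn 1) (hM : IndecOn S.Stable) :
    ∃ x : Index p s t n, S.Iso (listed hn hξ x).grading := by
  have hM' : IndecOn (PairStable (S.ρ (r 1)) (S.ρ (sr 0))) := by
    refine hM.mono fun N hN => ⟨fun h v hv => hN.rep h hv, fun g v hv => ?_⟩
    rw [hS.E_eq_ite]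
    split_ifs
    · exact hv
    · exact N.zero_mem
  obtain ⟨r', hr, ⟨ε, hε, e, ha, hb⟩ | ⟨i, hi, e, ha, hb⟩⟩ := exists_equiv_of_pair hp ht hn hodd hξ
    rep_pow rep_sr_mul_self rep_relation hM'
  · rcases hε with rfl | rfl
    · refine ⟨.V r' hr, iso_trivialGrading (ρ' := moduleV hn hr.2 hξ) hS e
        (map_rep_of_generators (e := e.toLinearMap) (fun v => ?_) fun v => ?_)⟩
      · rw [moduleV_r_one]; exact ha v
      · rw [moduleV_sr_zero, ← one_smul k (involutionMatrix k r' *ᵥ v)]; exact hb v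
    · refine ⟨.V' r' hr, iso_trivialGrading (ρ' := moduleV' hn hr.2 hξ) hS e
        (map_rep_of_generators (e := e.toLinearMap) (fun v => ?_) fun v => ?_)⟩
      · rw [moduleV'_r_one]; exact ha v
      · rw [moduleV'_sr_zero, ← neg_one_smul k (involutionMatrix k r' *ᵥ v)]; exact hb v
  · refine ⟨.W r' i hr hi, iso_trivialGrading (ρ' := moduleW hn hr.2 hξ i) hS e
      (map_rep_of_generators (e := e.toLinearMap) (fun v => ?_) fun v => ?_)⟩
    · rw [moduleW_r_one]; exact ha v
    · rw [moduleW_sr_zero]; exact hb v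

theorem exists_iso_of_supportedOn_sr_zero (hp : Odd p) (hodd : Odd n)
    (hS : S.SupportedOn (sr 0)) (hM : IndecOn S.Stable) :
    ∃ x : Index p s t n, S.Iso (listed hn hξ x).grading := by
  have hst : ∀ v ∈ S.fiber (sr 0), S.ρ (sr 0) v ∈ S.fiber (sr 0) := fun v hv =>
    ConjGrading.ρ_mem_fiber (Commute.refl _) hv
  set B : Module.End k (S.fiber (sr 0)) := (S.ρ (sr 0)).restrict hst with hB
  have hBv : ∀ v, (B v : M) = S.ρ (sr 0) v := fun v => rfl
  have hB2 : B ^ 2 = 1 := by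
    ext v
    rw [pow_two, Module.End.mul_apply, hBv, hBv, ← Module.End.mul_apply, rep_sr_mul_self]; rfl
  have hF : IndecOn fun N : Submodule k (S.fiber (sr 0)) => ∀ v ∈ N, B v ∈ N := by
    refine (ConjGrading.indecOn_fiber hS hM).mono fun N hN h hc v hv w hw => ?_
    rcases commute_sr_zero hodd hc with rfl | rfl
    · rw [map_one, Module.End.one_apply] at hw
      rwa [Subtype.ext hw]
    · have : w = B v := Subtype.ext hw
      rw [this]
      exact hN v hv
  have hp2 : p ≠ 2 := by rintro rfl; exact absurd hp (by decide)
  have h2 : ¬ p ∣ 2 := fun h =>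
    hp2 ((Nat.prime_dvd_prime_iff_eq Fact.out Nat.prime_two).1 h)
  -- The classification for cyclic groups is applied to the group `{1, b}` of order `2 = p ^ 0 * 2`,
  -- with the primitive root `-1`; block sizes are then at most `p ^ 0 = 1`.
  obtain ⟨r', j, ⟨hr1, hr2⟩, hj, e, he⟩ := exists_equiv_jordanBlock_of_pow_eq_one (n := 2)
    (s := 0) (t := 2) (p := p) (by simp) h2 hB2 (IsPrimitiveRoot.neg_one (R := k) p hp2) hF
  obtain rfl : r' = 1 := le_antisymm (by simpa using hr2) hr1
  -- The exponent found is `0` or `1`, whereas the list is indexed by `1` and `2`; only its parity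
  -- matters.
  obtain ⟨j', hj', hjj⟩ : ∃ j', (1 ≤ j' ∧ j' ≤ 2) ∧ (-1 : k) ^ j' = (-1) ^ j := by
    obtain rfl | rfl : j = 0 ∨ j = 1 := by omega
    · exact ⟨2, by omega, by simp⟩
    · exact ⟨1, by omega, rfl⟩
  let e' : k ≃ₗ[k] S.fiber (sr 0) := (LinearEquiv.funUnique (Fin 1) k k).symm ≪≫ₗ e
  have he' : ∀ x, e' ((-1) ^ j' * x) = B (e' x) := by
    intro x
    simp only [e', LinearEquiv.trans_apply]
    rw [← he]
    congr 1
    ext i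
    rw [jordanBlock_mulVec, hjj]
    simp
  refine ⟨.U j' hj', iso_inducedGrading (ρ := moduleU k n j') hS e' fun c x => ?_⟩
  obtain ⟨c, hc⟩ := c
  rcases commute_sr_zero hodd (Subgroup.mem_centralizer_singleton_iff.1 hc) with rfl | rfl
  · have : (⟨1, hc⟩ : Subgroup.centralizer {(sr 0 : DihedralGroup n)}) = 1 := rfl
    rw [this, map_one]
    simp
  · rw [moduleU_sr_zero, he', hBv]

theorem exists_iso_of_supportedOn_r (ht : ¬ p ∣ t) {l : ℕ} (hl : 1 ≤ l ∧ l ≤ (n - 1) / 2)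
    (hS : S.SupportedOn (r (l : ZMod n))) (hM : IndecOn S.Stable) :
    ∃ x : Index p s t n, S.Iso (listed hn hξ x).grading := by
  have hst : ∀ v ∈ S.fiber (r (l : ZMod n)), S.ρ (r 1) v ∈ S.fiber (r (l : ZMod n)) := fun v hv =>
    ConjGrading.ρ_mem_fiber (Subgroup.mem_centralizer_singleton_iff.1 (r_mem_centralizer 1 _)) hv
  set A : Module.End k (S.fiber (r (l : ZMod n))) := (S.ρ (r 1)).restrict hst with hA
  have hAv : ∀ (m : ℕ) v, ((A ^ m) v : M) = (S.ρ (r 1) ^ m) v := fun m v => by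
    rw [hA, Module.End.pow_restrict]; rfl
  have hAn : A ^ n = 1 := by
    ext v
    rw [hAv, rep_pow]; rfl
  have hF : IndecOn fun N : Submodule k (S.fiber (r (l : ZMod n))) => ∀ v ∈ N, A v ∈ N := by
    refine (ConjGrading.indecOn_fiber hS hM).mono fun N hN h hc v hv w hw => ?_
    obtain ⟨i, rfl⟩ := exists_eq_r_of_mem_centralizer hl.1 hl.2
      (Subgroup.mem_centralizer_singleton_iff.2 hc)
    -- The centralizer consists of powers of `a`, so stability under the single operator `A` is
    -- enough.
    have : w = (A ^ i.val) v := Subtype.ext (by rw [hw, rep_r, hAv])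
    rw [this]
    exact pow_mem_of_forall hN _ hv
  obtain ⟨r', j, hr, hj, e, he⟩ := exists_equiv_jordanBlock_of_pow_eq_one hn ht hAn hξ hF
  have hem : ∀ (m : ℕ) x, e ((jordanBlock r' (ξ ^ j) ^ m) *ᵥ x) = (A ^ m) (e x) := by
    intro m
    induction m with
    | zero => intro x; simp
    | succ m ih =>
      intro x
      rw [pow_succ, pow_succ, ← Matrix.mulVec_mulVec, ih, he, Module.End.mul_apply]
  refine ⟨.Q r' j l hr (by omega) hl, iso_inducedGrading
    (ρ := (moduleQ hn hr.2 hξ j).comp (centralizerToCyclic hl.1 hl.2)) hS e fun c x => ?_⟩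
  obtain ⟨c, hc⟩ := c
  obtain ⟨i, rfl⟩ := exists_eq_r_of_mem_centralizer hl.1 hl.2 hc
  rw [moduleQ_apply hn hr.2 hξ j l hl, hem, hAv]
  exact (LinearMap.congr_fun (rep_r i) _).symm

theorem exists_iso_listed (hp : Odd p) (ht : ¬ p ∣ t) (hodd : Odd n) (hM : IndecOn S.Stable) :
    ∃ x : Index p s t n, S.Iso (listed hn hξ x).grading := by
  obtain ⟨g, hg⟩ := ConjGrading.exists_supportedOn hM
  rcases exists_isConj hodd g with h | h | ⟨l, hl, h⟩
  · exact exists_iso_of_supportedOn_one hp ht hodd (hg.conj h.symm) hM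
  · exact exists_iso_of_supportedOn_sr_zero hp hodd (hg.conj h.symm) hM
  · exact exists_iso_of_supportedOn_r ht hl (hg.conj h.symm) hM

end Complete

end DihedralYD

end

/-! ### The classification theorem -/

theorem mainTheorem1 {k : Type u} [Field k] [IsAlgClosed k] {p : ℕ} [Fact p.Prime] [CharP k p]
    (hp : Odd p) {s t n : ℕ} [NeZero n] (ht : ¬ p ∣ t) (hn : n = p ^ s * t) (hodd : Odd n)
    {ξ : k} (hξ : IsPrimitiveRoot ξ t) :
    -- the listed Yetter-Drinfeld modules are finite dimensional and indecomposable,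
    (∀ x : DihedralYD.Index p s t n,
      FiniteDimensional k (DihedralYD.listed hn hξ x).carrier ∧
        (DihedralYD.listed hn hξ x).IsIndecomposable) ∧
    -- pairwise non-isomorphic,
    (∀ x y : DihedralYD.Index p s t n,
      (DihedralYD.listed hn hξ x).Isomorphic (DihedralYD.listed hn hξ y) → x = y) ∧
    -- and every finite dimensional indecomposable Yetter-Drinfeld module is isomorphic to one;
    (∀ M : YetterDrinfeldModule.{u, v, u} k (MonoidAlgebra k (DihedralGroup n)),
      FiniteDimensional k M.carrier → M.IsIndecomposable →
        ∃ x : DihedralYD.Index p s t n, M.Isomorphic (DihedralYD.listed hn hξ x)) ∧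
    -- the same three assertions for the corresponding modules over the quantum double
    (∀ x : DihedralYD.Index p s t n,
      IsIndecomposableModule (DrinfeldDouble k (DihedralGroup n))
        (DihedralYD.listed hn hξ x).carrier) ∧
    (∀ x y : DihedralYD.Index p s t n,
      Nonempty ((DihedralYD.listed hn hξ x).carrier ≃ₗ[DrinfeldDouble k (DihedralGroup n)]
        (DihedralYD.listed hn hξ y).carrier) → x = y) ∧
    (∀ (M : Type v) [AddCommGroup M] [Module k M] [Module (DrinfeldDouble k (DihedralGroup n)) M]
        [IsScalarTower k (DrinfeldDouble k (DihedralGroup n)) M],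
      FiniteDimensional k M → IsIndecomposableModule (DrinfeldDouble k (DihedralGroup n)) M →
        ∃ x : DihedralYD.Index p s t n,
          Nonempty (M ≃ₗ[DrinfeldDouble k (DihedralGroup n)]
            (DihedralYD.listed hn hξ x).carrier)) := by
  have hind := fun x => DihedralYD.indecOn_listed (hn := hn) (hξ := hξ) x
  refine ⟨fun x => ⟨DihedralYD.finiteDimensional_listed x,
      (YetterDrinfeldModule.isIndecomposable_iff _).2 (hind x)⟩,
    fun x y h => DihedralYD.listed_injective hp ((YetterDrinfeldModule.isomorphic_iff _ _).1 h),
    fun M hM hM' => ?_, fun x => ?_, fun x y h => ?_, fun M _ _ _ _ hM hM' => ?_⟩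
  · obtain ⟨x, hx⟩ := DihedralYD.exists_iso_listed (hn := hn) (hξ := hξ) hp ht hodd
      ((YetterDrinfeldModule.isIndecomposable_iff M).1 hM')
    exact ⟨x, (YetterDrinfeldModule.isomorphic_iff _ _).2 hx⟩
  -- The assertions over the quantum double reduce to the same statements about graded
  -- representations.
  · rw [DrinfeldDouble.isIndecomposableModule_iff (k := k),
      DrinfeldDouble.grading_yetterDrinfeldModule]
    exact hind x
  · rw [DrinfeldDouble.nonempty_linearEquiv_iff, DrinfeldDouble.grading_yetterDrinfeldModule,
      DrinfeldDouble.grading_yetterDrinfeldModule] at h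
    exact DihedralYD.listed_injective hp h
  · obtain ⟨x, hx⟩ := DihedralYD.exists_iso_listed (hn := hn) (hξ := hξ) hp ht hodd
      (DrinfeldDouble.isIndecomposableModule_iff.1 hM')
    refine ⟨x, ?_⟩
    rw [DrinfeldDouble.nonempty_linearEquiv_iff, DrinfeldDouble.grading_yetterDrinfeldModule]
    exact hx
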